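/- All graphs are finite, simple and undirected; $n=|V(G)|$. Fix an integer $t\ge 3$. **Definitions.** For a graph $G$ and a family $\mathcal H$ of vertex sets of $G$, let $\mathsf{sol}_t(G,\mathcal H)$ be the collection of all $S\subseteq V(G)$ such that $G-S$ contains no $K_t$ and $S\cap Z\neq\emptyset$ for every $Z\in\mathcal H$. Put $\mathrm{opt}(G,\mathcal H)=\min\{|S| : S\in\mathsf{sol}_t(G,\mathcal H)\}$ and $\mathrm{opt}(G)=\mathrm{opt}(G,\emptyset)$. The pair $(G,\mathcal H)$ is *clean* if $\mathrm{opt}(G,\mathcal H)=\mathrm{opt}(G)$. A *root* of a connected graph $G$ is a nonempty set $T\subseteq V(G)$ such that $G[T]$ is connected and $K_t$-free and every connected component of $G-T$ is adjacent to exactly one vertex of $T$. The parameter $\mathrm{bed}^+_t(G)$ is defined recursively, the first applicable case being used: - $\mathrm{bed}^+_t(G)=0$ if $V(G)=\emptyset$; - $\mathrm{bed}^+_t(G)=\mathrm{bed}^+_t(G-v)$ if $v$ is a vertex contained in no copy of $K_t$ in $G$; - $\mathrm{bed}^+_t(G)=\max_i \mathrm{bed}^+_t(C_i)$ if $G$ is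 disconnected with connected components $C_1,\dots,C_c$; - $\mathrm{bed}^+_t(G)=1+\min_T \mathrm{bed}^+_t(G-T)$ otherwise, where $T$ ranges over all roots of $G$. In both parts the input family is a (repetition-free) set of vertex sets $Z$ such that $1\le |Z|\le t-1$ and $G[Z]$ is complete. **Claim.** (1) There are an algorithm and a constant $c=c(t)$ such that, given a graph $G$, such a family $\mathcal H$, and integers $\lambda,\kappa\ge 0$, the algorithm outputs a set $S\in\mathsf{sol}_t(G,\mathcal H)$ in time at most $\max(n,2)^{c((\lambda+\kappa)^2+1)}$, that is, $n^{O_t((\lambda+\kappa)^2)}$; and whenever $\mathrm{bed}^+_t(G)\le\lambda$ and $\mathrm{opt}(G,\mathcal H)\le\mathrm{opt}(G)+\kappa$, one has $|S|=\mathrm{opt}(G,\mathcal H)$. (2) There are an algorithm and a constant $c'=c'(t)$ such that, given a graph $G$, such a family $\mathcal F$, and an integer $\lambda\ge 0$ with $\mathrm{bed}^+_t(G)\le\lambda$, the algorithm outputs the value $\mathrm{opt}(G)$ and whether $(G,\mathcal F)$ is clean, in time at most $\max(n,2)^{c'(\lambda^2+1)}$, that is, $n^{O_t(\lambda^2)}$.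 -/

import Mathlib

/-! ### Cliques, hitting sets, and the optimum -/

/-- Instances of the extended `K_t`-hitting problem: every member of `H` is the vertex set of a
complete subgraph of `G` with at least one and fewer than `t` vertices. -/
def IsCliqueFamily {V : Type*} (t : ℕ) (G : SimpleGraph V) (H : Finset (Finset V)) : Prop :=
  ∀ Z ∈ H, Z.Nonempty ∧ Z.card < t ∧ G.IsClique (Z : Set V)

/-- `sol_t(G,H)`: the vertex sets `S` such that `G - S` is `K_t`-free and `S` meets every member
of `H`. -/
def sol {V : Type*} [DecidableEq V] (t : ℕ) (G : SimpleGraph V) (H : Finset (Finset V)) :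
    Set (Finset V) :=
  {S | (G.induce ((S : Set V)ᶜ)).CliqueFree t ∧ ∀ Z ∈ H, (S ∩ Z).Nonempty}

/-- `opt(G,H)`, the minimum size of a set in `sol_t(G,H)`; `opt(G) = opt(G,∅)`. -/
noncomputable def opt {V : Type*} [DecidableEq V] (t : ℕ) (G : SimpleGraph V)
    (H : Finset (Finset V)) : ℕ :=
  sInf {k | ∃ S ∈ sol t G H, S.card = k}

/-- `(G,F)` is clean if `opt(G,F) = opt(G)`. -/
def IsClean {V : Type*} [DecidableEq V] (t : ℕ) (G : SimpleGraph V) (F : Finset (Finset V)) :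
    Prop :=
  opt t G F = opt t G ∅

/-! ### The parameter `bed⁺_t`

The recursion runs over induced subgraphs `G[A]`, given by their vertex sets `A`. -/

/-- `v` lies in some copy of `K_t` in `G[A]`. -/
def InClique {V : Type*} (t : ℕ) (G : SimpleGraph V) (A : Finset V) (v : V) : Prop :=
  ∃ K : Finset V, K ⊆ A ∧ v ∈ K ∧ G.IsNClique t K

open Classical in
/-- The vertex set of the connected component of `v` in `G[A]`. -/
noncomputable def componentIn {V : Type*} (G : SimpleGraph V) (A : Finset V) (v : A) : Finset V :=
  A.filter fun u => ∃ hu : u ∈ A, (G.induce (A : Set V)).Reachable ⟨u, hu⟩ v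

/-- `T` is a root of the connected graph `G[A]` (for the forbidden graph `K_t`): `T` is a nonempty
subset of `A`, the graph `G[T]` is connected and `K_t`-free, and every connected component of
`G[A] - T` has exactly one neighbour in `T`. -/
def IsRoot {V : Type*} [DecidableEq V] (t : ℕ) (G : SimpleGraph V) (A T : Finset V) : Prop :=
  T.Nonempty ∧ T ⊆ A ∧ (G.induce (T : Set V)).Connected ∧ (G.induce (T : Set V)).CliqueFree t ∧
    ∀ C : (G.induce ((A \ T : Finset V) : Set V)).ConnectedComponent,
      ∃! w : V, w ∈ T ∧ ∃ u ∈ C.supp, G.Adj (u : V) w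

theorem componentIn_ssubset {V : Type*} (G : SimpleGraph V) (A : Finset V)
    (h : ¬ (G.induce (A : Set V)).Preconnected) (v : A) : componentIn G A v ⊂ A := by
  classical
  refine Finset.ssubset_iff_subset_ne.2 ⟨Finset.filter_subset _ _, fun he => h ?_⟩
  have key : ∀ u : (A : Set V), (G.induce (A : Set V)).Reachable u v := by
    intro u
    have hu : (u : V) ∈ componentIn G A v := by rw [he]; exact u.2
    obtain ⟨_, hr⟩ := (Finset.mem_filter.1 hu).2
    exact hr
  exact fun x y => (key x).trans (key y).symm

theorem IsRoot.sdiff_card_lt {V : Type*} [DecidableEq V] {t : ℕ} {G : SimpleGraph V}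
    {A T : Finset V} (h : IsRoot t G A T) : (A \ T).card < A.card :=
  Finset.card_lt_card (Finset.sdiff_ssubset h.2.1 h.1)

open Classical in
/-- `bed⁺_t(G[A])`, by the four-case recursion: it is `0` if `A = ∅`; a vertex lying in no copy of
`K_t` is deleted for free; a disconnected graph takes the maximum over its connected components;
otherwise it is `1` plus the minimum of `bed⁺_t(G[A] - T)` over all roots `T` of `G[A]`. -/
noncomputable def bedPlusOn {V : Type*} [DecidableEq V] (t : ℕ) (G : SimpleGraph V)
    (A : Finset V) : ℕ :=
  if A = ∅ then 0
  else if hv : ∃ v ∈ A, ¬ InClique t G A v then bedPlusOn t G (A.erase hv.choose)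
  else if hc : ¬ (G.induce (A : Set V)).Preconnected then
    A.attach.sup fun v => bedPlusOn t G (componentIn G A v)
  else 1 + sInf {k | ∃ T, ∃ _h : IsRoot t G A T, k = bedPlusOn t G (A \ T)}
termination_by A.card
decreasing_by
  · exact Finset.card_erase_lt_of_mem hv.choose_spec.1
  · exact Finset.card_lt_card (componentIn_ssubset G A hc v)
  · exact IsRoot.sdiff_card_lt _h

/-- `bed⁺_t(G)`. -/
noncomputable def bedPlus {V : Type*} [Fintype V] [DecidableEq V] (t : ℕ) (G : SimpleGraph V) :
    ℕ :=
  bedPlusOn t G Finset.univ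

/-! ### Algorithms and running time

Algorithms are programs of a first-order functional language (pure Lisp). Data are natural numbers
and pairs; pairing, projections, addition, truncated subtraction, comparison and function calls
each cost one step. As on a random access machine with unit-cost addition and subtraction, every
step is elementary: data are shared, never copied or compared as a whole, and no multiplication is
available, so programs and Turing machines simulate each other with polynomial overhead. -/

/-- Data values. -/
inductive Val where
  | num (k : ℕ) : Val
  | pair (a b : Val) : Val

/-- First component (`0` for a number). -/
def Val.left : Val → Val
  | .num _ => .num 0
  | .pair a _ => a

/-- Second component (`0` for a number). -/
def Val.right : Val → Val
  | .num _ => .num 0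
  | .pair _ b => b

/-- Numerical value (`0` for a pair). -/
def Val.toNat : Val → ℕ
  | .num k => k
  | .pair _ _ => 0

/-- Expressions; variables are de Bruijn indices, functions are referred to by their index in the
program. -/
inductive Expr where
  | var (i : ℕ) : Expr
  | lit (k : ℕ) : Expr
  | pair (a b : Expr) : Expr
  | left (a : Expr) : Expr
  | right (a : Expr) : Expr
  | add (a b : Expr) : Expr
  | sub (a b : Expr) : Expr
  /-- if `a ≤ b` then `e₁` else `e₂` -/
  | ifLe (a b e₁ e₂ : Expr) : Expr
  /-- if `a` is a pair then `e₁` else `e₂` -/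
  | ifPair (a e₁ e₂ : Expr) : Expr
  /-- evaluate `b` with the value of `a` as the new variable `0` -/
  | bind (a b : Expr) : Expr
  /-- call function number `f` with argument `a` -/
  | call (f : ℕ) (a : Expr) : Expr

/-- A program is a finite list of function bodies, each with one argument (its variable `0`);
function number `0` is the main function. -/
abbrev Program : Type := List Expr

/-- The body of function number `f`. -/
def Program.body (P : Program) (f : ℕ) : Expr := P.getD f (.lit 0)

/-- `P.Eval ρ e v c`: call-by-value evaluation of the expression `e`, with the values `ρ` of the
variables, terminates with value `v` after exactly `c` steps. -/
inductive Program.Eval (P : Program) : List Val → Expr → Val → ℕ → Prop where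
  | var (ρ : List Val) (i : ℕ) : Eval P ρ (.var i) (ρ.getD i (.num 0)) 1
  | lit (ρ : List Val) (k : ℕ) : Eval P ρ (.lit k) (.num k) 1
  | pair {ρ : List Val} {a b : Expr} {x y : Val} {c d : ℕ} :
      Eval P ρ a x c → Eval P ρ b y d → Eval P ρ (.pair a b) (.pair x y) (c + d + 1)
  | left {ρ : List Val} {a : Expr} {x : Val} {c : ℕ} :
      Eval P ρ a x c → Eval P ρ (.left a) x.left (c + 1)
  | right {ρ : List Val} {a : Expr} {x : Val} {c : ℕ} :
      Eval P ρ a x c → Eval P ρ (.right a) x.right (c + 1)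
  | add {ρ : List Val} {a b : Expr} {x y : Val} {c d : ℕ} :
      Eval P ρ a x c → Eval P ρ b y d → Eval P ρ (.add a b) (.num (x.toNat + y.toNat)) (c + d + 1)
  | sub {ρ : List Val} {a b : Expr} {x y : Val} {c d : ℕ} :
      Eval P ρ a x c → Eval P ρ b y d → Eval P ρ (.sub a b) (.num (x.toNat - y.toNat)) (c + d + 1)
  | ifLe_true {ρ : List Val} {a b e₁ e₂ : Expr} {x y z : Val} {c d m : ℕ} :
      Eval P ρ a x c → Eval P ρ b y d → x.toNat ≤ y.toNat → Eval P ρ e₁ z m →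
        Eval P ρ (.ifLe a b e₁ e₂) z (c + d + m + 1)
  | ifLe_false {ρ : List Val} {a b e₁ e₂ : Expr} {x y z : Val} {c d m : ℕ} :
      Eval P ρ a x c → Eval P ρ b y d → ¬ x.toNat ≤ y.toNat → Eval P ρ e₂ z m →
        Eval P ρ (.ifLe a b e₁ e₂) z (c + d + m + 1)
  | ifPair_true {ρ : List Val} {a e₁ e₂ : Expr} {x y z : Val} {c m : ℕ} :
      Eval P ρ a (.pair x y) c → Eval P ρ e₁ z m → Eval P ρ (.ifPair a e₁ e₂) z (c + m + 1)
  | ifPair_false {ρ : List Val} {a e₁ e₂ : Expr} {k : ℕ} {z : Val} {c m : ℕ} :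
      Eval P ρ a (.num k) c → Eval P ρ e₂ z m → Eval P ρ (.ifPair a e₁ e₂) z (c + m + 1)
  | bind {ρ : List Val} {a b : Expr} {x y : Val} {c d : ℕ} :
      Eval P ρ a x c → Eval P (x :: ρ) b y d → Eval P ρ (.bind a b) y (c + d + 1)
  | call {ρ : List Val} {f : ℕ} {a : Expr} {x y : Val} {c d : ℕ} :
      Eval P ρ a x c → Eval P [x] (P.body f) y d → Eval P ρ (.call f a) y (c + d + 1)

/-- Evaluation is deterministic: output and number of steps are determined by the input. -/
theorem Program.Eval.unique {P : Program} {ρ : List Val} {e : Expr} {v : Val} {c : ℕ}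
    (h : P.Eval ρ e v c) : ∀ {v' : Val} {c' : ℕ}, P.Eval ρ e v' c' → v = v' ∧ c = c' := by
  induction h with
  | var => intro v' c' h'; cases h'; exact ⟨rfl, rfl⟩
  | lit => intro v' c' h'; cases h'; exact ⟨rfl, rfl⟩
  | left _ ih =>
    intro v' c' h'; cases h' with
    | left g => obtain ⟨rfl, rfl⟩ := ih g; exact ⟨rfl, rfl⟩
  | right _ ih =>
    intro v' c' h'; cases h' with
    | right g => obtain ⟨rfl, rfl⟩ := ih g; exact ⟨rfl, rfl⟩
  | pair _ _ ih₁ ih₂ =>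
    intro v' c' h'; cases h' with
    | pair g₁ g₂ => obtain ⟨rfl, rfl⟩ := ih₁ g₁; obtain ⟨rfl, rfl⟩ := ih₂ g₂; exact ⟨rfl, rfl⟩
  | add _ _ ih₁ ih₂ =>
    intro v' c' h'; cases h' with
    | add g₁ g₂ => obtain ⟨rfl, rfl⟩ := ih₁ g₁; obtain ⟨rfl, rfl⟩ := ih₂ g₂; exact ⟨rfl, rfl⟩
  | sub _ _ ih₁ ih₂ =>
    intro v' c' h'; cases h' with
    | sub g₁ g₂ => obtain ⟨rfl, rfl⟩ := ih₁ g₁; obtain ⟨rfl, rfl⟩ := ih₂ g₂; exact ⟨rfl, rfl⟩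
  | bind _ _ ih₁ ih₂ =>
    intro v' c' h'; cases h' with
    | bind g₁ g₂ => obtain ⟨rfl, rfl⟩ := ih₁ g₁; obtain ⟨rfl, rfl⟩ := ih₂ g₂; exact ⟨rfl, rfl⟩
  | call _ _ ih₁ ih₂ =>
    intro v' c' h'; cases h' with
    | call g₁ g₂ => obtain ⟨rfl, rfl⟩ := ih₁ g₁; obtain ⟨rfl, rfl⟩ := ih₂ g₂; exact ⟨rfl, rfl⟩
  | ifLe_true _ _ hl _ ih₁ ih₂ ih₃ =>
    intro v' c' h'; cases h' with
    | ifLe_true g₁ g₂ _ g₃ =>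
      obtain ⟨rfl, rfl⟩ := ih₁ g₁; obtain ⟨rfl, rfl⟩ := ih₂ g₂; obtain ⟨rfl, rfl⟩ := ih₃ g₃
      exact ⟨rfl, rfl⟩
    | ifLe_false g₁ g₂ hl' _ =>
      obtain ⟨rfl, rfl⟩ := ih₁ g₁; obtain ⟨rfl, rfl⟩ := ih₂ g₂; exact absurd hl hl'
  | ifLe_false _ _ hl _ ih₁ ih₂ ih₃ =>
    intro v' c' h'; cases h' with
    | ifLe_true g₁ g₂ hl' _ =>
      obtain ⟨rfl, rfl⟩ := ih₁ g₁; obtain ⟨rfl, rfl⟩ := ih₂ g₂; exact absurd hl' hl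
    | ifLe_false g₁ g₂ _ g₃ =>
      obtain ⟨rfl, rfl⟩ := ih₁ g₁; obtain ⟨rfl, rfl⟩ := ih₂ g₂; obtain ⟨rfl, rfl⟩ := ih₃ g₃
      exact ⟨rfl, rfl⟩
  | ifPair_true _ _ ih₁ ih₂ =>
    intro v' c' h'; cases h' with
    | ifPair_true g₁ g₂ =>
      obtain ⟨_, rfl⟩ := ih₁ g₁; obtain ⟨rfl, rfl⟩ := ih₂ g₂; exact ⟨rfl, rfl⟩
    | ifPair_false g₁ _ => exact absurd (ih₁ g₁).1 (by simp)
  | ifPair_false _ _ ih₁ ih₂ =>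
    intro v' c' h'; cases h' with
    | ifPair_true g₁ _ => exact absurd (ih₁ g₁).1 (by simp)
    | ifPair_false g₁ g₂ =>
      obtain ⟨_, rfl⟩ := ih₁ g₁; obtain ⟨rfl, rfl⟩ := ih₂ g₂; exact ⟨rfl, rfl⟩

/-- On input `x`, the program `P` halts with output `y` after exactly `c` steps. -/
def Program.Runs (P : Program) (x y : Val) (c : ℕ) : Prop := P.Eval [x] (P.body 0) y c

/-! ### Encoding of inputs and outputs -/

/-- Lists are right-nested pairs ending in `0`. -/
def encList (l : List Val) : Val := l.foldr Val.pair (.num 0)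

/-- A vertex set is given by its list of `n` membership bits. -/
def encSet {n : ℕ} (S : Finset (Fin n)) : Val :=
  encList (List.ofFn fun i => Val.num (if i ∈ S then 1 else 0))

open Classical in
/-- A graph is given by its adjacency matrix. -/
noncomputable def encGraph {n : ℕ} (G : SimpleGraph (Fin n)) : Val :=
  encList (List.ofFn fun i => encList (List.ofFn fun j => Val.num (if G.Adj i j then 1 else 0)))

/-- The list `hs` enumerates the family `H` without repetition. -/
def Enumerates {n : ℕ} (hs : List (Finset (Fin n))) (H : Finset (Finset (Fin n))) : Prop :=
  hs.Nodup ∧ ∀ Z, Z ∈ hs ↔ Z ∈ H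

/-- The input consisting of `n`, the graph, the listed family, and the integer parameters. -/
noncomputable def encInput {n : ℕ} (G : SimpleGraph (Fin n)) (hs : List (Finset (Fin n)))
    (params : List ℕ) : Val :=
  encList ([.num n, encGraph G, encList (hs.map encSet)] ++ params.map Val.num)

open Classical in
/-- The truth value of a proposition as an output bit. -/
noncomputable def encBool (p : Prop) : Val := .num (if p then 1 else 0)

/-! ### Evaluation within a budget -/

/-! The algorithm solves instances (A, F): A is the part still to be solved and F is a set of
vertices outside A already decided to be kept. A constraint (a t-clique or a member of the given
family) is relevant when it meets A and lies in A ∪ F; vertices put into the solution simply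
disappear from the instance. The excess of a solution S on A is |S| minus the least number of
vertices hitting the t-cliques inside A. At the start A is everything, F is empty, and the promise
says that an optimal solution has excess at most κ. Guessing is affordable because excess bounds
what has to be guessed.

Split (`solves_solveSplit`). Removing from S its vertices in no t-clique of G[A] unhits no t-clique,
so there are at most k of them. Guess them and move the other inactive vertices to F. A clique meets
at most one component of the active part, so the components are then independent.

Root (`solveRoot_card_le`). Given a root T of a connected G[C], each w in T carries a pendant part
P(w), and a clique not inside T (up to F) lies in a single P(w) ∪ {w}. For each w there are two
candidates: take w and solve P(w), or keep w and solve P(w) with w added to F. Use the smaller valid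
one, except on a guessed set Y where w is forced in. The right Y consists of those w in S where
keeping w would be valid and strictly cheaper. Exchanging S for the cheaper option at all of them
saves |Y| vertices and still hits every t-clique, so |Y| ≤ k. On P(w) the excess is at most k + 1,
since w may complete a hitting set of P(w) to one of P(w) ∪ {w}.

Choosing the root (`freeHull_spec`). There may be exponentially many roots, but those containing a
fixed vertex v all lie in a largest one: path-closed sets sharing a vertex have a path-closed union,
and a clique in the union lies in one of them. The largest one is the set reachable from v along
edges whose blocks contain no t-clique. Enlarging a root only shrinks what is left, so trying one
hull per vertex v suffices.

Depth (`depthLE_of_bedPlusOn`). The parameter `bedPlus` is replaced by the hereditary predicate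
`DepthLE`, which survives every passage to a subset that the recursion makes. Each level lowers the
depth by one and raises the excess by one, so their sum stays at most λ + κ, each level costs
n^{O_t(λ+κ)} times the cost of the next, and λ + 1 levels give n^{O_t((λ+κ)²)} (`calls_solve`,
`cost_le_pow`). Part (2) is the case κ = 0, run once with and once without the family. -/

/-- A base `B` exceeding the vertex count `n`, and a number `τ` of steps: costs are measured
as `B ^ C * τ` with explicit exponents `C`. -/
structure Budget (n : ℕ) where
  B : ℕ
  τ : ℕ
  hn : n + 2 ≤ B
  hτ : 1 ≤ τ

/-- The cost allowance with exponent `C`. -/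
def Budget.cost {n : ℕ} (X : Budget n) (C : ℕ) : ℕ := X.B ^ C * X.τ

/-- `e` evaluates to `v` in at most `X.cost C` steps. -/
def Within {n : ℕ} (X : Budget n) (P : Program) (C : ℕ) (ρ : List Val) (e : Expr)
    (v : Val) : Prop :=
  ∃ c, P.Eval ρ e v c ∧ c ≤ X.cost C

namespace Budget

variable {n : ℕ} (X : Budget n)

theorem two_le : 2 ≤ X.B := le_trans (by omega) X.hn

theorem cost_mono {a b : ℕ} (h : a ≤ b) : X.cost a ≤ X.cost b :=
  Nat.mul_le_mul_right _ (Nat.pow_le_pow_right (by have := X.two_le; omega) h)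

theorem one_le_cost (a : ℕ) : 1 ≤ X.cost a :=
  Nat.mul_pos (Nat.pow_pos (by have := X.two_le; omega)) X.hτ

theorem two_mul_cost (a : ℕ) : 2 * X.cost a ≤ X.cost (a + 1) := by
  unfold Budget.cost
  rw [pow_succ, mul_assoc, mul_left_comm 2]
  exact Nat.mul_le_mul_left _ (Nat.mul_le_mul_right _ X.two_le)

theorem pow_mul_cost (a b : ℕ) : X.B ^ a * X.cost b = X.cost (a + b) := by
  unfold Budget.cost; rw [pow_add, mul_assoc]

theorem le_cost (a : ℕ) : a ≤ X.cost a := by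
  induction a with
  | zero => exact Nat.zero_le _
  | succ k ih => have := X.two_mul_cost k; have := X.one_le_cost k; omega

end Budget

namespace Within

variable {n : ℕ} {X : Budget n} {P : Program} {ρ : List Val}

theorem mono {C D : ℕ} {e : Expr} {v : Val} (h : Within X P C ρ e v) (hCD : C ≤ D) :
    Within X P D ρ e v := by
  obtain ⟨c, hc, hle⟩ := h
  exact ⟨c, hc, hle.trans (X.cost_mono hCD)⟩

theorem congr {C : ℕ} {e : Expr} {v w : Val} (h : Within X P C ρ e v) (hv : v = w) :
    Within X P C ρ e w := hv ▸ h

/-- Adding exponents instead of taking their maximum is wasteful but harmless: the program text is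
fixed, so the exponents stay explicit, and since 2 ≤ B each doubling costs only one more. -/
theorem add_one_le {a b C D : ℕ} (ha : a ≤ X.cost C) (hb : b ≤ X.cost D) :
    a + b + 1 ≤ X.cost (C + D + 2) := by
  have h₁ := ha.trans (X.cost_mono (Nat.le_add_right C D))
  have h₂ := hb.trans (X.cost_mono (Nat.le_add_left D C))
  have h₃ := X.one_le_cost (C + D)
  have h₄ := X.two_mul_cost (C + D)
  have h₅ := X.two_mul_cost (C + D + 1)
  have : X.cost (C + D + 2) = X.cost (C + D + 1 + 1) := rfl
  omega

theorem bind {C D : ℕ} {a b : Expr} {x y : Val} (ha : Within X P C ρ a x)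
    (hb : Within X P D (x :: ρ) b y) : Within X P (C + D + 2) ρ (.bind a b) y := by
  obtain ⟨c, hc, hle⟩ := ha
  obtain ⟨d, hd, hle'⟩ := hb
  exact ⟨_, hc.bind hd, add_one_le hle hle'⟩

theorem call {C D : ℕ} {f : ℕ} {a : Expr} {x y : Val} (ha : Within X P C ρ a x)
    (hb : Within X P D [x] (P.body f) y) : Within X P (C + D + 2) ρ (.call f a) y := by
  obtain ⟨c, hc, hle⟩ := ha
  obtain ⟨d, hd, hle'⟩ := hb
  exact ⟨_, hc.call hd, add_one_le hle hle'⟩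

theorem ifLe {C D K : ℕ} {a b e₁ e₂ : Expr} {x y z : Val} (ha : Within X P C ρ a x)
    (hb : Within X P D ρ b y) (h₁ : x.toNat ≤ y.toNat → Within X P K ρ e₁ z)
    (h₂ : ¬ x.toNat ≤ y.toNat → Within X P K ρ e₂ z) :
    Within X P (C + D + K + 3) ρ (.ifLe a b e₁ e₂) z := by
  obtain ⟨c, hc, hle⟩ := ha
  obtain ⟨d, hd, hle'⟩ := hb
  have key : ∀ m ≤ X.cost K, c + d + m + 1 ≤ X.cost (C + D + K + 3) := by
    intro m hm
    have h1 := hle.trans (X.cost_mono (show C ≤ C + D + K + 1 by omega))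
    have h2 := hle'.trans (X.cost_mono (show D ≤ C + D + K + 1 by omega))
    have h3 := hm.trans (X.cost_mono (show K ≤ C + D + K + 1 by omega))
    have h4 := X.one_le_cost (C + D + K + 1)
    have h5 := X.two_mul_cost (C + D + K + 1)
    have h6 := X.two_mul_cost (C + D + K + 1 + 1)
    have : X.cost (C + D + K + 3) = X.cost (C + D + K + 1 + 1 + 1) := rfl
    omega
  by_cases h : x.toNat ≤ y.toNat
  · obtain ⟨m, hm, hlm⟩ := h₁ h
    exact ⟨_, .ifLe_true hc hd h hm, key m hlm⟩
  · obtain ⟨m, hm, hlm⟩ := h₂ h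
    exact ⟨_, .ifLe_false hc hd h hm, key m hlm⟩

end Within

/-! ### Loop-free and call-free expressions -/

/-- Expressions built without branching, binding and calls. -/
def Expr.IsSimple : Expr → Bool
  | .var _ => true
  | .lit _ => true
  | .pair a b => a.IsSimple && b.IsSimple
  | .left a => a.IsSimple
  | .right a => a.IsSimple
  | .add a b => a.IsSimple && b.IsSimple
  | .sub a b => a.IsSimple && b.IsSimple
  | _ => false

/-- The value of a simple expression. -/
def Expr.den : Expr → List Val → Val
  | .var i, ρ => ρ.getD i (.num 0)
  | .lit k, _ => .num k
  | .pair a b, ρ => .pair (a.den ρ) (b.den ρ)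
  | .left a, ρ => (a.den ρ).left
  | .right a, ρ => (a.den ρ).right
  | .add a b, ρ => .num ((a.den ρ).toNat + (b.den ρ).toNat)
  | .sub a b, ρ => .num ((a.den ρ).toNat - (b.den ρ).toNat)
  | _, _ => .num 0

/-- The number of evaluation steps of a simple expression. -/
def Expr.nodes : Expr → ℕ
  | .pair a b => a.nodes + b.nodes + 1
  | .left a => a.nodes + 1
  | .right a => a.nodes + 1
  | .add a b => a.nodes + b.nodes + 1
  | .sub a b => a.nodes + b.nodes + 1
  | _ => 1

theorem Expr.eval_den {P : Program} {ρ : List Val} :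
    ∀ e : Expr, e.IsSimple = true → P.Eval ρ e (e.den ρ) e.nodes
  | .var i, _ => .var ρ i
  | .lit k, _ => .lit ρ k
  | .pair a b, h => by
    have h' := Bool.and_eq_true_iff.1 h
    exact (a.eval_den h'.1).pair (b.eval_den h'.2)
  | .left a, h => (a.eval_den h).left
  | .right a, h => (a.eval_den h).right
  | .add a b, h => by
    have h' := Bool.and_eq_true_iff.1 h
    exact (a.eval_den h'.1).add (b.eval_den h'.2)
  | .sub a b, h => by
    have h' := Bool.and_eq_true_iff.1 h
    exact (a.eval_den h'.1).sub (b.eval_den h'.2)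

/-- Straight-line code is checked by computation: the value by `rfl`, the cost because a number a is
at most `X.cost a`. -/
theorem Within.simple {n : ℕ} {X : Budget n} {P : Program} {ρ : List Val} {e : Expr} {v : Val}
    (h : e.IsSimple = true) (hv : e.den ρ = v) : Within X P e.nodes ρ e v :=
  ⟨_, hv ▸ e.eval_den h, X.le_cost _⟩

/-- Call a function with a simple argument and bind the result. -/
theorem Within.letCall {n : ℕ} {X : Budget n} {P : Program} {ρ : List Val} {f : ℕ} {a b : Expr}
    {x y v : Val} {C D : ℕ} (hf : Within X P C [x] (P.body f) y) (hs : a.IsSimple = true)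
    (ha : a.den ρ = x) (hb : Within X P D (y :: ρ) b v) :
    Within X P (a.nodes + C + 2 + D + 2) ρ (.bind (.call f a) b) v :=
  ((Within.simple hs ha).call hf).bind hb

/-- Call a function with a simple argument. -/
theorem Within.callSimple {n : ℕ} {X : Budget n} {P : Program} {ρ : List Val} {f : ℕ} {a : Expr}
    {x y : Val} {C : ℕ} (hf : Within X P C [x] (P.body f) y) (hs : a.IsSimple = true)
    (ha : a.den ρ = x) : Within X P (a.nodes + C + 2) ρ (.call f a) y :=
  (Within.simple hs ha).call hf

/-! ### Loops -/

/-- Right fold: on input `(l, (b, e))`, the step `s` is applied to `(x, (acc, e))`. -/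
def foldE (k : ℕ) (s : Expr) : Expr :=
  .ifPair (.left (.var 0))
    (.bind (.call k (.pair (.right (.left (.var 0))) (.right (.var 0))))
      (.bind (.pair (.left (.left (.var 1))) (.pair (.var 0) (.right (.right (.var 1))))) s))
    (.left (.right (.var 0)))

/-- Map: on input `(l, e)`, the step `s` is applied to `(x, e)`. -/
def mapE (k : ℕ) (s : Expr) : Expr :=
  .ifPair (.left (.var 0))
    (.pair (.bind (.pair (.left (.left (.var 0))) (.right (.var 0))) s)
      (.call k (.pair (.right (.left (.var 0))) (.right (.var 0)))))
    (.lit 0)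

/-- Combine two lists of equal length entry by entry; `s` is applied to `(x, y)`. -/
def zipE (k : ℕ) (s : Expr) : Expr :=
  .ifPair (.left (.var 0))
    (.pair (.bind (.pair (.left (.left (.var 0))) (.left (.right (.var 0)))) s)
      (.call k (.pair (.right (.left (.var 0))) (.right (.right (.var 0))))))
    (.lit 0)

section Loops

variable {n : ℕ} {X : Budget n} {P : Program} {α β : Type*}

/-- The numbers 29 and 6 are uniform bounds for the bookkeeping of one round and for leaving the
loop. At most B^K rounds raise the exponent by K. -/
theorem loop_cost {m K C : ℕ} (hm : m ≤ X.B ^ K) :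
    m * (X.cost C + 29) + 6 ≤ X.cost (K + C + 6) := by
  have h1 := X.one_le_cost C
  have h2 := X.one_le_cost (K + C)
  have h3 : m * X.cost C ≤ X.cost (K + C) := by
    rw [← X.pow_mul_cost]; exact Nat.mul_le_mul_right _ hm
  have h4 : m ≤ m * X.cost C := Nat.le_mul_of_pos_right _ h1
  have h5 := X.two_mul_cost (K + C)
  have h6 := X.two_mul_cost (K + C + 1)
  have h7 := X.two_mul_cost (K + C + 2)
  have h8 := X.two_mul_cost (K + C + 3)
  have h9 := X.two_mul_cost (K + C + 4)
  have h10 : 2 * X.cost (K + C + 5) ≤ X.cost (K + C + 6) := X.two_mul_cost (K + C + 5)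
  simp only [add_assoc, Nat.reduceAdd] at *
  rw [mul_add]
  omega

theorem Within.fold {k K C : ℕ} {s : Expr} (hk : P.body k = foldE k s) (eα : α → Val)
    (eβ : β → Val) (f : α → β → β) (l : List α) (b : β) (e : Val) (hl : l.length ≤ X.B ^ K)
    (hs : ∀ x ∈ l, ∀ acc ρ,
      Within X P C (.pair (eα x) (.pair (eβ acc) e) :: ρ) s (eβ (f x acc))) :
    Within X P (K + C + 6) [.pair (encList (l.map eα)) (.pair (eβ b) e)] (P.body k)
      (eβ (l.foldr f b)) := by
  -- Induction needs a bound linear in the length; an exponent bound would grow with every round.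
  suffices h : ∃ c, P.Eval [.pair (encList (l.map eα)) (.pair (eβ b) e)] (P.body k)
      (eβ (l.foldr f b)) c ∧ c ≤ l.length * (X.cost C + 29) + 6 by
    obtain ⟨c, hc, hle⟩ := h
    exact ⟨c, hc, hle.trans (loop_cost hl)⟩
  clear hl
  induction l with
  | nil =>
    rw [hk]
    exact ⟨_, .ifPair_false (k := 0) (.left (.var _ _)) (.left (.right (.var _ _))), by simp⟩
  | cons x l ih =>
    obtain ⟨c, hc, hle⟩ := ih fun y hy => hs y (List.mem_cons_of_mem _ hy)
    obtain ⟨d, hd, hle'⟩ := hs x List.mem_cons_self (l.foldr f b)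
      [eβ (l.foldr f b), .pair (encList ((x :: l).map eα)) (.pair (eβ b) e)]
    rw [hk]
    refine ⟨_, .ifPair_true (x := eα x) (y := encList (l.map eα)) (.left (.var _ _))
      (.bind (.call (.pair (.right (.left (.var _ _))) (.right (.var _ _))) hc)
        (.bind (.pair (.left (.left (.var _ _))) (.pair (.var _ _)
          (.right (.right (.var _ _))))) hd)), ?_⟩
    simp only [List.length_cons]
    rw [Nat.succ_mul]
    omega

theorem Within.map {k K C : ℕ} {s : Expr} (hk : P.body k = mapE k s) (eα : α → Val)
    (f : α → Val) (l : List α) (e : Val) (hl : l.length ≤ X.B ^ K)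
    (hs : ∀ x ∈ l, ∀ ρ, Within X P C (.pair (eα x) e :: ρ) s (f x)) :
    Within X P (K + C + 6) [.pair (encList (l.map eα)) e] (P.body k) (encList (l.map f)) := by
  suffices h : ∃ c, P.Eval [.pair (encList (l.map eα)) e] (P.body k)
      (encList (l.map f)) c ∧ c ≤ l.length * (X.cost C + 29) + 6 by
    obtain ⟨c, hc, hle⟩ := h
    exact ⟨c, hc, hle.trans (loop_cost hl)⟩
  clear hl
  induction l with
  | nil => rw [hk]; exact ⟨_, .ifPair_false (k := 0) (.left (.var _ _)) (.lit _ _), by simp⟩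
  | cons x l ih =>
    obtain ⟨c, hc, hle⟩ := ih fun y hy => hs y (List.mem_cons_of_mem _ hy)
    obtain ⟨d, hd, hle'⟩ := hs x List.mem_cons_self [.pair (encList ((x :: l).map eα)) e]
    rw [hk]
    refine ⟨_, .ifPair_true (x := eα x) (y := encList (l.map eα)) (.left (.var _ _))
      (.pair (.bind (.pair (.left (.left (.var _ _))) (.right (.var _ _))) hd)
        (.call (.pair (.right (.left (.var _ _))) (.right (.var _ _))) hc)), ?_⟩
    simp only [List.length_cons]
    rw [Nat.succ_mul]
    omega

theorem Within.zip {k K C : ℕ} {s : Expr} (hk : P.body k = zipE k s) (f g h : α → Val)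
    (l : List α) (hl : l.length ≤ X.B ^ K)
    (hs : ∀ x ∈ l, ∀ ρ, Within X P C (.pair (f x) (g x) :: ρ) s (h x)) :
    Within X P (K + C + 6) [.pair (encList (l.map f)) (encList (l.map g))] (P.body k)
      (encList (l.map h)) := by
  suffices h : ∃ c, P.Eval [.pair (encList (l.map f)) (encList (l.map g))] (P.body k)
      (encList (l.map h)) c ∧ c ≤ l.length * (X.cost C + 29) + 6 by
    obtain ⟨c, hc, hle⟩ := h
    exact ⟨c, hc, hle.trans (loop_cost hl)⟩
  clear hl
  induction l with
  | nil => rw [hk]; exact ⟨_, .ifPair_false (k := 0) (.left (.var _ _)) (.lit _ _), by simp⟩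
  | cons x l ih =>
    obtain ⟨c, hc, hle⟩ := ih fun y hy => hs y (List.mem_cons_of_mem _ hy)
    obtain ⟨d, hd, hle'⟩ := hs x List.mem_cons_self
      [.pair (encList ((x :: l).map f)) (encList ((x :: l).map g))]
    rw [hk]
    refine ⟨_, .ifPair_true (x := f x) (y := encList (l.map f)) (.left (.var _ _))
      (.pair (.bind (.pair (.left (.left (.var _ _))) (.left (.right (.var _ _)))) hd)
        (.call (.pair (.right (.left (.var _ _))) (.right (.right (.var _ _)))) hc)), ?_⟩
    simp only [List.length_cons]
    rw [Nat.succ_mul]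
    omega

end Loops

/-! ### The algorithm as a function on finite sets -/

section Model

variable {V : Type*} [DecidableEq V]

/-- One step (possibly trivial) of the relation `r` inside `Y`. -/
def StepIn (r : V → V → Prop) (Y : Finset V) (a b : V) : Prop :=
  a ∈ Y ∧ b ∈ Y ∧ (a = b ∨ r a b)

/-- `a` and `b` are joined inside `Y` by a sequence of `r`-steps. -/
def Linked (r : V → V → Prop) (Y : Finset V) : V → V → Prop := Relation.TransGen (StepIn r Y)

open Classical in
/-- The vertices linked to `v` inside `Y`. -/
noncomputable def linkedSet (r : V → V → Prop) (Y : Finset V) (v : V) : Finset V :=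
  Y.filter (Linked r Y v)

/-- `z` is separated from both ends of the edge `ax` by a single vertex other than `z`. -/
def Separated (G : SimpleGraph V) (C : Finset V) (a x z : V) : Prop :=
  ∃ u, u ≠ z ∧ ¬ Linked G.Adj (C \ {u}) x z ∧ ¬ Linked G.Adj (C \ {u}) a z

open Classical in
/-- The complement of the block of `G[C]` containing the edge `ax`. -/
noncomputable def blockCompl [Fintype V] (G : SimpleGraph V) (C : Finset V) (a x : V) : Finset V :=
  Finset.univ.filter (Separated G C a x)

/-- The edge `ax` lies in a block of `G[C]` containing no member of `TT`. -/
def GoodEdge [Fintype V] (G : SimpleGraph V) (TT : List (Finset V)) (C : Finset V) (a x : V) :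
    Prop :=
  G.Adj a x ∧ ¬ ∃ K ∈ TT, Disjoint K (blockCompl G C a x)

/-- The vertices joined to `v` by edges in blocks containing no member of `TT`. -/
noncomputable def freeHull [Fintype V] (G : SimpleGraph V) (TT : List (Finset V)) (C : Finset V)
    (v : V) : Finset V :=
  linkedSet (GoodEdge G TT C) C v

open Classical in
/-- The vertices of `A` in members of `TT` contained in `A`. -/
noncomputable def activePart (TT : List (Finset V)) (A : Finset V) : Finset V :=
  A.filter fun v => ∃ K ∈ TT, K ⊆ A ∧ v ∈ K

/-- `S` hits, inside `A`, each member of `KK` that meets `A` and is contained in `A ∪ F`. -/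
def Valid (KK : List (Finset V)) (A F S : Finset V) : Prop :=
  ∀ Q ∈ KK, Q ⊆ A ∪ F → (Q ∩ A).Nonempty → (Q ∩ (A ∩ S)).Nonempty

open Classical in
/-- The set `x` if it is valid and smaller than `y`, otherwise `y`. -/
noncomputable def pick (KK : List (Finset V)) (A F x y : Finset V) : Finset V :=
  if Valid KK A F x ∧ x.card < y.card then x else y

/-- The smallest among `A` and the valid candidates. -/
noncomputable def best {ι : Type*} (KK : List (Finset V)) (A F : Finset V) (cand : ι → Finset V)
    (l : List ι) : Finset V :=
  l.foldr (fun s acc => pick KK A F (cand s) acc) A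

/-- The union of `g v` over the members `v` of `T` in the list `l`. -/
def unionOver (l : List V) (T : Finset V) (g : V → Finset V) : Finset V :=
  l.foldr (fun v acc => if v ∈ T then g v ∪ acc else acc) ∅

/-- The vertices of `C \ T` linked to `w` in `G[(C \ T) ∪ {w}]`. -/
noncomputable def pendant (G : SimpleGraph V) (C T : Finset V) (w : V) : Finset V :=
  linkedSet G.Adj ((C \ T) ∪ {w}) w \ T

/-- A solution for the part pendant at `w`: containing `w` if `w ∈ Y`, otherwise the better one of
the two options. -/
noncomputable def pendantSol (G : SimpleGraph V) (KK : List (Finset V))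
    (rec : Finset V → Finset V → Finset V) (C F T Y : Finset V) (w : V) : Finset V :=
  if w ∈ Y then {w} ∪ rec (pendant G C T w) F
  else pick KK (pendant G C T w ∪ {w}) F (rec (pendant G C T w) (F ∪ {w}))
    ({w} ∪ rec (pendant G C T w) F)

end Model

section FinModel

variable {n : ℕ}

/-- All sets of at most `k` vertices (with repetitions). -/
def smallSets (n : ℕ) : ℕ → List (Finset (Fin n))
  | 0 => [∅]
  | k + 1 => (smallSets n k).foldr
      (fun s acc => (List.finRange n).foldr (fun v acc => (s ∪ {v}) :: acc) acc) [∅]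

variable (G : SimpleGraph (Fin n)) (KK TT : List (Finset (Fin n)))

/-- The best solution for `G[C]` obtained from the root `T`. -/
noncomputable def solveRoot (rec : Finset (Fin n) → Finset (Fin n) → Finset (Fin n)) (k : ℕ)
    (C F T : Finset (Fin n)) : Finset (Fin n) :=
  best KK C F (fun Y => unionOver (List.finRange n) T (pendantSol G KK rec C F T Y))
    (smallSets n k)

/-- The best solution for the connected graph `G[C]`, over all roots. -/
noncomputable def solveConn (rec : Finset (Fin n) → Finset (Fin n) → Finset (Fin n)) (k : ℕ)
    (C F : Finset (Fin n)) : Finset (Fin n) :=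
  best KK C F (fun v => solveRoot G KK rec k C F (freeHull G TT C v)) (List.finRange n)

/-- The candidate solution for `G[A]` that uses the vertices of `s` outside the active part. -/
noncomputable def splitCand (recC : Finset (Fin n) → Finset (Fin n) → Finset (Fin n))
    (A F s : Finset (Fin n)) : Finset (Fin n) :=
  ((A ∩ s) \ activePart TT A) ∪ unionOver (List.finRange n) (activePart TT A) fun v =>
    recC (linkedSet G.Adj (activePart TT A) v)
      (F ∪ ((A \ activePart TT A) \ ((A ∩ s) \ activePart TT A)))

/-- The best solution for `G[A]`, given a solver for connected graphs. -/
noncomputable def solveSplit (recC : Finset (Fin n) → Finset (Fin n) → Finset (Fin n)) (k : ℕ)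
    (A F : Finset (Fin n)) : Finset (Fin n) :=
  best KK A F (splitCand G TT recC A F) (smallSets n k)

/-- The recursive algorithm with depth bound `l` and excess bound `k`. -/
noncomputable def solve : ℕ → ℕ → Finset (Fin n) → Finset (Fin n) → Finset (Fin n)
  | 0, k => solveSplit G KK TT (fun _ _ => ∅) k
  | l + 1, k => solveSplit G KK TT (solveConn G KK TT (solve l (k + 1)) k) k

open Classical in
/-- Prepend to `init` the sets of the list that are cliques with `t` vertices. -/
noncomputable def addCliques (t : ℕ) (init l : List (Finset (Fin n))) : List (Finset (Fin n)) :=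
  l.foldr (fun S acc => if G.IsNClique t S then S :: acc else acc) init

/-! ### Encodings -/

/-- The list of all vertices. -/
def encVerts (n : ℕ) : Val := encList ((List.finRange n).map fun i : Fin n => .num i)

open Classical in
/-- A relation is given by its matrix. -/
noncomputable def encRel (r : Fin n → Fin n → Prop) : Val :=
  encList (List.ofFn fun i => encList (List.ofFn fun j => Val.num (if r i j then 1 else 0)))

/-- The data that stay fixed throughout the algorithm. -/
noncomputable def encBase : Val :=
  .pair (encVerts n) (.pair (encRel G.Adj) (.pair (encList (KK.map encSet))
    (.pair (encList (TT.map encSet)) (.pair (encSet (Finset.univ : Finset (Fin n)))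
      (encSet (∅ : Finset (Fin n)))))))

end FinModel

/-! ### The program -/

namespace Expr

/-- Negation of a bit. -/
abbrev bnot (a : Expr) : Expr := .sub (.lit 1) a

/-- Conjunction of bits. -/
abbrev band (a b : Expr) : Expr := .sub a (.sub (.lit 1) b)

/-- Disjunction of bits. -/
abbrev bor (a b : Expr) : Expr := .sub (.lit 1) (.sub (.sub (.lit 1) a) b)

/-- Equality of numbers, as a bit. -/
abbrev beq (a b : Expr) : Expr := .sub (.lit 1) (.add (.sub a b) (.sub b a))

abbrev baseGraph (g : Expr) : Expr := g.right.left
abbrev baseKK (g : Expr) : Expr := g.right.right.left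
abbrev baseTT (g : Expr) : Expr := g.right.right.right.left
abbrev baseUniv (g : Expr) : Expr := g.right.right.right.right.left
abbrev baseEmpty (g : Expr) : Expr := g.right.right.right.right.right

end Expr

namespace Code

open Expr

/-- The numerals after `.call` are positions in `hittingProgram`. Functions take one value, so
several arguments travel as nested pairs. -/
def nth : Expr :=
  .ifLe (var 0).right (.lit 0) (var 0).left.left
    (.call 1 (.pair (var 0).left.right (.sub (var 0).right (.lit 1))))

def upto : Expr :=
  .ifLe (var 0).left (.lit 0) (var 0).right
    (.call 2 (.pair (.sub (var 0).left (.lit 1))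
      (.pair (.sub (var 0).left (.lit 1)) (var 0).right)))

/-- The two membership bits add up to 2 exactly at a common element. -/
def meets : Expr :=
  .ifPair (var 0).left
    (.ifLe (.lit 2) (.add (var 0).left.left (var 0).right.left) (.lit 1)
      (.call 5 (.pair (var 0).left.right (var 0).right.right)))
    (.lit 0)

def card : Expr :=
  .ifPair (var 0) (.add (var 0).left (.call 6 (var 0).right)) (.lit 0)

def look : Expr :=
  .bind (.call 1 (.pair (var 0).left (var 0).right.left))
    (.call 1 (.pair (var 0) (var 1).right.right))

/-- Row function of a matrix computed by the entry function `k + 1`; the environment is a pair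
starting with the base data. -/
def row (k : ℕ) : Expr := .call (k + 1) (.pair (var 0).right.left.left (var 0))

def restrEntry : Expr :=
  .bind (.call 1 (.pair (var 0).right.right.right.right (var 0).right.left))
  (.bind (.call 1 (.pair (var 1).right.right.right.right (var 1).left))
  (.bind (.call 7 (.pair (var 2).right.right.right.left (.pair (var 2).right.left (var 2).left)))
    (band (band (var 2) (var 1)) (bor (beq (var 3).right.left (var 3).left) (var 0)))))

def warshallEntry : Expr :=
  .bind (.call 7 (.pair (var 0).right.right.right.left (.pair (var 0).right.left (var 0).left)))
  (.bind (.call 7 (.pair (var 1).right.right.right.left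
    (.pair (var 1).right.left (var 1).right.right.right.right)))
  (.bind (.call 7 (.pair (var 2).right.right.right.left
    (.pair (var 2).right.right.right.right (var 2).left)))
    (bor (var 2) (band (var 1) (var 0)))))

def warshallStep : Expr :=
  .call 11 (.pair (var 0).right.right.left
    (.pair (var 0).right.right (.pair (var 0).right.left (var 0).left)))

def linked : Expr :=
  .bind (.call 9 (.pair (var 0).left.left (var 0)))
    (.call 13 (.pair (var 1).left.left (.pair (var 0) (var 1).left)))

def deletedStep : Expr :=
  .bind (.call 8 (.pair (var 0).right.left.left (var 0).left))
  (.bind (.call 4 (.pair (var 1).right.right (var 0)))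
    (.call 14 (.pair (var 2).right.left (.pair (baseGraph (var 2).right.left) (var 0)))))

/-- The fold environment is `(u, (bit, (z, (a, (x, D)))))`, with D the list of reachability matrices
of the graphs G[C] - u. -/
def sepStep : Expr :=
  .bind (.call 1 (.pair (var 0).right.right.right.right.right (var 0).left))
  (.bind (.call 7 (.pair (var 0)
    (.pair (var 1).right.right.right.right.left (var 1).right.right.left)))
  (.bind (.call 7 (.pair (var 1)
    (.pair (var 2).right.right.right.left (var 2).right.right.left)))
    (bor (var 3).right.left (band (bnot (beq (var 3).left (var 3).right.right.left))
      (band (bnot (var 1)) (bnot (var 0)))))))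

def blockStep : Expr :=
  .call 16 (.pair (var 0).right.left (.pair (.lit 0) (.pair (var 0).left (var 0).right.right)))

def avoidsStep : Expr :=
  .bind (.call 5 (.pair (var 0).left (var 0).right.right))
    (bor (var 1).right.left (bnot (var 0)))

def goodEntry : Expr :=
  .bind (.call 7 (.pair (baseGraph (var 0).right.right.left)
    (.pair (var 0).right.left (var 0).left)))
  (.bind (.call 17 (.pair (var 1).right.right.left.left (.pair (var 1).right.right.left.left
    (.pair (var 1).right.left (.pair (var 1).left (var 1).right.right.right)))))
  (.bind (.call 18 (.pair (baseTT (var 2).right.right.left) (.pair (.lit 0) (var 0))))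
    (band (var 2) (bnot (var 0)))))

def activeStep : Expr :=
  .bind (.call 5 (.pair (var 0).left (var 0).right.right))
    (.ifLe (.lit 1) (var 0) (var 1).right.left
      (.call 3 (.pair (var 1).left (var 1).right.left)))

def insertStep : Expr :=
  .bind (.call 8 (.pair (var 0).right.right.right (var 0).left))
  (.bind (.call 3 (.pair (var 1).right.right.left (var 0)))
    (.pair (var 0) (var 2).right.left))

def insertAllStep : Expr :=
  .call 22 (.pair (var 0).right.right (.pair (var 0).right.left
    (.pair (var 0).left (var 0).right.right)))

def smallSets : Expr :=
  .ifLe (var 0).left (.lit 0) (.pair (var 0).right.right (.lit 0))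
    (.bind (.call 24 (.pair (.sub (var 0).left (.lit 1)) (var 0).right))
      (.call 23 (.pair (var 0) (.pair (.pair (var 1).right.right (.lit 0)) (var 1).right.left))))

def badStep : Expr :=
  .bind (.call 5 (.pair (var 0).left (var 0).right.right.left))
  (.bind (.call 5 (.pair (var 1).left (var 1).right.right.right.left))
  (.bind (.call 5 (.pair (var 2).left (var 2).right.right.right.right))
    (bor (var 3).right.left (band (band (bnot (var 2)) (var 1)) (bnot (var 0))))))

/-- The argument is `(base, ((A, F), (x, y)))`. Only union and difference of sets are programmed, so
A ∩ x is computed as a double difference. -/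
def pick : Expr :=
  .bind (.call 3 (var 0).right.left)
  (.bind (.call 4 (.pair (baseUniv (var 1).left) (var 0)))
  (.bind (.call 4 (.pair (var 2).right.left.left (var 2).right.right.left))
  (.bind (.call 4 (.pair (var 3).right.left.left (var 0)))
  (.bind (.call 25 (.pair (baseKK (var 4).left)
    (.pair (.lit 0) (.pair (var 2) (.pair (var 4).right.left.left (var 0))))))
  (.bind (.call 6 (var 5).right.right.left)
  (.bind (.call 6 (var 6).right.right.right)
    (.ifLe (.lit 1) (var 2) (var 7).right.right.right
      (.ifLe (var 0) (var 1) (var 7).right.right.right (var 7).right.right.left))))))))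

def splitStep : Expr :=
  .bind (.call 4 (.pair (var 0).right.right.right.left.left (var 0).left))
  (.bind (.call 4 (.pair (var 1).right.right.right.left.left (var 0)))
  (.bind (.call 4 (.pair (var 0) (var 2).right.right.right.right.right))
  (.bind (.call 4 (.pair (var 3).right.right.right.left.left (var 3).right.right.right.right.right))
  (.bind (.call 4 (.pair (var 0) (var 1)))
  (.bind (.call 3 (.pair (var 5).right.right.right.left.right (var 0)))
  (.bind (.call 28 (.pair (var 6).right.right.left.left (.pair (baseEmpty (var 6).right.right.left)
    (.pair (var 6).right.right.left (.pair (var 6).right.right.right.right.right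
      (.pair (var 0) (var 6).right.right.right.right.left))))))
  (.bind (.call 3 (.pair (var 4) (var 0)))
    (.call 26 (.pair (var 8).right.right.left (.pair (var 8).right.right.right.left
      (.pair (var 0) (var 8).right.left)))))))))))

def componentStep : Expr :=
  .bind (.call 1 (.pair (var 0).right.right.right.left (var 0).left))
    (.ifLe (.lit 1) (var 0)
      (.bind (.call 14 (.pair (var 1).right.right.left
        (.pair (baseGraph (var 1).right.right.left) (var 1).right.right.right.left)))
      (.bind (.call 1 (.pair (var 0) (var 2).left))
      (.bind (.call 29 (.pair (var 3).right.right.left (.pair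
        (.pair (var 0) (var 3).right.right.right.right.left)
        (var 3).right.right.right.right.right)))
        (.call 3 (.pair (var 0) (var 4).right.left)))))
      (var 1).right.left)

/-- The argument is `(base, ((C, F), (l, k)))`, the same format as for `solve`. The good edges and
their closure are computed once, after which every hull is a matrix row. Here the depth drops by
one. -/
def solveConn : Expr :=
  .ifLe (var 0).right.right.left (.lit 0) (baseEmpty (var 0).left)
    (.bind (.call 15 (.pair (var 0).left.left (.pair (var 0).left (var 0).right.left.left)))
    (.bind (.call 19 (.pair (var 1).left.left (.pair (var 1).left (var 0))))
    (.bind (.call 14 (.pair (var 2).left (.pair (var 0) (var 2).right.left.left)))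
      (.call 30 (.pair (var 3).left.left (.pair (var 3).right.left.left (.pair (var 3).left
        (.pair (var 3).right.left (.pair (.pair (.sub (var 3).right.right.left (.lit 1))
          (var 3).right.right.right) (var 0))))))))))

def rootStep : Expr :=
  .bind (.call 1 (.pair (var 0).right.right.right.right.right (var 0).left))
  (.bind (.call 31 (.pair (var 1).right.right.left (.pair (var 1).right.right.right.left
    (.pair (var 1).right.right.right.right.left (var 0)))))
    (.call 26 (.pair (var 2).right.right.left (.pair (var 2).right.right.right.left
      (.pair (var 0) (var 2).right.left)))))

def solveRoot : Expr :=
  .bind (.call 24 (.pair (var 0).right.right.left.right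
    (.pair (var 0).left.left (baseEmpty (var 0).left))))
    (.call 32 (.pair (var 0) (.pair (var 1).right.left.left (var 1))))

def forcedStep : Expr :=
  .bind (.call 33 (.pair (var 0).right.right.left.left (.pair (baseEmpty (var 0).right.right.left)
    (.pair (var 0).left (var 0).right.right))))
    (.call 26 (.pair (var 1).right.right.left (.pair (var 1).right.right.right.left
      (.pair (var 0) (var 1).right.left))))

def pendantStep : Expr :=
  .bind (.call 1 (.pair (var 0).right.right.right.right.right.right (var 0).left))
    (.ifLe (.lit 1) (var 0)
      (.bind (.call 34 (.pair (var 1).left (var 1).right.right))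
        (.call 3 (.pair (var 0) (var 2).right.left)))
      (var 1).right.left)

/-- The argument is `(w, (Y, (base, ((C, F), ((l, k), T)))))`. Both recursive calls of `solve` get
the excess bound k + 1. -/
def pendantSol : Expr :=
  .bind (.call 8 (.pair (var 0).right.right.left.left (var 0).left))
  (.bind (.call 4 (.pair (var 1).right.right.right.left.left (var 1).right.right.right.right.right))
  (.bind (.call 3 (.pair (var 0) (var 1)))
  (.bind (.call 14 (.pair (var 3).right.right.left
    (.pair (baseGraph (var 3).right.right.left) (var 0))))
  (.bind (.call 1 (.pair (var 0) (var 4).left))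
  (.bind (.call 4 (.pair (var 0) (var 5).right.right.right.right.right))
  (.bind (.call 35 (.pair (var 6).right.right.left (.pair
    (.pair (var 0) (var 6).right.right.right.left.right)
    (.pair (var 6).right.right.right.right.left.left
      (.add (var 6).right.right.right.right.left.right (.lit 1))))))
  (.bind (.call 3 (.pair (var 6) (var 0)))
  (.bind (.call 1 (.pair (var 8).right.left (var 8).left))
    (.ifLe (.lit 1) (var 0) (var 1)
      (.bind (.call 3 (.pair (var 9).right.right.right.left.right (var 8)))
      (.bind (.call 35 (.pair (var 10).right.right.left (.pair
        (.pair (var 4) (var 0))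
        (.pair (var 10).right.right.right.right.left.left
          (.add (var 10).right.right.right.right.left.right (.lit 1))))))
      (.bind (.call 3 (.pair (var 5) (var 10)))
        (.call 26 (.pair (var 12).right.right.left (.pair
          (.pair (var 0) (var 12).right.right.right.left.right)
          (.pair (var 1) (var 4)))))))))))))))))

def solve : Expr :=
  .bind (.call 24 (.pair (var 0).right.right.right
    (.pair (var 0).left.left (baseEmpty (var 0).left))))
  (.bind (.call 4 (.pair (baseUniv (var 1).left) (var 1).right.left.left))
  (.bind (.call 21 (.pair (baseTT (var 2).left) (.pair (baseEmpty (var 2).left) (var 0))))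
    (.call 27 (.pair (var 2) (.pair (var 3).right.left.left (.pair (var 3).left
      (.pair (var 3).right.left (.pair (var 3).right.right (var 0)))))))))

def nonCliqueStep : Expr :=
  .bind (.call 1 (.pair (var 0).right.right.left (var 0).left))
  (.bind (.call 1 (.pair (baseGraph (var 1).right.right.right) (var 1).left))
  (.bind (.call 8 (.pair (var 2).right.right.right.left (var 2).left))
  (.bind (.call 3 (.pair (var 1) (var 0)))
  (.bind (.call 4 (.pair (var 4).right.right.left (var 0)))
  (.bind (.call 5 (.pair (var 0) (var 5).right.right.left))
    (bor (var 6).right.left (band (var 5) (var 0))))))))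

def cliqueStep (t : ℕ) : Expr :=
  .bind (.call 36 (.pair (var 0).right.right.left
    (.pair (.lit 0) (.pair (var 0).left (var 0).right.right))))
  (.bind (.call 6 (var 1).left)
    (.ifLe (.lit 1) (var 1) (var 2).right.left
      (.ifLe (var 0) (.lit t)
        (.ifLe (.lit t) (var 0) (.pair (var 2).left (var 2).right.left) (var 2).right.left)
        (var 2).right.left)))

def main (t : ℕ) : Expr :=
  .bind (.call 2 (.pair (var 0).left (.lit 0)))
  (.bind (.call 8 (.pair (var 0) (var 1).left))
  (.bind (.call 38 (.pair (var 1) (.lit 0)))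
  (.bind (.call 24 (.pair (.lit t) (.pair (var 2) (var 1))))
  (.bind (.call 37 (.pair (var 0) (.pair (.lit 0) (.pair (var 3) (.pair (var 4).right.left
    (.lit 0))))))
  (.bind (.call 37 (.pair (var 1) (.pair (var 5).right.right.left (.pair (var 4)
    (.pair (var 5).right.left (.lit 0))))))
    -- The two problems share one program: the fourth tail of the input is a pair when κ is supplied
    -- and the number 0 otherwise.
    (.ifPair (var 6).right.right.right.right
      (.call 35 (.pair (.pair (var 5) (.pair (var 6).right.left (.pair (var 0) (.pair (var 1)
        (.pair (var 3) (var 4)))))) (.pair (.pair (var 3) (var 4))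
          (.pair (var 6).right.right.right.left (var 6).right.right.right.right.left))))
      (.bind (.call 35 (.pair (.pair (var 5) (.pair (var 6).right.left (.pair (var 1)
        (.pair (var 1) (.pair (var 3) (var 4)))))) (.pair (.pair (var 3) (var 4))
          (.pair (var 6).right.right.right.left (.lit 0)))))
      (.bind (.call 35 (.pair (.pair (var 6) (.pair (var 7).right.left (.pair (var 1)
        (.pair (var 2) (.pair (var 4) (var 5)))))) (.pair (.pair (var 4) (var 5))
          (.pair (var 7).right.right.right.left (.lit 0)))))
      (.bind (.call 6 (var 1))
      (.bind (.call 6 (var 1))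
        -- The output bit is 1 - (c_F - c_∅) in truncated subtraction, hence 1 exactly when c_F ≤
        -- c_∅.
        (.pair (var 1) (bnot (.sub (var 0) (var 1))))))))))))))

end Code

/-- The program solving both problems, for the forbidden clique size `t`. -/
def hittingProgram (t : ℕ) : Program :=
  [Code.main t, Code.nth, Code.upto,
   zipE 3 (.bor (Expr.var 0).left (Expr.var 0).right),
   zipE 4 (.sub (Expr.var 0).left (Expr.var 0).right),
   Code.meets, Code.card, Code.look,
   mapE 8 (.beq (Expr.var 0).left (Expr.var 0).right),
   mapE 9 (Code.row 9), mapE 10 Code.restrEntry, mapE 11 (Code.row 11), mapE 12 Code.warshallEntry,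
   foldE 13 Code.warshallStep, Code.linked, mapE 15 Code.deletedStep,
   foldE 16 Code.sepStep, mapE 17 Code.blockStep, foldE 18 Code.avoidsStep,
   mapE 19 (Code.row 19), mapE 20 Code.goodEntry, foldE 21 Code.activeStep,
   foldE 22 Code.insertStep, foldE 23 Code.insertAllStep, Code.smallSets,
   foldE 25 Code.badStep, Code.pick,
   foldE 27 Code.splitStep, foldE 28 Code.componentStep, Code.solveConn,
   foldE 30 Code.rootStep, Code.solveRoot, foldE 32 Code.forcedStep, foldE 33 Code.pendantStep,
   Code.pendantSol, Code.solve, foldE 36 Code.nonCliqueStep, foldE 37 (Code.cliqueStep t),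
   mapE 38 (.lit 1)]

/-! ### Specifications of the basic functions -/

theorem encBool_congr {p q : Prop} (h : p ↔ q) : encBool p = encBool q := by rw [propext h]

@[simp] theorem toNat_encBool (p : Prop) [Decidable p] :
    (encBool p).toNat = if p then 1 else 0 := by
  by_cases h : p <;> simp [encBool, Val.toNat, h]

theorem one_le_encBool {p : Prop} : (Val.num 1).toNat ≤ (encBool p).toNat ↔ p := by
  classical
  rw [toNat_encBool]
  by_cases h : p <;> simp [h, Val.toNat]

namespace Expr

variable {ρ : List Val} {a b : Expr} {p q : Prop}

theorem den_bnot (ha : a.den ρ = encBool p) : (bnot a).den ρ = encBool ¬p := by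
  classical
  simp only [den, ha, encBool, Val.toNat]
  by_cases h : p <;> simp [h]

theorem den_band (ha : a.den ρ = encBool p) (hb : b.den ρ = encBool q) :
    (band a b).den ρ = encBool (p ∧ q) := by
  classical
  simp only [den, ha, hb, encBool, Val.toNat]
  by_cases h : p <;> by_cases h' : q <;> simp [h, h']

theorem den_bor (ha : a.den ρ = encBool p) (hb : b.den ρ = encBool q) :
    (bor a b).den ρ = encBool (p ∨ q) := by
  classical
  simp only [den, ha, hb, encBool, Val.toNat]
  by_cases h : p <;> by_cases h' : q <;> simp [h, h']

theorem den_beq {i j : ℕ} (ha : a.den ρ = .num i) (hb : b.den ρ = .num j) :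
    (beq a b).den ρ = encBool (i = j) := by
  classical
  simp only [den, ha, hb, encBool, Val.toNat]
  by_cases h : i = j
  · simp [h]
  · have : 1 ≤ i - j + (j - i) := by omega
    simp [h, Nat.sub_eq_zero_of_le this]

end Expr

section Encodings

variable {n : ℕ}

theorem encSet_eq (S : Finset (Fin n)) :
    encSet S = encList ((List.finRange n).map fun i => encBool (i ∈ S)) := by
  unfold encSet
  rw [List.ofFn_eq_map]
  congr 2
  funext i
  unfold encBool
  congr

theorem encSet_of_iff {p : Fin n → Prop} {S : Finset (Fin n)} (h : ∀ i, p i ↔ i ∈ S) :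
    encList ((List.finRange n).map fun i => encBool (p i)) = encSet S := by
  rw [encSet_eq]
  congr 2
  funext i
  exact encBool_congr (h i)

open Classical in
/-- The set of `j` with `r i j`. -/
noncomputable def relRow (r : Fin n → Fin n → Prop) (i : Fin n) : Finset (Fin n) :=
  Finset.univ.filter (r i)

theorem mem_relRow {r : Fin n → Fin n → Prop} {i j : Fin n} : j ∈ relRow r i ↔ r i j := by
  simp [relRow]

theorem encRel_eq (r : Fin n → Fin n → Prop) :
    encRel r = encList ((List.finRange n).map fun i => encSet (relRow r i)) := by
  unfold encRel encSet
  rw [List.ofFn_eq_map]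
  congr 2
  funext i
  congr 2
  funext j
  by_cases h : r i j
  · simp [h, mem_relRow.2 h]
  · simp [h, mt mem_relRow.1 h]

theorem encRel_eq' (r : Fin n → Fin n → Prop) :
    encRel r = encList ((List.finRange n).map fun i =>
      encList ((List.finRange n).map fun j => encBool (r i j))) := by
  rw [encRel_eq]
  congr 2
  funext i
  rw [encSet_of_iff]
  exact fun j => mem_relRow.symm

theorem encRel_congr {r s : Fin n → Fin n → Prop} (h : ∀ i j, r i j ↔ s i j) :
    encRel r = encRel s := by
  have : r = s := by funext i j; exact propext (h i j)
  rw [this]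

end Encodings

section Specs

variable {n t : ℕ} (X : Budget n)

/-- Function `k` of the program maps `x` to `y` within `X.cost C` steps. -/
abbrev Calls (t k C : ℕ) (x y : Val) : Prop :=
  Within X (hittingProgram t) C [x] ((hittingProgram t).body k) y

theorem Calls.le {X : Budget n} {k C D : ℕ} {x y : Val} (h : Calls X t k C x y) (hCD : C ≤ D) :
    Calls X t k D x y := Within.mono h hCD

theorem Budget.length_finRange_le : (List.finRange n).length ≤ X.B ^ 1 := by
  have := X.hn
  rw [List.length_finRange, pow_one]; omega

theorem calls_nth (l : List Val) (i : ℕ) (hi : i < l.length) (hl : l.length ≤ X.B) :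
    Calls X t 1 7 (.pair (encList l) (.num i)) l[i] := by
  suffices h : ∃ c, (hittingProgram t).Eval [.pair (encList l) (.num i)] Code.nth l[i] c ∧
      c ≤ (i + 1) * (X.cost 0 + 29) by
    obtain ⟨c, hc, hle⟩ := h
    refine ⟨c, hc, ?_⟩
    have := loop_cost (X := X) (m := i + 1) (K := 1) (C := 0) (by rw [pow_one]; omega)
    exact (hle.trans (Nat.le_add_right _ 6)).trans this
  clear hl
  induction i generalizing l with
  | zero =>
    match l, hi with
    | x :: l, _ =>
      exact ⟨_, .ifLe_true (.right (.var _ _)) (.lit _ _) le_rfl (.left (.left (.var _ _))),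
        by simp⟩
  | succ i ih =>
    match l, hi with
    | x :: l, hi =>
      obtain ⟨c, hc, hle⟩ := ih l (by simpa using hi)
      refine ⟨_, .ifLe_false (.right (.var _ _)) (.lit _ _) (by simp [Val.right, Val.toNat])
        (.call (.pair (.right (.left (.var _ _))) (.sub (.right (.var _ _)) (.lit _ _))) hc), ?_⟩
      rw [Nat.succ_mul (i + 1)]
      omega

theorem calls_mem (S : Finset (Fin n)) (v : Fin n) :
    Calls X t 1 7 (.pair (encSet S) (.num v)) (encBool (v ∈ S)) := by
  have h := calls_nth (t := t) X ((List.finRange n).map fun i => encBool (i ∈ S)) v (by simp)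
    (by simpa using X.length_finRange_le)
  rw [← encSet_eq] at h
  simpa using h

theorem calls_row (r : Fin n → Fin n → Prop) (v : Fin n) :
    Calls X t 1 7 (.pair (encRel r) (.num v)) (encSet (relRow r v)) := by
  have h := calls_nth (t := t) X ((List.finRange n).map fun i => encSet (relRow r i)) v (by simp)
    (by simpa using X.length_finRange_le)
  rw [← encRel_eq] at h
  simpa using h

/-- The list l is an accumulator: counting down from k prepends k - 1 first, so the result comes out
in increasing order. -/
theorem calls_upto (k : ℕ) (hk : k ≤ n) (l : List ℕ) :
    Calls X t 2 7 (.pair (.num k) (encList (l.map .num)))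
      (encList ((List.range k ++ l).map .num)) := by
  suffices h : ∃ c, (hittingProgram t).Eval [.pair (.num k) (encList (l.map .num))] Code.upto
      (encList ((List.range k ++ l).map .num)) c ∧ c ≤ k * (X.cost 0 + 29) + 6 by
    obtain ⟨c, hc, hle⟩ := h
    refine ⟨c, hc, hle.trans ?_⟩
    exact loop_cost (X := X) (K := 1) (C := 0) (by have := X.hn; rw [pow_one]; omega)
  clear hk
  induction k generalizing l with
  | zero =>
    exact ⟨_, .ifLe_true (.left (.var _ _)) (.lit _ _) le_rfl (.right (.var _ _)), by simp⟩
  | succ k ih =>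
    obtain ⟨c, hc, hle⟩ := ih (k :: l)
    rw [List.range_succ, List.append_assoc]
    refine ⟨_, .ifLe_false (.left (.var _ _)) (.lit _ _) (by simp [Val.left, Val.toNat])
        (.call (.pair (.sub (.left (.var _ _)) (.lit _ _))
          (.pair (.sub (.left (.var _ _)) (.lit _ _)) (.right (.var _ _)))) hc), ?_⟩
    rw [Nat.succ_mul]
    omega

theorem calls_verts : Calls X t 2 7 (.pair (.num n) (.num 0)) (encVerts n) := by
  have h := calls_upto (t := t) X n le_rfl []
  refine h.congr ?_
  unfold encVerts
  rw [List.append_nil]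
  congr 1
  rw [← List.map_coe_finRange_eq_range, List.map_map]
  rfl

theorem calls_union (S T : Finset (Fin n)) :
    Calls X t 3 16 (.pair (encSet S) (encSet T)) (encSet (S ∪ T)) := by
  rw [encSet_eq S, encSet_eq T]
  refine (((Within.zip (X := X) (P := hittingProgram t) (k := 3) (C := 9) rfl _ _
    (fun i => encBool (i ∈ S ∨ i ∈ T)) _ X.length_finRange_le) ?_).congr
      (encSet_of_iff fun i => by simp)).mono (by omega)
  intro x _ ρ
  exact (Within.simple rfl (Expr.den_bor rfl rfl)).mono (by decide)

theorem calls_diff (S T : Finset (Fin n)) :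
    Calls X t 4 16 (.pair (encSet S) (encSet T)) (encSet (S \ T)) := by
  rw [encSet_eq S, encSet_eq T]
  refine (((Within.zip (X := X) (P := hittingProgram t) (k := 4) (C := 9) rfl _ _
    (fun i => encBool (i ∈ S ∧ i ∉ T)) _ X.length_finRange_le) ?_).congr
      (encSet_of_iff fun i => by simp)).mono (by omega)
  intro x _ ρ
  refine (Within.simple rfl ?_).mono (show _ ≤ 9 by decide)
  classical
  simp only [Expr.den, List.getD_cons_zero, Val.left, Val.right, encBool, Val.toNat]
  by_cases h : x ∈ S <;> by_cases h' : x ∈ T <;> simp [h, h']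

theorem calls_meets (S T : Finset (Fin n)) :
    Calls X t 5 7 (.pair (encSet S) (encSet T)) (encBool (S ∩ T).Nonempty) := by
  suffices h : ∀ l : List (Fin n), ∃ c, (hittingProgram t).Eval
      [.pair (encList (l.map fun i => encBool (i ∈ S))) (encList (l.map fun i => encBool (i ∈ T)))]
      Code.meets (encBool (∃ i ∈ l, i ∈ S ∧ i ∈ T)) c ∧ c ≤ l.length * (X.cost 0 + 29) + 6 by
    obtain ⟨c, hc, hle⟩ := h (List.finRange n)
    rw [← encSet_eq, ← encSet_eq] at hc
    refine Within.congr ⟨c, hc, hle.trans (loop_cost X.length_finRange_le)⟩ (encBool_congr ?_)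
    simp [Finset.Nonempty]
  intro l
  induction l with
  | nil => exact ⟨_, .ifPair_false (k := 0) (.left (.var _ _)) (by simpa [encBool] using .lit _ _),
      by simp⟩
  | cons x l ih =>
    obtain ⟨c, hc, hle⟩ := ih
    by_cases h : x ∈ S ∧ x ∈ T
    · have : encBool (∃ i ∈ x :: l, i ∈ S ∧ i ∈ T) = .num 1 := by simp [encBool, h]
      rw [this]
      refine ⟨_, .ifPair_true (x := encBool (x ∈ S)) (.left (.var _ _))
        (.ifLe_true (.lit _ _) (.add (.left (.left (.var _ _))) (.left (.right (.var _ _)))) ?_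
          (.lit _ _)), ?_⟩
      · simp [encList, Val.left, Val.right, h, Val.toNat, encBool]
      · simp only [List.length_cons]; rw [Nat.succ_mul]; omega
    · have : encBool (∃ i ∈ x :: l, i ∈ S ∧ i ∈ T) = encBool (∃ i ∈ l, i ∈ S ∧ i ∈ T) :=
        encBool_congr (by simp [h])
      rw [this]
      refine ⟨_, .ifPair_true (x := encBool (x ∈ S)) (.left (.var _ _))
        (.ifLe_false (.lit _ _) (.add (.left (.left (.var _ _))) (.left (.right (.var _ _)))) ?_
          (.call (.pair (.right (.left (.var _ _))) (.right (.right (.var _ _)))) hc)), ?_⟩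
      · by_cases h1 : x ∈ S <;> by_cases h2 : x ∈ T <;>
          simp_all [encList, Val.left, Val.right, Val.toNat, encBool]
      · simp only [List.length_cons]; rw [Nat.succ_mul]; omega

theorem calls_card (S : Finset (Fin n)) : Calls X t 6 7 (encSet S) (.num S.card) := by
  suffices h : ∀ l : List (Fin n), ∃ c, (hittingProgram t).Eval
      [encList (l.map fun i => encBool (i ∈ S))] Code.card
      (.num (l.filter (· ∈ S)).length) c ∧ c ≤ l.length * (X.cost 0 + 29) + 6 by
    obtain ⟨c, hc, hle⟩ := h (List.finRange n)
    rw [← encSet_eq] at hc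
    refine Within.congr ⟨c, hc, hle.trans (loop_cost X.length_finRange_le)⟩ ?_
    rw [← List.toFinset_card_of_nodup ((List.nodup_finRange n).filter _)]
    congr 2
    ext i; simp
  intro l
  induction l with
  | nil => exact ⟨_, .ifPair_false (k := 0) (.var _ _) (.lit _ _), by simp⟩
  | cons x l ih =>
    obtain ⟨c, hc, hle⟩ := ih
    have : (Val.num ((x :: l).filter (· ∈ S)).length) =
        .num ((encBool (x ∈ S)).toNat + (Val.num (l.filter (· ∈ S)).length).toNat) := by
      by_cases h : x ∈ S <;> simp [h, Val.toNat, encBool, add_comm]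
    rw [this]
    refine ⟨_, .ifPair_true (x := encBool (x ∈ S)) (.var _ _)
        (.add (.left (.var _ _)) (.call (.right (.var _ _)) hc)), ?_⟩
    simp only [List.length_cons]; rw [Nat.succ_mul]; omega

theorem calls_look (r : Fin n → Fin n → Prop) (u v : Fin n) :
    Calls X t 7 31 (.pair (encRel r) (.pair (.num u) (.num v))) (encBool (r u v)) :=
  (((calls_row X r u).letCall rfl rfl ((calls_mem X (relRow r u) v).callSimple rfl rfl)).congr
    (encBool_congr mem_relRow)).mono (by decide)

theorem calls_single (w : ℕ) (S : Finset (Fin n)) (hS : ∀ v : Fin n, (v : ℕ) = w ↔ v ∈ S) :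
    Calls X t 8 20 (.pair (encVerts n) (.num w)) (encSet S) := by
  refine ((Within.map (X := X) (P := hittingProgram t) (k := 8) (C := 13) rfl
    (fun i : Fin n => .num i) (fun i => encBool ((i : ℕ) = w)) _ (.num w)
    X.length_finRange_le) ?_).congr
      (encSet_of_iff hS)
  intro x _ ρ
  exact (Within.simple rfl (Expr.den_beq rfl rfl)).mono (by decide)

theorem calls_singleton (w : Fin n) :
    Calls X t 8 20 (.pair (encVerts n) (.num w)) (encSet {w}) :=
  calls_single X w {w} fun v => by simp [Fin.ext_iff]

theorem calls_empty : Calls X t 8 20 (.pair (encVerts n) (.num n)) (encSet (∅ : Finset (Fin n))) :=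
  calls_single X n ∅ fun v => by simp [v.2.ne]

theorem calls_univ :
    Calls X t 38 17 (.pair (encVerts n) (.num 0)) (encSet (Finset.univ : Finset (Fin n))) := by
  refine ((Within.map (X := X) (P := hittingProgram t) (k := 38) (C := 10) rfl
    (fun i : Fin n => .num i) (fun i => encBool True) _ (.num 0) X.length_finRange_le) ?_).congr
      (encSet_of_iff fun v => by simp)
  intro x _ ρ
  exact (Within.simple rfl (by simp [Expr.den, encBool])).mono (by decide)

/-- Matrices computed entry by entry. -/
theorem calls_matrix {k C : ℕ} {s : Expr} (h₁ : (hittingProgram t).body k = mapE k (Code.row k))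
    (h₂ : (hittingProgram t).body (k + 1) = mapE (k + 1) s) (r : Fin n → Fin n → Prop) (b e : Val)
    (hs : ∀ u v : Fin n, ∀ ρ, Within X (hittingProgram t) C
      (.pair (.num v) (.pair (.num u) (.pair (.pair (encVerts n) b) e)) :: ρ) s
        (encBool (r u v))) :
    Calls X t k (C + 25) (.pair (encVerts n) (.pair (.pair (encVerts n) b) e)) (encRel r) := by
  rw [encRel_eq']
  refine ((Within.map (X := X) (P := hittingProgram t) (k := k) (C := C + 18) h₁
    (fun i : Fin n => .num i) (fun i => encList ((List.finRange n).map fun j => encBool (r i j)))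
      _ (.pair (.pair (encVerts n) b) e) X.length_finRange_le) ?_).mono (by omega)
  intro u _ ρ
  refine (Within.callSimple (Within.map (X := X) (P := hittingProgram t) (k := k + 1) h₂
    (fun i : Fin n => .num i) (fun j => encBool (r u j)) _
      (.pair (.num u) (.pair (.pair (encVerts n) b) e)) X.length_finRange_le
      fun v _ ρ => hs u v ρ) rfl rfl).mono ?_
  simp [Expr.nodes]; omega

end Specs

/-! ### Warshall's algorithm -/

section Warshall

variable {V : Type*}

/-- Allow the members of the list as intermediate vertices. -/
def warshall (r : V → V → Prop) (l : List V) : V → V → Prop :=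
  l.foldr (fun k R u v => R u v ∨ (R u k ∧ R k v)) r

/-- A vertex already processed can always be used to concatenate. For the newest vertex this is its
own update rule; for older ones it passes through that rule. -/
theorem warshall_trans (r : V → V → Prop) (l : List V) :
    ∀ m ∈ l, ∀ u v, warshall r l u m → warshall r l m v → warshall r l u v := by
  induction l with
  | nil => simp
  | cons k l ih =>
    intro m hm u v
    simp only [warshall, List.foldr_cons] at ih ⊢
    rcases List.mem_cons.1 hm with rfl | hm
    · tauto
    · have := ih m hm
      rintro (h1 | h1) (h2 | h2)
      · exact .inl (this _ _ h1 h2)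
      · exact .inr ⟨this _ _ h1 h2.1, h2.2⟩
      · exact .inr ⟨h1.1, this _ _ h1.2 h2⟩
      · exact .inr ⟨h1.1, h2.2⟩

theorem warshall_of_rel {r : V → V → Prop} (l : List V) {u v : V} (h : r u v) :
    warshall r l u v := by
  induction l with
  | nil => exact h
  | cons k l ih => exact .inl ih

theorem transGen_of_warshall {r : V → V → Prop} (l : List V) {u v : V} (h : warshall r l u v) :
    Relation.TransGen r u v := by
  induction l generalizing u v with
  | nil => exact .single h
  | cons k l ih => exact h.elim ih fun h => (ih h.1).trans (ih h.2)

theorem warshall_iff {r : V → V → Prop} {l : List V} (hl : ∀ v, v ∈ l) {u v : V} :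
    warshall r l u v ↔ Relation.TransGen r u v := by
  refine ⟨transGen_of_warshall l, fun h => ?_⟩
  induction h with
  | single h => exact warshall_of_rel l h
  | tail _ h ih => exact warshall_trans r l _ (hl _) _ _ ih (warshall_of_rel l h)

end Warshall

/-! ### Cost of reachability, blocks, active parts and validity tests. -/

section GraphSpecs

variable {n t : ℕ} (X : Budget n) (G : SimpleGraph (Fin n)) (KK TT : List (Finset (Fin n)))

theorem calls_stepIn (r : Fin n → Fin n → Prop) (Y : Finset (Fin n)) :
    Calls X t 9 160 (.pair (encVerts n) (.pair (encBase G KK TT) (.pair (encRel r) (encSet Y))))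
      (encRel (StepIn r Y)) := by
  refine (calls_matrix (C := 135) X rfl rfl _ _ _ fun u v ρ => ?_).mono (by decide)
  refine (((calls_mem X Y u).letCall rfl rfl ((calls_mem X Y v).letCall rfl rfl
    ((calls_look X r u v).letCall rfl rfl (.simple rfl
      (Expr.den_band (Expr.den_band rfl rfl) (Expr.den_bor (Expr.den_beq rfl rfl) rfl)))))).congr
        (encBool_congr ?_)).mono (by decide)
  simp only [StepIn, Fin.ext_iff, and_assoc]

theorem calls_warshallMatrix (r : Fin n → Fin n → Prop) (k : Fin n) :
    Calls X t 11 220 (.pair (encVerts n) (.pair (encBase G KK TT) (.pair (encRel r) (.num k))))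
      (encRel fun u v => r u v ∨ (r u k ∧ r k v)) := by
  refine (calls_matrix (C := 195) X rfl rfl _ _ _ fun u v ρ => ?_).mono (by decide)
  exact ((calls_look X r u v).letCall rfl rfl ((calls_look X r u k).letCall rfl rfl
    ((calls_look X r k v).letCall rfl rfl (.simple rfl
      (Expr.den_bor rfl (Expr.den_band rfl rfl)))))).mono (by decide)

theorem calls_linked (r : Fin n → Fin n → Prop) (Y : Finset (Fin n)) :
    Calls X t 14 450 (.pair (encBase G KK TT) (.pair (encRel r) (encSet Y)))
      (encRel (Linked r Y)) := by
  have hw : Calls X t 13 250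
      (.pair (encVerts n) (.pair (encRel (StepIn r Y)) (encBase G KK TT)))
      (encRel (warshall (StepIn r Y) (List.finRange n))) := by
    refine (Within.fold (C := 243) rfl (fun i : Fin n => Val.num i) encRel
      (fun k R u v => R u v ∨ (R u k ∧ R k v)) _ (StepIn r Y) (encBase G KK TT)
      X.length_finRange_le ?_).mono (by decide)
    exact fun k _ R ρ => ((calls_warshallMatrix X G KK TT R k).callSimple rfl rfl).mono (by decide)
  refine (((calls_stepIn X G KK TT r Y).letCall rfl rfl (hw.callSimple rfl rfl)).congr
    (encRel_congr fun i j => ?_)).mono (by decide)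
  exact warshall_iff List.mem_finRange

theorem relRow_linked (r : Fin n → Fin n → Prop) (Y : Finset (Fin n)) (v : Fin n) :
    relRow (Linked r Y) v = linkedSet r Y v := by
  classical
  ext u
  rw [mem_relRow, linkedSet, Finset.mem_filter]
  refine ⟨fun h => ⟨?_, h⟩, fun h => h.2⟩
  cases h with
  | single h => exact h.2.1
  | tail _ h => exact h.2.1

theorem calls_linkedRow (r : Fin n → Fin n → Prop) (Y : Finset (Fin n)) (v : Fin n) :
    Calls X t 1 7 (.pair (encRel (Linked r Y)) (.num v)) (encSet (linkedSet r Y v)) := by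
  rw [← relRow_linked]; exact calls_row X _ v

/-- The list of the reachability matrices of `G[C] - u`. -/
noncomputable def encDeleted (C : Finset (Fin n)) : Val :=
  encList ((List.finRange n).map fun u => encRel (Linked G.Adj (C \ {u})))

theorem calls_deleted (C : Finset (Fin n)) :
    Calls X t 15 550 (.pair (encVerts n) (.pair (encBase G KK TT) (encSet C)))
      (encDeleted G C) := by
  refine (Within.map (C := 543) rfl (fun i : Fin n => Val.num i)
    (fun u => encRel (Linked G.Adj (C \ {u}))) _ (.pair (encBase G KK TT) (encSet C))
    X.length_finRange_le fun u _ ρ => ?_).mono (by decide)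
  exact ((calls_singleton X u).letCall rfl rfl ((calls_diff X C {u}).letCall rfl rfl
    ((calls_linked X G KK TT G.Adj (C \ {u})).callSimple rfl rfl))).mono (by decide)

theorem calls_deletedGet (C : Finset (Fin n)) (u : Fin n) :
    Calls X t 1 7 (.pair (encDeleted G C) (.num u)) (encRel (Linked G.Adj (C \ {u}))) := by
  have h := calls_nth (t := t) X
    ((List.finRange n).map fun u => encRel (Linked G.Adj (C \ {u}))) u (by simp)
    (by simpa using X.length_finRange_le)
  simpa [encDeleted] using h

theorem encBool_any {α : Type*} (p : α → Prop) (l : List α) :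
    l.foldr (fun x (b : Prop) => b ∨ p x) False = ∃ x ∈ l, p x := by
  induction l with
  | nil => simp
  | cons x l ih => rw [List.foldr_cons, ih]; simp [or_comm]

/-- Search a list for an entry with property `p`. -/
theorem Within.any {α : Type*} {k K C : ℕ} {s : Expr} (hk : (hittingProgram t).body k = foldE k s)
    (eα : α → Val) (p : α → Prop) (l : List α) (e : Val) (hl : l.length ≤ X.B ^ K)
    (hs : ∀ x ∈ l, ∀ (b : Prop) (ρ : List Val), Within X (hittingProgram t) C
      (.pair (eα x) (.pair (encBool b) e) :: ρ) s (encBool (b ∨ p x))) :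
    Calls X t k (K + C + 6) (.pair (encList (l.map eα)) (.pair (.num 0) e))
      (encBool (∃ x ∈ l, p x)) := by
  have h := Within.fold hk eα encBool (fun x b => b ∨ p x) l False e hl hs
  rw [encBool_any] at h
  simpa [encBool] using h

theorem calls_separated (C : Finset (Fin n)) (a x z : Fin n) :
    Calls X t 16 250 (.pair (encVerts n) (.pair (.num 0)
      (.pair (.num z) (.pair (.num a) (.pair (.num x) (encDeleted G C))))))
      (encBool (Separated G C a x z)) := by
  refine ((Within.any X (C := 243) rfl (fun i : Fin n => Val.num i)
    (fun u => ¬ (u : ℕ) = z ∧ ¬ Linked G.Adj (C \ {u}) x z ∧ ¬ Linked G.Adj (C \ {u}) a z) _ _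
    X.length_finRange_le fun u _ b ρ => ?_).congr (encBool_congr ?_)).mono (by decide)
  · exact ((calls_deletedGet X G C u).letCall rfl rfl ((calls_look X _ x z).letCall rfl rfl
      ((calls_look X _ a z).letCall rfl rfl (.simple rfl (Expr.den_bor rfl
        (Expr.den_band (Expr.den_bnot (Expr.den_beq rfl rfl))
          (Expr.den_band (Expr.den_bnot rfl) (Expr.den_bnot rfl)))))))).mono (by decide)
  · simp [Separated, Fin.ext_iff]

theorem calls_blockCompl (C : Finset (Fin n)) (a x : Fin n) :
    Calls X t 17 320 (.pair (encVerts n) (.pair (encVerts n)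
      (.pair (.num a) (.pair (.num x) (encDeleted G C))))) (encSet (blockCompl G C a x)) := by
  refine ((Within.map (C := 313) rfl (fun i : Fin n => Val.num i)
    (fun z => encBool (Separated G C a x z)) _ (.pair (encVerts n)
      (.pair (.num a) (.pair (.num x) (encDeleted G C))))
    X.length_finRange_le fun z _ ρ => ?_).congr
      (encSet_of_iff fun z => by simp [blockCompl])).mono (by decide)
  exact ((calls_separated X G C a x z).callSimple rfl rfl).mono (by decide)

variable {KK TT} {K : ℕ}

theorem calls_avoids (hTT : TT.length ≤ X.B ^ K) (D : Finset (Fin n)) :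
    Calls X t 18 (K + 50) (.pair (encList (TT.map encSet)) (.pair (.num 0) (encSet D)))
      (encBool (∃ Q ∈ TT, Disjoint Q D)) := by
  refine (Within.any X (C := 40) rfl encSet (fun Q => Disjoint Q D) _ _ hTT
    fun Q _ b ρ => ?_).mono (by omega)
  refine (((calls_meets X Q D).letCall rfl rfl (.simple rfl (Expr.den_bor rfl
    (Expr.den_bnot rfl)))).congr (encBool_congr ?_)).mono (by decide)
  rw [Finset.not_nonempty_iff_eq_empty, Finset.disjoint_iff_inter_eq_empty]

theorem calls_goodEdge (hTT : TT.length ≤ X.B ^ K) (C : Finset (Fin n)) :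
    Calls X t 19 (K + 600) (.pair (encVerts n) (.pair (encBase G KK TT) (encDeleted G C)))
      (encRel (GoodEdge G TT C)) := by
  refine (calls_matrix (C := K + 550) X rfl rfl _ _ _ fun a x ρ => ?_).mono (by omega)
  refine ((calls_look X G.Adj a x).letCall rfl rfl ((calls_blockCompl X G C a x).letCall rfl rfl
    ((calls_avoids X hTT (blockCompl G C a x)).letCall rfl rfl
      (.simple rfl (Expr.den_band rfl (Expr.den_bnot rfl)))))).mono ?_
  simp only [Expr.nodes]; omega

/-- The function receives the complement of A, so that the inclusion of Q in A becomes the failure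
of an intersection test; the members of `TT` that pass are united. -/
theorem calls_active (hTT : TT.length ≤ X.B ^ K) (A : Finset (Fin n)) :
    Calls X t 21 (K + 80)
      (.pair (encList (TT.map encSet)) (.pair (encSet (∅ : Finset (Fin n)))
        (encSet (Finset.univ \ A)))) (encSet (activePart TT A)) := by
  classical
  refine ((Within.fold (C := 70) rfl encSet encSet
    (fun Q acc => if (Q ∩ (Finset.univ \ A)).Nonempty then acc else Q ∪ acc) _ ∅ _ hTT
    fun Q _ acc ρ => ?_).congr ?_).mono (by omega)
  · refine ((calls_meets X Q (Finset.univ \ A)).letCall rfl rfl (.ifLe (K := 40)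
      (.simple rfl rfl) (.simple rfl rfl) ?_ ?_)).mono (by decide)
    · intro h
      rw [if_pos (one_le_encBool.1 h)]
      exact (Within.simple rfl rfl).mono (by decide)
    · intro h
      rw [if_neg fun h' => h (one_le_encBool.2 h')]
      exact ((calls_union X Q acc).callSimple rfl rfl).mono (by decide)
  · congr 1
    have key : ∀ Q : Finset (Fin n), (Q ∩ (Finset.univ \ A)).Nonempty ↔ ¬ Q ⊆ A := by
      intro Q; rw [Finset.not_subset]; simp [Finset.Nonempty]
    ext v
    simp only [activePart, Finset.mem_filter, key]
    clear hTT
    induction TT with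
    | nil => simp
    | cons Q l ih =>
      rw [List.foldr_cons]
      by_cases h : Q ⊆ A
      · simp only [h, not_true_eq_false, if_false, Finset.mem_union, ih, List.mem_cons,
          exists_eq_or_imp, true_and]
        have := @h v
        tauto
      · simp only [h, not_false_eq_true, if_true, ih, List.mem_cons, exists_eq_or_imp, false_and,
          false_or]

/-- A search for a violated constraint. Inclusion in A ∪ F is again tested by disjointness from the
complement. -/
theorem calls_bad (hKK : KK.length ≤ X.B ^ K) (A F S : Finset (Fin n)) :
    Calls X t 25 (K + 150) (.pair (encList (KK.map encSet)) (.pair (.num 0)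
      (.pair (encSet (Finset.univ \ (A ∪ F))) (.pair (encSet A) (encSet (A ∩ S))))))
      (encBool (¬ Valid KK A F S)) := by
  refine ((Within.any X (C := 120) rfl encSet (fun Q =>
    ((¬ (Q ∩ (Finset.univ \ (A ∪ F))).Nonempty ∧ (Q ∩ A).Nonempty) ∧ ¬ (Q ∩ (A ∩ S)).Nonempty))
    _ _ hKK fun Q _ b ρ => ?_).congr (encBool_congr ?_)).mono (by omega)
  · exact ((calls_meets X Q _).letCall rfl rfl ((calls_meets X Q A).letCall rfl rfl
      ((calls_meets X Q (A ∩ S)).letCall rfl rfl (.simple rfl (Expr.den_bor rfl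
        (Expr.den_band (Expr.den_band (Expr.den_bnot rfl) rfl) (Expr.den_bnot rfl))))))).mono
          (by decide)
  · have key : ∀ Q : Finset (Fin n), ¬ (Q ∩ (Finset.univ \ (A ∪ F))).Nonempty ↔ Q ⊆ A ∪ F := by
      intro Q
      rw [not_iff_comm, Finset.not_subset]
      simp only [Finset.Nonempty, Finset.mem_inter, Finset.mem_sdiff, Finset.mem_univ, true_and]
    simp only [key, Valid]
    push Not
    simp only [and_assoc]

theorem calls_pick (hKK : KK.length ≤ X.B ^ K) (A F x y : Finset (Fin n)) :
    Calls X t 26 (K + 500) (.pair (encBase G KK TT) (.pair (.pair (encSet A) (encSet F))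
      (.pair (encSet x) (encSet y)))) (encSet (pick KK A F x y)) := by
  have hi : A \ (A \ x) = A ∩ x := by ext; simp
  have hd := calls_diff (t := t) X A (A \ x)
  rw [hi] at hd
  refine ((calls_union X A F).letCall rfl rfl ((calls_diff X Finset.univ (A ∪ F)).letCall rfl rfl
    ((calls_diff X A x).letCall rfl rfl (hd.letCall rfl rfl
      ((calls_bad X hKK A F x).letCall rfl rfl ((calls_card X x).letCall rfl rfl
        ((calls_card X y).letCall rfl rfl (.ifLe (K := 60) (.simple rfl rfl) (.simple rfl rfl)
          ?_ ?_)))))))).mono (by simp only [Expr.nodes]; omega)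
  · intro h
    unfold pick
    rw [if_neg fun h' => one_le_encBool.1 h h'.1]
    exact (Within.simple rfl rfl).mono (by decide)
  · intro h
    have hv : Valid KK A F x := not_not.1 fun h' => h (one_le_encBool.2 h')
    refine (Within.ifLe (K := 10) (.simple rfl rfl) (.simple rfl rfl) ?_ ?_).mono (by decide)
    · intro hc
      unfold pick
      rw [if_neg fun h' => not_lt.2 hc h'.2]
      exact (Within.simple rfl rfl).mono (by decide)
    · intro hc
      unfold pick
      rw [if_pos ⟨hv, not_le.1 hc⟩]
      exact (Within.simple rfl rfl).mono (by decide)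

end GraphSpecs

/-! ### Cost of enumerating small sets and of one level of the recursion. -/

section SolveSpecs

variable {n t : ℕ} (X : Budget n) (G : SimpleGraph (Fin n)) {KK TT : List (Finset (Fin n))} {K : ℕ}

/-- Lists of sets as data. -/
noncomputable def encFamily (l : List (Finset (Fin n))) : Val := encList (l.map encSet)

theorem foldr_cons_length {α β : Type*} (f : α → β) (l : List α) (acc : List β) :
    (l.foldr (fun v acc => f v :: acc) acc).length = l.length + acc.length := by
  induction l with
  | nil => simp
  | cons x l ih => rw [List.foldr_cons, List.length_cons, ih, List.length_cons]; omega

/-- The length obeys L ↦ nL + 1, and n(n+1)^k + 1 ≤ (n+1)^(k+1). -/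
theorem length_smallSets_le (n k : ℕ) : (smallSets n k).length ≤ (n + 1) ^ k := by
  induction k with
  | zero => simp [smallSets]
  | succ k ih =>
    have key : ∀ l : List (Finset (Fin n)), (l.foldr (fun s acc =>
        (List.finRange n).foldr (fun v acc => (s ∪ {v}) :: acc) acc) [∅]).length
          = l.length * n + 1 := by
      intro l
      induction l with
      | nil => simp
      | cons s l ih =>
        rw [List.foldr_cons, foldr_cons_length, ih, List.length_finRange, List.length_cons]
        ring
    rw [smallSets, key, pow_succ, mul_add, mul_one]
    exact Nat.add_le_add (Nat.mul_le_mul_right _ ih) (Nat.one_le_pow _ _ (by omega))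

theorem calls_insertAll (s : Finset (Fin n)) (l : List (Finset (Fin n))) :
    Calls X t 22 90 (.pair (encVerts n) (.pair (encFamily l) (.pair (encSet s) (encVerts n))))
      (encFamily ((List.finRange n).foldr (fun v acc => (s ∪ {v}) :: acc) l)) := by
  refine (Within.fold (C := 80) rfl (fun i : Fin n => Val.num i) encFamily _ _ l
    (.pair (encSet s) (encVerts n)) X.length_finRange_le fun v _ acc ρ => ?_).mono (by decide)
  exact ((calls_singleton X v).letCall rfl rfl ((calls_union X s {v}).letCall rfl rfl
    (.simple rfl rfl))).mono (by decide)

theorem calls_smallSets (k : ℕ) (hk : (n + 2) ^ k ≤ X.B ^ K) :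
    Calls X t 24 (2 * K + 150) (.pair (.num k) (.pair (encVerts n) (encSet (∅ : Finset (Fin n)))))
      (encFamily (smallSets n k)) := by
  suffices h : ∃ c, (hittingProgram t).Eval
      [.pair (.num k) (.pair (encVerts n) (encSet (∅ : Finset (Fin n))))] Code.smallSets
      (encFamily (smallSets n k)) c ∧ c ≤ k * (X.cost (K + 140) + 29) + 6 + 6 by
    obtain ⟨c, hc, hle⟩ := h
    refine ⟨c, hc, ?_⟩
    -- The recursion depth k counts as a number of rounds, so it too must be bounded by a power of
    -- B; k ≤ 2^k does this.
    have hk' : k ≤ X.B ^ K :=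
      (Nat.lt_two_pow_self.le.trans (Nat.pow_le_pow_left (by omega) k)).trans hk
    have := loop_cost (C := K + 140) hk'
    have h1 := X.two_mul_cost (K + (K + 140) + 6)
    have h2 : X.cost (K + (K + 140) + 6 + 1) ≤ X.cost (2 * K + 150) := X.cost_mono (by omega)
    have h3 := X.le_cost (K + (K + 140) + 6)
    omega
  induction k with
  | zero =>
    exact ⟨_, .ifLe_true (.left (.var _ _)) (.lit _ _) le_rfl
      (.pair (.right (.right (.var _ _))) (.lit _ _)), by simp⟩
  | succ k ih =>
    have hk' : (n + 2) ^ k ≤ X.B ^ K := (Nat.pow_le_pow_right (by omega) (by omega)).trans hk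
    obtain ⟨c, hc, hle⟩ := ih hk'
    have hs : Calls X t 23 (K + 120) (.pair (encFamily (smallSets n k))
        (.pair (encFamily [(∅ : Finset (Fin n))]) (encVerts n)))
        (encFamily (smallSets n (k + 1))) := by
      refine (Within.fold (C := 110) rfl encSet encFamily _ _ [∅] (encVerts n)
        ((length_smallSets_le n k).trans ((Nat.pow_le_pow_left (by omega) k).trans hk'))
        fun s _ acc ρ => ?_).mono (by omega)
      exact ((calls_insertAll X s acc).callSimple rfl rfl).mono (by decide)
    obtain ⟨d, hd, hle'⟩ := hs
    refine ⟨_, .ifLe_false (.left (.var _ _)) (.lit _ _) (by simp [Val.left, Val.toNat])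
      (.bind (.call (.pair (.sub (.left (.var _ _)) (.lit _ _)) (.right (.var _ _))) hc)
        (.call (.pair (.var _ _) (.pair (.pair (.right (.right (.var _ _))) (.lit _ _))
          (.left (.right (.var _ _))))) hd)), ?_⟩
    have := hle'.trans (X.cost_mono (show K + 120 ≤ K + 140 by omega))
    have h1 := X.two_mul_cost (K + 120)
    have h2 : X.cost (K + 120 + 1) ≤ X.cost (K + 140) := X.cost_mono (by omega)
    have h3 := X.le_cost (K + 120)
    rw [Nat.succ_mul]
    omega

/-- S fails to be a clique when some u in S misses a vertex of S outside its closed neighbourhood.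
-/
theorem calls_nonClique (S : Finset (Fin n)) (b : Val) :
    Calls X t 36 200 (.pair (encVerts n) (.pair (.num 0) (.pair (encSet S)
      (.pair (encVerts n) (.pair (encRel G.Adj) b))))) (encBool (¬ G.IsClique S)) := by
  refine ((Within.any X (C := 190) rfl (fun i : Fin n => Val.num i)
    (fun u => u ∈ S ∧ ((S \ (relRow G.Adj u ∪ {u})) ∩ S).Nonempty) _ _
    X.length_finRange_le fun u _ c ρ => ?_).congr (encBool_congr ?_)).mono (by decide)
  · exact ((calls_mem X S u).letCall rfl rfl ((calls_row X G.Adj u).letCall rfl rfl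
      ((calls_singleton X u).letCall rfl rfl ((calls_union X _ _).letCall rfl rfl
        ((calls_diff X S _).letCall rfl rfl ((calls_meets X _ S).letCall rfl rfl
          (.simple rfl (Expr.den_bor rfl (Expr.den_band rfl rfl))))))))).mono (by decide)
  · simp only [SimpleGraph.IsClique, Set.Pairwise, Finset.Nonempty, Finset.mem_inter,
      Finset.mem_sdiff, Finset.mem_union, mem_relRow, Finset.mem_singleton, List.mem_finRange,
      true_and, Finset.mem_coe]
    push Not
    constructor
    · rintro ⟨u, hu, v, ⟨hv, h1, h2⟩, -⟩
      exact ⟨u, hu, v, hv, Ne.symm h2, h1⟩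
    · rintro ⟨u, hu, v, hv, h1, h2⟩
      exact ⟨u, hu, v, ⟨hv, h2, Ne.symm h1⟩, hv⟩

theorem calls_addCliques (init l : List (Finset (Fin n))) (b : Val) (hl : l.length ≤ X.B ^ K) :
    Calls X t 37 (K + 350) (.pair (encFamily l) (.pair (encFamily init)
      (.pair (encVerts n) (.pair (encRel G.Adj) b)))) (encFamily (addCliques G t init l)) := by
  classical
  unfold addCliques
  refine (Within.fold (C := 340) rfl encSet encFamily _ l init
    (.pair (encVerts n) (.pair (encRel G.Adj) b)) hl fun S _ acc ρ => ?_).mono (by omega)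
  refine ((calls_nonClique X G S b).letCall rfl rfl ((calls_card X S).letCall rfl rfl
    (.ifLe (K := 50) (.simple rfl rfl) (.simple rfl rfl) ?_ ?_))).mono (by decide)
  · intro h
    rw [if_neg fun h' => one_le_encBool.1 h h'.1]
    exact (Within.simple rfl rfl).mono (by decide)
  · intro h
    have hc : G.IsClique S := not_not.1 fun h' => h (one_le_encBool.2 h')
    refine (Within.ifLe (K := 30) (.simple rfl rfl) (.simple rfl rfl) ?_ ?_).mono
      (by simp [Expr.nodes])
    · intro h1
      refine (Within.ifLe (K := 10) (.simple rfl rfl) (.simple rfl rfl) ?_ ?_).mono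
        (by simp [Expr.nodes])
      · intro h2
        rw [if_pos ⟨hc, le_antisymm h1 h2⟩]
        exact (Within.simple rfl rfl).mono (by decide)
      · intro h2
        rw [if_neg fun h' => h2 h'.2.ge]
        exact (Within.simple rfl rfl).mono (by decide)
    · intro h1
      rw [if_neg fun h' => h1 h'.2.le]
      exact (Within.simple rfl rfl).mono (by decide)

/-- The arguments of the two solvers. -/
noncomputable def encTask (G : SimpleGraph (Fin n)) (KK TT : List (Finset (Fin n)))
    (A F : Finset (Fin n)) (p : Val) : Val :=
  .pair (encBase G KK TT) (.pair (.pair (encSet A) (encSet F)) p)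

variable {l k : ℕ} {rec : Finset (Fin n) → Finset (Fin n) → Finset (Fin n)}

/-- The exponent 0 in `hrec` means that a recursive call fits in one time unit τ. Costs of a level
are thus measured relative to those of the level below. -/
theorem calls_pendantSol (hKK : KK.length ≤ X.B ^ K)
    (hrec : ∀ A F, Calls X t 35 0 (encTask G KK TT A F (.pair (.num l) (.num (k + 1))))
      (encSet (rec A F))) (C F T Y : Finset (Fin n)) (w : Fin n) :
    Calls X t 34 (K + 1500) (.pair (.num w) (.pair (encSet Y) (encTask G KK TT C F
      (.pair (.pair (.num l) (.num k)) (encSet T))))) (encSet (pendantSol G KK rec C F T Y w)) := by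
  refine ((calls_singleton X w).letCall rfl rfl ((calls_diff X C T).letCall rfl rfl
    ((calls_union X (C \ T) {w}).letCall rfl rfl
    ((calls_linked X G KK TT G.Adj ((C \ T) ∪ {w})).letCall rfl rfl
    ((calls_linkedRow X G.Adj _ w).letCall rfl rfl
    ((calls_diff X _ T).letCall rfl rfl ((hrec (pendant G C T w) F).letCall rfl rfl
    ((calls_union X {w} (rec (pendant G C T w) F)).letCall rfl rfl
    ((calls_mem X Y w).letCall rfl rfl (.ifLe (K := K + 750)
      (.simple rfl rfl) (.simple rfl rfl) ?_ ?_)))))))))).mono (by simp only [Expr.nodes]; omega)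
  · intro h
    unfold pendantSol
    rw [if_pos (one_le_encBool.1 h)]
    exact (Within.simple rfl rfl).mono (by simp only [Expr.nodes]; omega)
  · intro h
    unfold pendantSol
    rw [if_neg fun h' => h (one_le_encBool.2 h')]
    exact ((calls_union X F {w}).letCall rfl rfl
      ((hrec (pendant G C T w) (F ∪ {w})).letCall rfl rfl
      ((calls_union X (pendant G C T w) {w}).letCall rfl rfl
        ((calls_pick X G hKK (pendant G C T w ∪ {w}) F _ _).callSimple rfl rfl)))).mono
          (by simp only [Expr.nodes]; omega)

theorem calls_solveRoot (hKK : KK.length ≤ X.B ^ K) (hk : (n + 2) ^ k ≤ X.B ^ K)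
    (hrec : ∀ A F, Calls X t 35 0 (encTask G KK TT A F (.pair (.num l) (.num (k + 1))))
      (encSet (rec A F))) (C F T : Finset (Fin n)) :
    Calls X t 31 (6 * K + 2700) (encTask G KK TT C F
      (.pair (.pair (.num l) (.num k)) (encSet T))) (encSet (solveRoot G KK rec k C F T)) := by
  have hu : ∀ Y, Calls X t 33 (K + 1650) (.pair (encVerts n) (.pair (encSet (∅ : Finset (Fin n)))
      (.pair (encSet Y) (encTask G KK TT C F (.pair (.pair (.num l) (.num k)) (encSet T))))))
      (encSet (unionOver (List.finRange n) T (pendantSol G KK rec C F T Y))) := by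
    intro Y
    refine (Within.fold (C := K + 1600) rfl (fun i : Fin n => Val.num i) encSet _ _ ∅
      (.pair (encSet Y) (encTask G KK TT C F (.pair (.pair (.num l) (.num k)) (encSet T))))
      X.length_finRange_le fun w _ acc ρ => ?_).mono (by omega)
    refine ((calls_mem X T w).letCall rfl rfl (.ifLe (K := K + 1560) (.simple rfl rfl)
      (.simple rfl rfl) ?_ ?_)).mono (by simp only [Expr.nodes]; omega)
    · intro h
      rw [if_pos (one_le_encBool.1 h)]
      exact ((calls_pendantSol X G hKK hrec C F T Y w).letCall rfl rfl
        ((calls_union X _ acc).callSimple rfl rfl)).mono (by simp only [Expr.nodes]; omega)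
    · intro h
      rw [if_neg fun h' => h (one_le_encBool.2 h')]
      exact (Within.simple rfl rfl).mono (by simp only [Expr.nodes]; omega)
  have hf : Calls X t 32 (4 * K + 2300) (.pair (encFamily (smallSets n k)) (.pair (encSet C)
      (encTask G KK TT C F (.pair (.pair (.num l) (.num k)) (encSet T)))))
      (encSet (solveRoot G KK rec k C F T)) := by
    refine (Within.fold (C := 2 * K + 2250) rfl encSet encSet _ _ C
      (encTask G KK TT C F (.pair (.pair (.num l) (.num k)) (encSet T)))
      ((length_smallSets_le n k).trans ((Nat.pow_le_pow_left (by omega) k).trans hk))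
      fun Y _ acc ρ => ?_).mono (by omega)
    exact ((hu Y).letCall rfl rfl ((calls_pick X G hKK C F _ acc).callSimple rfl rfl)).mono
      (by simp only [Expr.nodes]; omega)
  exact ((calls_smallSets X k hk).letCall rfl rfl (hf.callSimple rfl rfl)).mono
    (by simp only [Expr.nodes]; omega)

theorem calls_solveConn_zero (C F : Finset (Fin n)) :
    Calls X t 29 30 (encTask G KK TT C F (.pair (.num 0) (.num k)))
      (encSet (∅ : Finset (Fin n))) := by
  refine (Within.ifLe (K := 10) (x := .num 0) (y := .num 0) (.simple rfl rfl) (.simple rfl rfl)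
    (fun _ => ?_) fun h => absurd (Nat.le_refl 0) h).mono (by decide)
  exact (Within.simple rfl rfl).mono (by decide)

theorem calls_solveConn_succ (hKK : KK.length ≤ X.B ^ K) (hTT : TT.length ≤ X.B ^ K)
    (hk : (n + 2) ^ k ≤ X.B ^ K)
    (hrec : ∀ A F, Calls X t 35 0 (encTask G KK TT A F (.pair (.num l) (.num (k + 1))))
      (encSet (rec A F))) (C F : Finset (Fin n)) :
    Calls X t 29 (9 * K + 6000) (encTask G KK TT C F (.pair (.num (l + 1)) (.num k)))
      (encSet (solveConn G KK TT rec k C F)) := by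
  have hf : Calls X t 30 (8 * K + 3500) (.pair (encVerts n) (.pair (encSet C)
      (encTask G KK TT C F (.pair (.pair (.num l) (.num k))
        (encRel (Linked (GoodEdge G TT C) C))))))
      (encSet (solveConn G KK TT rec k C F)) := by
    refine (Within.fold (C := 8 * K + 3400) rfl (fun i : Fin n => Val.num i) encSet _ _ C
      (encTask G KK TT C F (.pair (.pair (.num l) (.num k))
        (encRel (Linked (GoodEdge G TT C) C))))
      X.length_finRange_le fun v _ acc ρ => ?_).mono (by omega)
    exact ((calls_linkedRow X (GoodEdge G TT C) C v).letCall rfl rfl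
      ((calls_solveRoot X G hKK hk hrec C F _).letCall rfl rfl
        ((calls_pick X G hKK C F _ acc).callSimple rfl rfl))).mono
          (by simp only [Expr.nodes]; omega)
  refine (Within.ifLe (K := 9 * K + 5900) (x := .num (l + 1)) (y := .num 0)
    (.simple rfl rfl) (.simple rfl rfl)
    (fun h => absurd (show l + 1 ≤ 0 from h) (by omega)) fun _ => ?_).mono
      (by simp only [Expr.nodes]; omega)
  exact ((calls_deleted X G KK TT C).letCall rfl rfl ((calls_goodEdge X G hTT C).letCall rfl rfl
    ((calls_linked X G KK TT (GoodEdge G TT C) C).letCall rfl rfl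
      (hf.callSimple rfl rfl)))).mono (by simp only [Expr.nodes]; omega)

/-- The exponent D of the connected solver is left open so that the bottom level, with its trivial
solver, and all higher levels use the same statement. -/
theorem calls_solveSplit {recC : Finset (Fin n) → Finset (Fin n) → Finset (Fin n)} {D : ℕ}
    (hKK : KK.length ≤ X.B ^ K) (hTT : TT.length ≤ X.B ^ K) (hk : (n + 2) ^ k ≤ X.B ^ K)
    (hrecC : ∀ C F, Calls X t 29 D (encTask G KK TT C F (.pair (.num l) (.num k)))
      (encSet (recC C F))) (A F : Finset (Fin n)) :
    Calls X t 35 (D + 9 * K + 6000) (encTask G KK TT A F (.pair (.num l) (.num k)))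
      (encSet (solveSplit G KK TT recC k A F)) := by
  set A' := activePart TT A with hA'
  have hu : ∀ F', Calls X t 28 (D + 700) (.pair (encVerts n) (.pair (encSet (∅ : Finset (Fin n)))
      (.pair (encBase G KK TT) (.pair (encSet A') (.pair (encSet F')
        (.pair (.num l) (.num k))))))) (encSet (unionOver (List.finRange n) A' fun v =>
          recC (linkedSet G.Adj A' v) F')) := by
    intro F'
    refine (Within.fold (C := D + 680) rfl (fun i : Fin n => Val.num i) encSet _ _ ∅
      (.pair (encBase G KK TT) (.pair (encSet A') (.pair (encSet F')
        (.pair (.num l) (.num k))))) X.length_finRange_le fun v _ acc ρ => ?_).mono (by omega)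
    refine ((calls_mem X A' v).letCall rfl rfl (.ifLe (K := D + 640) (.simple rfl rfl)
      (.simple rfl rfl) ?_ ?_)).mono (by simp only [Expr.nodes]; omega)
    · intro h
      rw [if_pos (one_le_encBool.1 h)]
      exact ((calls_linked X G KK TT G.Adj A').letCall rfl rfl
        ((calls_linkedRow X G.Adj A' v).letCall rfl rfl
        ((hrecC (linkedSet G.Adj A' v) F').letCall rfl rfl
        ((calls_union X _ acc).callSimple rfl rfl)))).mono (by simp only [Expr.nodes]; omega)
    · intro h
      rw [if_neg fun h' => h (one_le_encBool.2 h')]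
      exact (Within.simple rfl rfl).mono (by simp only [Expr.nodes]; omega)
  have hf : Calls X t 27 (D + 3 * K + 2500) (.pair (encFamily (smallSets n k)) (.pair (encSet A)
      (encTask G KK TT A F (.pair (.pair (.num l) (.num k)) (encSet A')))))
      (encSet (solveSplit G KK TT recC k A F)) := by
    refine (Within.fold (C := D + 2 * K + 2450) rfl encSet encSet _ _ A
      (encTask G KK TT A F (.pair (.pair (.num l) (.num k)) (encSet A')))
      ((length_smallSets_le n k).trans ((Nat.pow_le_pow_left (by omega) k).trans hk))
      fun s _ acc ρ => ?_).mono (by omega)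
    have hi : A \ (A \ s) = A ∩ s := by ext; simp
    have hd := calls_diff (t := t) X A (A \ s)
    rw [hi] at hd
    exact ((calls_diff X A s).letCall rfl rfl (hd.letCall rfl rfl
      ((calls_diff X (A ∩ s) A').letCall rfl rfl ((calls_diff X A A').letCall rfl rfl
      ((calls_diff X (A \ A') _).letCall rfl rfl ((calls_union X F _).letCall rfl rfl
      ((hu _).letCall rfl rfl ((calls_union X ((A ∩ s) \ A') _).letCall rfl rfl
        ((calls_pick X G hKK A F _ acc).callSimple rfl rfl))))))))).mono
          (by simp only [Expr.nodes]; omega)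
  exact ((calls_smallSets X k hk).letCall rfl rfl ((calls_diff X Finset.univ A).letCall rfl rfl
    ((calls_active X hTT A).letCall rfl rfl (hf.callSimple rfl rfl)))).mono
      (by simp only [Expr.nodes]; omega)

end SolveSpecs

theorem Within.ifPair_true {n : ℕ} {X : Budget n} {P : Program} {ρ : List Val} {C D : ℕ}
    {a e₁ e₂ : Expr} {x y z : Val} (ha : Within X P C ρ a (.pair x y))
    (h : Within X P D ρ e₁ z) : Within X P (C + D + 2) ρ (.ifPair a e₁ e₂) z := by
  obtain ⟨c, hc, hle⟩ := ha
  obtain ⟨d, hd, hle'⟩ := h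
  exact ⟨_, .ifPair_true hc hd, add_one_le hle hle'⟩

theorem Within.ifPair_false {n : ℕ} {X : Budget n} {P : Program} {ρ : List Val} {C D k : ℕ}
    {a e₁ e₂ : Expr} {z : Val} (ha : Within X P C ρ a (.num k))
    (h : Within X P D ρ e₂ z) : Within X P (C + D + 2) ρ (.ifPair a e₁ e₂) z := by
  obtain ⟨c, hc, hle⟩ := ha
  obtain ⟨d, hd, hle'⟩ := h
  exact ⟨_, .ifPair_false hc hd, add_one_le hle hle'⟩

/-! ### Total running time of the recursion and of the main function. -/

section MainSpec

variable {n t : ℕ}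

/-- The budget with base `B` and time unit `B ^ j`. -/
def Budget.power {B : ℕ} (hB : n + 2 ≤ B) (j : ℕ) : Budget n where
  B := B
  τ := B ^ j
  hn := hB
  hτ := Nat.one_le_pow _ _ (by omega)

theorem Calls.of_cost_le {X Y : Budget n} {k C D : ℕ} {x y : Val} (h : Calls X t k C x y)
    (hle : X.cost C ≤ Y.cost D) : Calls Y t k D x y := by
  obtain ⟨c, hc, hc'⟩ := h
  exact ⟨c, hc, hc'.trans hle⟩

/-- Each level multiplies the time unit by B^(18K + 12000), which becomes the unit τ of the next
level up; hence l + 1 levels cost B to the power (18K + 12000)(l + 1). -/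
theorem calls_solve {B K : ℕ} (hB : n + 2 ≤ B) (G : SimpleGraph (Fin n))
    {KK TT : List (Finset (Fin n))} (hKK : KK.length ≤ B ^ K) (hTT : TT.length ≤ B ^ K)
    (l k : ℕ) (hk : (n + 2) ^ (l + k) ≤ B ^ K) (A F : Finset (Fin n)) :
    Calls (Budget.power hB ((18 * K + 12000) * (l + 1))) t 35 0
      (encTask G KK TT A F (.pair (.num l) (.num k))) (encSet (solve G KK TT l k A F)) := by
  have key : ∀ l, (Budget.power hB ((18 * K + 12000) * l)).cost (18 * K + 12000) ≤
      (Budget.power hB ((18 * K + 12000) * (l + 1))).cost 0 := by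
    intro l
    simp only [Budget.cost, Budget.power, pow_zero, one_mul, ← pow_add]
    apply le_of_eq; ring
  induction l generalizing k A F with
  | zero =>
    refine (Calls.le ?_ (by omega : 30 + 9 * K + 6000 ≤ _)).of_cost_le (key 0)
    have hk' : (n + 2) ^ k ≤ B ^ K := by simpa using hk
    exact calls_solveSplit _ G hKK hTT hk' (fun C F => calls_solveConn_zero _ G C F)
      A F
  | succ l ih =>
    have hk' : (n + 2) ^ k ≤ B ^ K := (Nat.pow_le_pow_right (by omega) (by omega)).trans hk
    refine (Calls.le ?_ (by omega : (9 * K + 6000) + 9 * K + 6000 ≤ _)).of_cost_le (key (l + 1))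
    exact calls_solveSplit _ G hKK hTT hk' (fun C F => calls_solveConn_succ _ G hKK hTT hk'
      -- Depth goes down as excess goes up: (l + 1) + k = l + (k + 1), so one bound B^K serves all
      -- levels.
      (fun A F => ih (k + 1) (by rwa [← add_assoc, add_right_comm]) A F) C F) A F

/-- The list of the cliques with `t` vertices. -/
noncomputable def cliqueList (G : SimpleGraph (Fin n)) (t : ℕ) : List (Finset (Fin n)) :=
  addCliques G t [] (smallSets n t)

/-- The cliques with `t` vertices, followed by a given family. -/
noncomputable def constraintList (G : SimpleGraph (Fin n)) (t : ℕ) (hs : List (Finset (Fin n))) :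
    List (Finset (Fin n)) :=
  addCliques G t hs (smallSets n t)

theorem mem_addCliques {G : SimpleGraph (Fin n)} {init l : List (Finset (Fin n))}
    {S : Finset (Fin n)} :
    S ∈ addCliques G t init l ↔ S ∈ init ∨ (S ∈ l ∧ G.IsNClique t S) := by
  unfold addCliques
  induction l with
  | nil => simp
  | cons K l ih =>
    rw [List.foldr_cons]
    by_cases h : G.IsNClique t K
    · rw [if_pos h, List.mem_cons, ih, List.mem_cons]
      by_cases hS : S = K
      · simp [hS, h]
      · simp [hS]
    · rw [if_neg h, ih, List.mem_cons]
      by_cases hS : S = K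
      · simp [hS, h]
      · simp [hS]

theorem length_addCliques_le (G : SimpleGraph (Fin n)) (init l : List (Finset (Fin n))) :
    (addCliques G t init l).length ≤ init.length + l.length := by
  unfold addCliques
  induction l with
  | nil => simp
  | cons K l ih =>
    rw [List.foldr_cons, List.length_cons]
    split_ifs
    · rw [List.length_cons]; omega
    · omega

theorem mem_smallSets {k : ℕ} {S : Finset (Fin n)} (h : S.card ≤ k) : S ∈ smallSets n k := by
  have key : ∀ (l : List (Finset (Fin n))) (S : Finset (Fin n)),
      S ∈ l.foldr (fun s acc => (List.finRange n).foldr (fun v acc => (s ∪ {v}) :: acc) acc) [∅] ↔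
        S = ∅ ∨ ∃ s ∈ l, ∃ v, s ∪ {v} = S := by
    have inner : ∀ (s : Finset (Fin n)) (vs : List (Fin n)) (acc : List (Finset (Fin n))) S,
        S ∈ vs.foldr (fun v acc => (s ∪ {v}) :: acc) acc ↔ (∃ v ∈ vs, s ∪ {v} = S) ∨ S ∈ acc := by
      intro s vs acc S
      induction vs with
      | nil => simp
      | cons v vs _ => simp [or_assoc, eq_comm]
    intro l S
    induction l with
    | nil => simp
    | cons s l ih => rw [List.foldr_cons, inner, ih]; simp; tauto
  induction k generalizing S with
  | zero => simp [smallSets, Finset.card_eq_zero.1 (Nat.le_zero.1 h)]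
  | succ k ih =>
    rw [smallSets, key]
    rcases S.eq_empty_or_nonempty with rfl | ⟨v, hv⟩
    · exact .inl rfl
    · refine .inr ⟨S.erase v, ih ?_, v, ?_⟩
      · rw [Finset.card_erase_of_mem hv]; omega
      · ext u
        by_cases hu : u = v <;> simp [hu, hv]

theorem mem_cliqueList {G : SimpleGraph (Fin n)} {S : Finset (Fin n)} :
    S ∈ cliqueList G t ↔ G.IsNClique t S := by
  rw [cliqueList, mem_addCliques]
  simp only [List.not_mem_nil, false_or, and_iff_right_iff_imp]
  exact fun h => mem_smallSets h.2.le

theorem mem_constraintList {G : SimpleGraph (Fin n)} {hs : List (Finset (Fin n))}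
    {S : Finset (Fin n)} : S ∈ constraintList G t hs ↔ S ∈ hs ∨ G.IsNClique t S := by
  rw [constraintList, mem_addCliques]
  exact or_congr_right (and_iff_right_of_imp fun h => mem_smallSets h.2.le)

/-- Absence of repetitions and the size bound on the members make the input family polynomially
long, so the running time need not mention its length. -/
theorem length_family_le {hs : List (Finset (Fin n))} (hnd : hs.Nodup)
    (hcard : ∀ Z ∈ hs, Z.card ≤ t) : hs.length ≤ (n + 1) ^ t :=
  ((hnd.subperm fun Z hZ => mem_smallSets (hcard Z hZ)).length_le).trans (length_smallSets_le n t)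

variable {B : ℕ} (hB : n + 2 ≤ B) (G : SimpleGraph (Fin n)) {hs : List (Finset (Fin n))}

theorem length_lists_le (hlen : hs.length ≤ (n + 1) ^ t) (hb : (n + 2) ^ t ≤ B ^ t)
    (hB : n + 2 ≤ B) :
    (cliqueList G t).length ≤ B ^ (t + 1) ∧ (constraintList G t hs).length ≤ B ^ (t + 1) ∧
      (smallSets n t).length ≤ B ^ (t + 1) ∧ (n + 2) ^ t ≤ B ^ (t + 1) := by
  have h1 := length_smallSets_le n t
  have h2 : (n + 1) ^ t ≤ B ^ t := (Nat.pow_le_pow_left (by omega) t).trans hb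
  have h3 : 2 * B ^ t ≤ B ^ (t + 1) := by
    rw [pow_succ, mul_comm]; exact Nat.mul_le_mul_left _ (by omega)
  have h4 := length_addCliques_le (t := t) G [] (smallSets n t)
  have h5 := length_addCliques_le (t := t) G hs (smallSets n t)
  rw [List.length_nil] at h4
  exact ⟨by unfold cliqueList; omega, by unfold constraintList; omega, by omega, by omega⟩

/-- The two ways the main function uses the solver. -/
theorem calls_main_solution (hlen : hs.length ≤ (n + 1) ^ t) (l k : ℕ)
    (hk : (n + 2) ^ (l + k) ≤ B) :
    Calls (Budget.power hB ((18 * (t + 1) + 12000) * (l + 1))) t 0 (6 * t + 2000)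
      (encInput G hs [l, k])
      (encSet (solve G (constraintList G t hs) (cliqueList G t) l k Finset.univ ∅)) := by
  obtain ⟨h1, h2, h3, h4⟩ := length_lists_le G hlen (Nat.pow_le_pow_left hB t) hB
  set X := Budget.power hB ((18 * (t + 1) + 12000) * (l + 1))
  have hk' : (n + 2) ^ (l + k) ≤ B ^ (t + 1) :=
    hk.trans (Nat.le_self_pow (by omega) B)
  refine ((calls_verts X).letCall rfl rfl ((calls_empty X).letCall rfl rfl
    ((calls_univ X).letCall rfl rfl ((calls_smallSets (K := t + 1) X t h4).letCall rfl rfl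
    ((calls_addCliques (K := t + 1) X G [] _ (.num 0) h3).letCall rfl rfl
    ((calls_addCliques (K := t + 1) X G hs _ (.num 0) h3).letCall rfl rfl
    (.ifPair_true (.simple rfl rfl)
      ((calls_solve hB G h2 h1 l k hk' Finset.univ ∅).callSimple rfl rfl)))))))).mono ?_
  simp only [Expr.nodes]; omega

theorem calls_main_decision (hlen : hs.length ≤ (n + 1) ^ t) (l : ℕ) (hk : (n + 2) ^ l ≤ B) :
    Calls (Budget.power hB ((18 * (t + 1) + 12000) * (l + 1))) t 0 (6 * t + 2000)
      (encInput G hs [l])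
      (.pair (.num (solve G (cliqueList G t) (cliqueList G t) l 0 Finset.univ ∅).card)
        (encBool ((solve G (constraintList G t hs) (cliqueList G t) l 0 Finset.univ ∅).card ≤
          (solve G (cliqueList G t) (cliqueList G t) l 0 Finset.univ ∅).card))) := by
  obtain ⟨h1, h2, h3, h4⟩ := length_lists_le G hlen (Nat.pow_le_pow_left hB t) hB
  set X := Budget.power hB ((18 * (t + 1) + 12000) * (l + 1))
  have hk' : (n + 2) ^ (l + 0) ≤ B ^ (t + 1) :=
    hk.trans (Nat.le_self_pow (by omega) B)
  refine ((calls_verts X).letCall rfl rfl ((calls_empty X).letCall rfl rfl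
    ((calls_univ X).letCall rfl rfl ((calls_smallSets (K := t + 1) X t h4).letCall rfl rfl
    ((calls_addCliques (K := t + 1) X G [] _ (.num 0) h3).letCall rfl rfl
    ((calls_addCliques (K := t + 1) X G hs _ (.num 0) h3).letCall rfl rfl
    (.ifPair_false (k := 0) (.simple rfl rfl)
      ((calls_solve hB G h1 h1 l 0 hk' Finset.univ ∅).letCall rfl rfl
      ((calls_solve hB G h2 h1 l 0 hk' Finset.univ ∅).letCall rfl rfl
      ((calls_card X _).letCall rfl rfl ((calls_card X _).letCall rfl rfl
        (.simple rfl ?_)))))))))))).mono ?_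
  · simp only [Expr.den, List.getD_cons_zero, List.getD_cons_succ, Val.toNat, encBool]
    congr 2
    split_ifs <;> omega
  · simp only [Expr.nodes]; omega

/-- The running time, as a power of the number of vertices. -/
theorem cost_le_pow (l m a d : ℕ) (hl : l ≤ m) (hB : n + 2 ≤ (n + 2) ^ (m + 1)) :
    (Budget.power (n := n) hB (d * (l + 1))).cost a ≤
      (max n 2) ^ (4 * (a + d) * (m ^ 2 + 1)) := by
  have h1 : n + 2 ≤ (max n 2) ^ 2 := by
    rcases le_total n 2 with h | h
    · rw [max_eq_right h]; omega
    · rw [max_eq_left h]; nlinarith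
  -- With B = (n + 2)^(m + 1) the exponent is a product of two factors linear in m; this is the
  -- source of the square in the running time.
  have h2 : (m + 1) * (a + d * (l + 1)) ≤ 2 * (a + d) * (m ^ 2 + 1) := by
    have h3 : a + d * (l + 1) ≤ (a + d) * (m + 1) := by nlinarith [Nat.zero_le a, Nat.zero_le d]
    have h4 : (m + 1) * (m + 1) ≤ 2 * (m ^ 2 + 1) := by
      have : 2 * m ≤ m ^ 2 + 1 := by
        rcases Nat.eq_zero_or_pos m with rfl | h
        · simp
        · obtain ⟨j, rfl⟩ := Nat.exists_eq_add_of_lt h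
          nlinarith
      nlinarith
    calc (m + 1) * (a + d * (l + 1)) ≤ (m + 1) * ((a + d) * (m + 1)) := Nat.mul_le_mul_left _ h3
      _ = (a + d) * ((m + 1) * (m + 1)) := by ring
      _ ≤ (a + d) * (2 * (m ^ 2 + 1)) := Nat.mul_le_mul_left _ h4
      _ = _ := by ring
  calc (Budget.power (n := n) hB (d * (l + 1))).cost a
      = (n + 2) ^ ((m + 1) * (a + d * (l + 1))) := by
        simp only [Budget.cost, Budget.power]
        rw [← pow_add, ← pow_mul]
    _ ≤ ((max n 2) ^ 2) ^ ((m + 1) * (a + d * (l + 1))) := Nat.pow_le_pow_left h1 _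
    _ ≤ ((max n 2) ^ 2) ^ (2 * (a + d) * (m ^ 2 + 1)) :=
        Nat.pow_le_pow_right (by positivity) h2
    _ = _ := by rw [← pow_mul]; congr 1; ring

end MainSpec

/-! ### Path-closed sets -/

section PathClosed

variable {V : Type*}

namespace Linked

variable {r : V → V → Prop} {Y Z : Finset V} {a b c : V}

theorem mem_left (h : Linked r Y a b) : a ∈ Y := by
  induction h with
  | single h => exact h.1
  | tail _ _ ih => exact ih

theorem mem_right (h : Linked r Y a b) : b ∈ Y := by
  cases h with
  | single h => exact h.2.1
  | tail _ h => exact h.2.1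

theorem refl (h : a ∈ Y) : Linked r Y a a := .single ⟨h, h, .inl rfl⟩

theorem step (ha : a ∈ Y) (hb : b ∈ Y) (h : r a b) : Linked r Y a b := .single ⟨ha, hb, .inr h⟩

theorem trans (h : Linked r Y a b) (h' : Linked r Y b c) : Linked r Y a c :=
  Relation.TransGen.trans h h'

theorem mono (h : Linked r Y a b) (hYZ : Y ⊆ Z) : Linked r Z a b :=
  Relation.TransGen.mono (fun _ _ h => ⟨hYZ h.1, hYZ h.2.1, h.2.2⟩) _ _ h

theorem symm {G : SimpleGraph V} (h : Linked G.Adj Y a b) : Linked G.Adj Y b a := by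
  induction h with
  | single h => exact .single ⟨h.2.1, h.1, h.2.2.imp Eq.symm fun h => h.symm⟩
  | tail _ h ih => exact .head ⟨h.2.1, h.1, h.2.2.imp Eq.symm fun h => h.symm⟩ ih

theorem closed {p : V → Prop} (h : Linked r Y a b) (ha : p a)
    (hp : ∀ x y, p x → x ∈ Y → y ∈ Y → r x y → p y) : p b := by
  induction h with
  | single h => exact h.2.2.elim (fun e => e ▸ ha) (hp _ _ ha h.1 h.2.1)
  | tail _ h ih => exact h.2.2.elim (fun e => e ▸ ih) (hp _ _ ih h.1 h.2.1)

/-- The first vertex of `T` on a path starting outside `T`. -/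
theorem first_hit [DecidableEq V] {T : Finset V} (h : Linked r Y a b) (ha : a ∉ T) (hb : b ∈ T) :
    ∃ y m, Linked r (Y \ T) a y ∧ r y m ∧ m ∈ T ∧ m ∈ Y := by
  by_contra hcon
  have : Linked r (Y \ T) a b := by
    refine h.closed (p := fun z => Linked r (Y \ T) a z)
      (refl (Finset.mem_sdiff.2 ⟨h.mem_left, ha⟩)) ?_
    intro x y hx _ hy hxy
    by_cases hyT : y ∈ T
    · exact absurd ⟨x, y, hx, hxy, hyT, hy⟩ hcon
    · exact hx.trans (step hx.mem_right (Finset.mem_sdiff.2 ⟨hy, hyT⟩) hxy)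
  exact (Finset.mem_sdiff.1 this.mem_right).2 hb

end Linked

variable [DecidableEq V] (G : SimpleGraph V)

/-- `G[C]` is connected (or empty). -/
def ConnectedOn (C : Finset V) : Prop := ∀ a ∈ C, ∀ b ∈ C, Linked G.Adj C a b

/-- Every component of `G[C \ T]` has at most one neighbour in `T`. -/
def PathClosed (C T : Finset V) : Prop :=
  T ⊆ C ∧ ∀ w₁ ∈ T, ∀ w₂ ∈ T, ∀ u₁ u₂, Linked G.Adj (C \ T) u₁ u₂ → G.Adj w₁ u₁ → G.Adj w₂ u₂ →
    w₁ = w₂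

variable {G} {C T T₁ T₂ : Finset V}

/-- A walk between vertices of T that leaves T at w can only come back at w, so its excursions can
be cut out. -/
theorem PathClosed.connectedOn (h : PathClosed G C T) (hC : ConnectedOn G C) :
    ConnectedOn G T := by
  intro a ha b hb
  have key : (b ∈ T ∧ Linked G.Adj T a b) ∨
      (b ∉ T ∧ ∃ w u, Linked G.Adj T a w ∧ G.Adj w u ∧ Linked G.Adj (C \ T) u b) := by
    refine (hC a (h.1 ha) b (h.1 hb)).closed (p := fun b => (b ∈ T ∧ Linked G.Adj T a b) ∨
      (b ∉ T ∧ ∃ w u, Linked G.Adj T a w ∧ G.Adj w u ∧ Linked G.Adj (C \ T) u b))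
      (.inl ⟨ha, .refl ha⟩) ?_
    rintro x y (⟨hx, hax⟩ | ⟨hx, w, u, haw, hwu, hux⟩) hxC hyC hxy
    · by_cases hy : y ∈ T
      · exact .inl ⟨hy, hax.trans (.step hx hy hxy)⟩
      · exact .inr ⟨hy, x, y, hax, hxy, .refl (Finset.mem_sdiff.2 ⟨hyC, hy⟩)⟩
    · by_cases hy : y ∈ T
      · have := h.2 w haw.mem_right y hy u x hux hwu hxy.symm
        exact .inl ⟨hy, this ▸ haw⟩
      · exact .inr ⟨hy, w, u, haw, hwu, hux.trans
          (.step hux.mem_right (Finset.mem_sdiff.2 ⟨hyC, hy⟩) hxy)⟩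
  exact key.elim And.right fun h => absurd hb h.1

/-- Walk inside T₁ from a to the common vertex m. Its first vertex in T₂ attaches to the same
component of C \ T₂ as w does, hence equals w. -/
theorem PathClosed.mem_of_linked (h₁ : PathClosed G C T₁) (h₂ : PathClosed G C T₂)
    (hC : ConnectedOn G C) {m a u w : V} (hm₁ : m ∈ T₁) (hm₂ : m ∈ T₂) (ha : a ∈ T₁)
    (ha' : a ∉ T₂) (hau : Linked G.Adj (C \ T₂) a u) (huw : G.Adj u w) (hw : w ∈ T₂) :
    w ∈ T₁ := by
  obtain ⟨y, m', hay, hym, hm', hm''⟩ :=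
    (h₁.connectedOn hC a ha m hm₁).first_hit ha' hm₂
  have hay' := hay.mono (Finset.sdiff_subset_sdiff h₁.1 le_rfl)
  have := h₂.2 w hw m' hm' u y (hau.symm.trans hay') huw.symm hym.symm
  exact this ▸ hm''

/-- The only case not inherited from T₁ or T₂ is an attachment in T₁ \ T₂ and one in T₂ \ T₁. Seen
from T₂, the first lies in the outside component itself, and `PathClosed.mem_of_linked` puts the
second into T₁. The common vertex m is indispensable. -/
theorem PathClosed.union (h₁ : PathClosed G C T₁) (h₂ : PathClosed G C T₂)
    (hC : ConnectedOn G C) {m : V} (hm₁ : m ∈ T₁) (hm₂ : m ∈ T₂) :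
    PathClosed G C (T₁ ∪ T₂) := by
  refine ⟨Finset.union_subset h₁.1 h₂.1, ?_⟩
  intro w₁ hw₁ w₂ hw₂ u₁ u₂ hu a₁ a₂
  have hu₁ := hu.mono (Finset.sdiff_subset_sdiff le_rfl (Finset.subset_union_left (s₂ := T₂)))
  have hu₂ := hu.mono (Finset.sdiff_subset_sdiff le_rfl (Finset.subset_union_right (s₁ := T₁)))
  have both₁ := fun h h' => h₁.2 w₁ h w₂ h' u₁ u₂ hu₁ a₁ a₂
  have both₂ := fun h h' => h₂.2 w₁ h w₂ h' u₁ u₂ hu₂ a₁ a₂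
  rcases Finset.mem_union.1 hw₁ with k₁ | k₁ <;> rcases Finset.mem_union.1 hw₂ with k₂ | k₂
  · exact both₁ k₁ k₂
  · by_cases hk : w₁ ∈ T₂
    · exact both₂ hk k₂
    · refine both₁ k₁ (h₁.mem_of_linked h₂ hC hm₁ hm₂ k₁ hk ?_ a₂.symm k₂)
      exact (Linked.step (Finset.mem_sdiff.2 ⟨h₁.1 k₁, hk⟩) hu₂.mem_left a₁).trans hu₂
  · by_cases hk : w₂ ∈ T₂
    · exact both₂ k₁ hk
    · refine both₁ (h₁.mem_of_linked h₂ hC hm₁ hm₂ k₂ hk ?_ a₁.symm k₁) k₂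
      exact (Linked.step (Finset.mem_sdiff.2 ⟨h₁.1 k₂, hk⟩) hu₂.mem_right a₂).trans hu₂.symm
  · exact both₂ k₁ k₂

/-- An edge between T₁ \ T₂ and T₂ \ T₁ would contradict `PathClosed.mem_of_linked`, applied to a
path of length zero. Thus uniting clique-free sets creates no forbidden clique. -/
theorem PathClosed.clique_subset_union (h₁ : PathClosed G C T₁) (h₂ : PathClosed G C T₂)
    (hC : ConnectedOn G C) {m : V} (hm₁ : m ∈ T₁) (hm₂ : m ∈ T₂) {K : Finset V}
    (hK : G.IsClique (K : Set V)) (hsub : K ⊆ T₁ ∪ T₂) : K ⊆ T₁ ∨ K ⊆ T₂ := by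
  by_contra hcon
  obtain ⟨h, h'⟩ := not_or.1 hcon
  obtain ⟨b, hb, hb₁⟩ := Finset.not_subset.1 h
  obtain ⟨a, ha, ha₂⟩ := Finset.not_subset.1 h'
  have hb₂ := (Finset.mem_union.1 (hsub hb)).resolve_left hb₁
  have ha₁ := (Finset.mem_union.1 (hsub ha)).resolve_right ha₂
  have hab : G.Adj a b := hK ha hb fun e => ha₂ (e ▸ hb₂)
  exact hb₁ (h₁.mem_of_linked h₂ hC hm₁ hm₂ ha₁ ha₂
    (.refl (Finset.mem_sdiff.2 ⟨h₁.1 ha₁, ha₂⟩)) hab hb₂)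

/-! ### Blocks of a graph and the largest clique-free path-closed set. -/

section Blocks

variable [Fintype V]

/-- The block of `G[C]` containing the edge `ax`. -/
noncomputable def edgeBlock (G : SimpleGraph V) (C : Finset V) (a x : V) : Finset V :=
  Finset.univ \ blockCompl G C a x

theorem mem_edgeBlock {a x z : V} : z ∈ edgeBlock G C a x ↔
    ∀ u, u ≠ z → Linked G.Adj (C \ {u}) x z ∨ Linked G.Adj (C \ {u}) a z := by
  simp only [edgeBlock, blockCompl, Separated, Finset.mem_sdiff, Finset.mem_univ,
    Finset.mem_filter, true_and]
  push Not
  exact forall_congr' fun u => forall_congr' fun _ => or_iff_not_imp_left.symm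

theorem edgeBlock_left {a x : V} (ha : a ∈ C) : a ∈ edgeBlock G C a x :=
  mem_edgeBlock.2 fun u hu => .inr (.refl (Finset.mem_sdiff.2 ⟨ha, by simpa using hu.symm⟩))

theorem edgeBlock_right {a x : V} (hx : x ∈ C) : x ∈ edgeBlock G C a x :=
  mem_edgeBlock.2 fun u hu => .inl (.refl (Finset.mem_sdiff.2 ⟨hx, by simpa using hu.symm⟩))

/-- Membership quantifies over u ≠ z; distinctness of a and x supplies such a u, so the condition is
not vacuous. -/
theorem edgeBlock_subset {a x : V} (hax : a ≠ x) : edgeBlock G C a x ⊆ C := by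
  intro z hz
  rw [mem_edgeBlock] at hz
  have : ∃ u, u ≠ z := by
    by_cases h : a = z
    · exact ⟨x, fun e => hax (h.trans e.symm)⟩
    · exact ⟨a, h⟩
  obtain ⟨u, hu⟩ := this
  rcases hz u hu with h | h <;> exact (Finset.mem_sdiff.1 h.mem_right).1

/-- If an outside component had two attachments w₁ ≠ w₂, its vertex u₁ next to w₁ would be in the
block: after deletion of w₁ it is reached through w₂ and the component, after deletion of any other
vertex directly from w₁. -/
theorem pathClosed_edgeBlock {a x : V} (hax : a ≠ x) : PathClosed G C (edgeBlock G C a x) := by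
  refine ⟨edgeBlock_subset hax, fun w₁ hw₁ w₂ hw₂ u₁ u₂ hu a₁ a₂ => ?_⟩
  by_contra hne
  have hu₁ := Finset.mem_sdiff.1 hu.mem_left
  have hw₁C := edgeBlock_subset hax hw₁
  have hw₂C := edgeBlock_subset hax hw₂
  apply hu₁.2
  rw [mem_edgeBlock]
  intro u hu'
  by_cases h : u = w₁
  · subst h
    have hlink : Linked G.Adj (C \ {u}) w₂ u₁ := by
      have hsub : C \ edgeBlock G C a x ⊆ C \ {u} :=
        Finset.sdiff_subset_sdiff le_rfl (Finset.singleton_subset_iff.2 hw₁)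
      exact (Linked.step (Finset.mem_sdiff.2 ⟨hw₂C, by simpa using Ne.symm hne⟩)
        (hu.mono hsub).mem_right a₂).trans (hu.mono hsub).symm
    exact (mem_edgeBlock.1 hw₂ u hne).imp (·.trans hlink) (·.trans hlink)
  · have hlink : Linked G.Adj (C \ {u}) w₁ u₁ :=
      .step (Finset.mem_sdiff.2 ⟨hw₁C, by simpa using Ne.symm h⟩)
        (Finset.mem_sdiff.2 ⟨hu₁.1, by simpa using Ne.symm hu'⟩) a₁
    exact (mem_edgeBlock.1 hw₁ u h).imp (·.trans hlink) (·.trans hlink)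

/-- For z outside T, the unique attachment w of its component separates z from all other vertices of
T, in particular from the ends a and x. -/
theorem PathClosed.edgeBlock_subset (h : PathClosed G C T) (hC : ConnectedOn G C) {a x : V}
    (ha : a ∈ T) (hx : x ∈ T) (hax : a ≠ x) : edgeBlock G C a x ⊆ T := by
  intro z hz
  by_contra hzT
  have hzC := _root_.edgeBlock_subset hax hz
  obtain ⟨y, w, hzy, hyw, hw, -⟩ := (hC z hzC a (h.1 ha)).first_hit hzT ha
  have key : ∀ b ∈ T, ¬ Linked G.Adj (C \ {w}) b z := by
    intro b hb hbz
    have : Linked G.Adj (C \ T) z b := by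
      refine hbz.symm.closed (p := fun b => Linked G.Adj (C \ T) z b)
        (.refl (Finset.mem_sdiff.2 ⟨hzC, hzT⟩)) ?_
      intro p q hp _ hq hpq
      by_cases hqT : q ∈ T
      · have := h.2 q hqT w hw p y (hp.symm.trans hzy) hpq.symm hyw.symm
        exact absurd this (by simpa using (Finset.mem_sdiff.1 hq).2)
      · exact hp.trans (.step hp.mem_right
          (Finset.mem_sdiff.2 ⟨(Finset.mem_sdiff.1 hq).1, hqT⟩) hpq)
    exact (Finset.mem_sdiff.1 this.mem_right).2 hb
  rcases mem_edgeBlock.1 hz w (fun e => hzT (e ▸ hw)) with h' | h'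
  · exact key x hx h'
  · exact key a ha h'

/-- The hull of `v` is the largest path-closed set that contains `v` but no member of `TT`. -/
theorem freeHull_spec {TT : List (Finset V)} (hTT : ∀ K ∈ TT, G.IsClique (K : Set V))
    (hC : ConnectedOn G C) (hT : PathClosed G C T) (hfree : ∀ K ∈ TT, ¬ K ⊆ T) {v : V}
    (hv : v ∈ T) :
    T ⊆ freeHull G TT C v ∧ PathClosed G C (freeHull G TT C v) ∧
      ∀ K ∈ TT, ¬ K ⊆ freeHull G TT C v := by
  classical
  let p : Finset V → Prop := fun S => PathClosed G C S ∧ (∀ K ∈ TT, ¬ K ⊆ S) ∧ v ∈ S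
  obtain ⟨M, hM, hmax⟩ := Finset.exists_max_image (Finset.univ.filter p) Finset.card
    ⟨T, by simp [p, hT, hv]; exact hfree⟩
  have hM : p M := (Finset.mem_filter.1 hM).2
  -- A largest admissible M absorbs every clique-free path-closed set that meets it.
  have hmax' : ∀ S m, PathClosed G C S → (∀ K ∈ TT, ¬ K ⊆ S) → m ∈ M → m ∈ S → S ⊆ M := by
    intro S m hS hSf hmM hmS
    have hp : p (M ∪ S) := by
      refine ⟨hM.1.union hS hC hmM hmS, fun K hK hsub => ?_, Finset.mem_union_left _ hM.2.2⟩
      exact (hM.1.clique_subset_union hS hC hmM hmS (hTT K hK) hsub).elim (hM.2.1 K hK) (hSf K hK)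
    have hle := hmax _ (Finset.mem_filter.2 ⟨Finset.mem_univ _, hp⟩)
    have := Finset.eq_of_subset_of_card_le Finset.subset_union_left hle
    rw [this]; exact Finset.subset_union_right
  have hgood : ∀ a x, GoodEdge G TT C a x ↔
      G.Adj a x ∧ ∀ K ∈ TT, ¬ K ⊆ edgeBlock G C a x := by
    intro a x
    simp only [GoodEdge, edgeBlock, not_exists, not_and, Finset.subset_sdiff, Finset.subset_univ,
      true_and]
  have heq : freeHull G TT C v = M := by
    apply Finset.Subset.antisymm
    · intro z hz
      -- The block of a good edge leaving M is path-closed, clique-free and meets M, so its other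
      -- end is in M.
      refine ((Finset.mem_filter.1 hz).2).closed (p := fun z => z ∈ M) hM.2.2 ?_
      intro a x ha haC hxC hax
      obtain ⟨hadj, hf⟩ := (hgood a x).1 hax
      exact hmax' _ a (pathClosed_edgeBlock hadj.ne) hf ha (edgeBlock_left haC)
        (edgeBlock_right hxC)
    · intro z hz
      refine Finset.mem_filter.2 ⟨hM.1.1 hz, ?_⟩
      -- Conversely M is connected, and the block of each of its edges lies in M, so all these edges
      -- are good.
      refine Relation.TransGen.mono ?_ _ _ (hM.1.connectedOn hC v hM.2.2 z hz)
      rintro a x ⟨ha, hx, h⟩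
      refine ⟨hM.1.1 ha, hM.1.1 hx, h.imp_right fun hadj => (hgood a x).2 ⟨hadj, ?_⟩⟩
      exact fun K hK hsub => hM.2.1 K hK
        (hsub.trans (hM.1.edgeBlock_subset hC ha hx hadj.ne))
  rw [heq]
  exact ⟨hmax' T v hT hfree hM.2.2 hv, hM.1, hM.2.1⟩

end Blocks

end PathClosed

/-! ### Bounded depth -/

section Depth

variable {V : Type*} {G : SimpleGraph V}

theorem linked_iff_reachable {A : Finset V} {u v : V} (hu : u ∈ A) (hv : v ∈ A) :
    Linked G.Adj A u v ↔ (G.induce (A : Set V)).Reachable ⟨u, hu⟩ ⟨v, hv⟩ := by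
  constructor
  · intro h
    obtain ⟨_, h'⟩ := h.closed (p := fun b => ∃ hb : b ∈ A,
        (G.induce (A : Set V)).Reachable ⟨u, hu⟩ ⟨b, hb⟩) ⟨hu, .refl _⟩ (by
      rintro x y ⟨hx, hr⟩ _ hy hxy
      have hadj : (G.induce (A : Set V)).Adj ⟨x, hx⟩ ⟨y, hy⟩ := hxy
      exact ⟨hy, hr.trans hadj.reachable⟩)
    exact h'
  · rintro ⟨p⟩
    have key : ∀ {a b : (A : Set V)}, (G.induce (A : Set V)).Walk a b →
        Linked G.Adj A (a : V) (b : V) := by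
      intro a b p
      induction p with
      | nil => exact .refl (Finset.mem_coe.1 (Subtype.coe_prop _))
      | cons h _ ih =>
        exact (Linked.step (Finset.mem_coe.1 (Subtype.coe_prop _))
          (Finset.mem_coe.1 (Subtype.coe_prop _)) h).trans ih
    exact key p

theorem connectedOn_iff {A : Finset V} :
    ConnectedOn G A ↔ (G.induce (A : Set V)).Preconnected :=
  ⟨fun h a b => (linked_iff_reachable a.2 b.2).1 (h a a.2 b b.2),
    fun h a ha b hb => (linked_iff_reachable ha hb).2 (h ⟨a, ha⟩ ⟨b, hb⟩)⟩

theorem subset_componentIn {A C : Finset V} (hC : ConnectedOn G C) (hCA : C ⊆ A) {v : A}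
    (hv : (v : V) ∈ C) : C ⊆ componentIn G A v := by
  intro u hu
  classical
  simp only [componentIn, Finset.mem_filter]
  exact ⟨hCA hu, hCA hu, (linked_iff_reachable (hCA hu) v.2).1 ((hC u hu v hv).mono hCA)⟩

theorem cliqueFree_induce_iff {t : ℕ} {S : Set V} :
    (G.induce S).CliqueFree t ↔ ∀ K : Finset V, G.IsNClique t K → ¬ (K : Set V) ⊆ S := by
  classical
  constructor
  · intro h K hK hsub
    refine h (K.subtype (· ∈ S)) ?_
    rw [SimpleGraph.isNClique_induce_iff]
    convert hK
    exact (Finset.subtype_map _).trans (Finset.filter_true_of_mem fun x hx => hsub hx)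
  · intro h K hK
    refine h _ ((SimpleGraph.isNClique_induce_iff _ _ _).1 hK) ?_
    simp

variable [DecidableEq V]

/-- The depth of the elimination process on `G[A]`, with respect to the forbidden sets `TT`, is at
most `k`. -/
def DepthLE (G : SimpleGraph V) (TT : List (Finset V)) : ℕ → Finset V → Prop
  | 0, A => ∀ K ∈ TT, ¬ K ⊆ A
  | k + 1, A => ∀ C ⊆ A, C.Nonempty → ConnectedOn G C → (∀ v ∈ C, ∃ K ∈ TT, K ⊆ C ∧ v ∈ K) →
      ∃ T, T.Nonempty ∧ PathClosed G C T ∧ (∀ K ∈ TT, ¬ K ⊆ T) ∧ DepthLE G TT k (C \ T)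

/-- At positive depth the definition ranges over all connected active subsets of A instead of
following one run of the recursion on A. Monotonicity is then free, and no independence of choices
in `bedPlusOn` has to be shown. -/
theorem DepthLE.mono {TT : List (Finset V)} {k : ℕ} {A B : Finset V} (h : DepthLE G TT k A)
    (hBA : B ⊆ A) : DepthLE G TT k B := by
  cases k with
  | zero => exact fun K hK hsub => h K hK (hsub.trans hBA)
  | succ k => exact fun C hC => h C (hC.trans hBA)

theorem DepthLE.succ {TT : List (Finset V)} {k : ℕ} {A : Finset V} (h : DepthLE G TT k A) :
    DepthLE G TT (k + 1) A := by
  induction k generalizing A with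
  | zero =>
    rintro C hC ⟨v, hv⟩ - hact
    obtain ⟨K, hK, hKC, -⟩ := hact v hv
    exact absurd (hKC.trans hC) (h K hK)
  | succ k ih =>
    intro C hC hne hconn hact
    obtain ⟨T, h1, h2, h3, h4⟩ := h C hC hne hconn hact
    exact ⟨T, h1, h2, h3, ih h4⟩

variable {t : ℕ} {A T : Finset V} {TT : List (Finset V)}

theorem IsRoot.pathClosed (h : IsRoot t G A T) : PathClosed G A T := by
  refine ⟨h.2.1, fun w₁ hw₁ w₂ hw₂ u₁ u₂ hu a₁ a₂ => ?_⟩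
  have hr := (linked_iff_reachable hu.mem_left hu.mem_right).1 hu
  set c := (G.induce ((A \ T : Finset V) : Set V)).connectedComponentMk ⟨u₁, hu.mem_left⟩
  refine (h.2.2.2.2 c).unique ⟨hw₁, ⟨u₁, hu.mem_left⟩, ?_, a₁.symm⟩
    ⟨hw₂, ⟨u₂, hu.mem_right⟩, ?_, a₂.symm⟩
  · exact rfl
  · exact SimpleGraph.ConnectedComponent.sound hr.symm

/-- Needed so that the minimum over roots in `bedPlusOn` is never taken over the empty set. -/
theorem isRoot_singleton (ht : 2 ≤ t) (hA : ConnectedOn G A) {v : V} (hv : v ∈ A) :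
    IsRoot t G A {v} := by
  refine ⟨Finset.singleton_nonempty v, Finset.singleton_subset_iff.2 hv, ?_, ?_, ?_⟩
  · have : Nonempty (({v} : Finset V) : Set V) := ⟨⟨v, by simp⟩⟩
    refine ⟨connectedOn_iff.1 fun a ha b hb => ?_⟩
    rw [Finset.mem_singleton.1 ha, Finset.mem_singleton.1 hb]
    exact .refl (by simp)
  · rw [cliqueFree_induce_iff]
    intro K hK hsub
    have := Finset.card_le_card (Finset.coe_subset.1 hsub)
    rw [hK.2, Finset.card_singleton] at this
    omega
  · intro c
    obtain ⟨⟨u, hu⟩, rfl⟩ := c.exists_rep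
    have hu' := Finset.mem_sdiff.1 (Finset.mem_coe.1 hu)
    obtain ⟨y, m, hy, hym, hm, -⟩ := (hA u hu'.1 v hv).first_hit hu'.2 (Finset.mem_singleton_self v)
    refine ⟨v, ⟨Finset.mem_singleton_self v, ⟨y, hy.mem_right⟩, ?_, ?_⟩, fun w hw => ?_⟩
    · exact SimpleGraph.ConnectedComponent.sound
        ((linked_iff_reachable hy.mem_left hy.mem_right).1 hy).symm
    · obtain rfl := Finset.mem_singleton.1 hm
      exact hym
    · exact Finset.mem_singleton.1 hw.1

theorem clique_connectedOn {K : Finset V} (hK : G.IsClique (K : Set V)) : ConnectedOn G K := by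
  intro a ha b hb
  by_cases h : a = b
  · exact h ▸ .refl ha
  · exact .step ha hb (hK ha hb h)

/-- The recursion for `bed⁺` bounds the depth. -/
theorem depthLE_of_bedPlusOn (ht : 2 ≤ t) (hTT : ∀ K, K ∈ TT ↔ G.IsNClique t K) (A : Finset V)
    (k : ℕ) (h : bedPlusOn t G A ≤ k) : DepthLE G TT k A := by
  have hne : ∀ K ∈ TT, K.Nonempty := by
    intro K hK
    rw [← Finset.card_pos, ((hTT K).1 hK).2]; omega
  induction A using Finset.strongInduction generalizing k with
  | H A ih =>
    rw [bedPlusOn] at h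
    split_ifs at h with h1 h2 h3
    · subst h1
      have : DepthLE G TT 0 ∅ := fun K hK hsub =>
        (hne K hK).ne_empty (Finset.subset_empty.1 hsub)
      clear h ih
      induction k with
      | zero => exact this
      | succ k ih => exact ih.succ
    · have hv := h2.choose_spec
      set v := h2.choose
      have := ih _ (Finset.erase_ssubset hv.1) k h
      have hK : ∀ K ∈ TT, K ⊆ A → v ∉ K := fun K hK hsub hvK =>
        hv.2 ⟨K, hsub, hvK, (hTT K).1 hK⟩
      cases k with
      | zero =>
        exact fun K hKT hsub => this K hKT (Finset.subset_erase.2 ⟨hsub, hK K hKT hsub⟩)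
      | succ k =>
        intro C hC hCne hconn hact
        -- A vertex in no t-clique of G[A] is in no active subset C, so deleting it loses nothing.
        refine this C (Finset.subset_erase.2 ⟨hC, fun hvC => ?_⟩) hCne hconn hact
        obtain ⟨K, hKT, hKC, hvK⟩ := hact v hvC
        exact hK K hKT (hKC.trans hC) hvK
    rotate_left
    · have hcomp : ∀ v : A, DepthLE G TT k (componentIn G A v) := fun v =>
        ih _ (componentIn_ssubset G A h3 v) k
          ((Finset.le_sup (f := fun v => bedPlusOn t G (componentIn G A v))
            (Finset.mem_attach A v)).trans h)
      cases k with
      | zero =>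
        intro K hKT hsub
        obtain ⟨v, hv⟩ := hne K hKT
        exact hcomp ⟨v, hsub hv⟩ K hKT
          (subset_componentIn (clique_connectedOn ((hTT K).1 hKT).1) hsub hv)
      | succ k =>
        intro C hC hCne hconn hact
        obtain ⟨v, hv⟩ := hCne
        exact hcomp ⟨v, hC hv⟩ C (subset_componentIn hconn hC hv) ⟨v, hv⟩ hconn hact
    · have hA : ConnectedOn G A := connectedOn_iff.2 h3
      obtain ⟨v, hv⟩ := Finset.nonempty_iff_ne_empty.2 h1
      -- The infimum is attained by an actual root and is not the default value of `sInf` on the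
      -- empty set.
      have hmem := Nat.sInf_mem (s := {k | ∃ T, ∃ _h : IsRoot t G A T, k = bedPlusOn t G (A \ T)})
        ⟨_, _, isRoot_singleton ht hA hv, rfl⟩
      obtain ⟨T, hT, hbed⟩ := hmem
      rw [hbed] at h
      obtain ⟨k, rfl⟩ : ∃ j, k = j + 1 := ⟨k - 1, by omega⟩
      have hd := ih _ (Finset.sdiff_ssubset hT.2.1 hT.1) k (by omega)
      intro C hC hCne hconn hact
      have hsub : C \ T ⊆ A \ T := Finset.sdiff_subset_sdiff hC le_rfl
      rcases (C ∩ T).eq_empty_or_nonempty with he | he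
      · have hCT : C ⊆ A \ T := by
          rw [← Finset.disjoint_iff_inter_eq_empty] at he
          exact Finset.subset_sdiff.2 ⟨hC, he⟩
        exact hd.succ C hCT hCne hconn hact
      -- The trace of T on C is a witness: being path-closed, unlike being connected, passes to
      -- subsets directly.
      · have heq : C \ (C ∩ T) = C \ T := Finset.sdiff_inter_self_left C T
        refine ⟨C ∩ T, he, ⟨Finset.inter_subset_left, ?_⟩, ?_, ?_⟩
        · intro w₁ hw₁ w₂ hw₂ u₁ u₂ hu a₁ a₂
          rw [heq] at hu
          exact hT.pathClosed.2 w₁ (Finset.mem_inter.1 hw₁).2 w₂ (Finset.mem_inter.1 hw₂).2 u₁ u₂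
            (hu.mono hsub) a₁ a₂
        · intro K hK hKT
          exact cliqueFree_induce_iff.1 hT.2.2.2.1 K ((hTT K).1 hK)
            (Finset.coe_subset.2 (hKT.trans Finset.inter_subset_right))
        · rw [heq]; exact hd.mono hsub

end Depth

/-! ### Correctness of the algorithm -/

theorem mem_linkedSet {V : Type*} {r : V → V → Prop} {Y : Finset V} {v u : V} :
    u ∈ linkedSet r Y v ↔ Linked r Y v u := by
  classical
  rw [linkedSet, Finset.mem_filter]
  exact and_iff_right_of_imp Linked.mem_right

/-! ### The parts hanging off the vertices of a root. -/

section Pendant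

variable {V : Type*} [DecidableEq V] {G : SimpleGraph V} {C T : Finset V} {w : V}

theorem mem_pendant (hw : w ∈ T) {u : V} :
    u ∈ pendant G C T w ↔ ∃ y, G.Adj w y ∧ Linked G.Adj (C \ T) y u := by
  rw [pendant, Finset.mem_sdiff, mem_linkedSet]
  have hwC : w ∈ (C \ T) ∪ {w} := Finset.mem_union_right _ (Finset.mem_singleton_self w)
  constructor
  · rintro ⟨h, hu⟩
    have := h.closed (p := fun b => b = w ∨ ∃ y, G.Adj w y ∧ Linked G.Adj (C \ T) y b)
      (.inl rfl) (by
        intro x y hx _ hy hxy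
        rcases Finset.mem_union.1 hy with hy' | hy'
        · rcases hx with rfl | ⟨z, hz, hzx⟩
          · exact .inr ⟨y, hxy, .refl hy'⟩
          · exact .inr ⟨z, hz, hzx.trans (.step hzx.mem_right hy' hxy)⟩
        · exact .inl (Finset.mem_singleton.1 hy'))
    exact this.resolve_left fun e => hu (e ▸ hw)
  · rintro ⟨y, hy, hyu⟩
    exact ⟨(Linked.step hwC (Finset.mem_union_left _ hyu.mem_left) hy).trans
      (hyu.mono Finset.subset_union_left), (Finset.mem_sdiff.1 hyu.mem_right).2⟩

theorem pendant_subset (hw : w ∈ T) : pendant G C T w ⊆ C \ T := by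
  intro u hu
  obtain ⟨_, -, h⟩ := (mem_pendant hw).1 hu
  exact h.mem_right

theorem pendant_adj (hw : w ∈ T) {u z : V} (hu : u ∈ pendant G C T w) (hz : z ∈ C \ T)
    (h : G.Adj u z) : z ∈ pendant G C T w := by
  obtain ⟨y, hy, hyu⟩ := (mem_pendant hw).1 hu
  exact (mem_pendant hw).2 ⟨y, hy, hyu.trans (.step hyu.mem_right hz h)⟩

theorem PathClosed.pendant_attach (hT : PathClosed G C T) (hw : w ∈ T) {u w' : V}
    (hu : u ∈ pendant G C T w) (hw' : w' ∈ T) (h : G.Adj u w') : w' = w := by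
  obtain ⟨y, hy, hyu⟩ := (mem_pendant hw).1 hu
  exact (hT.2 w hw w' hw' y u hyu hy h.symm).symm

theorem exists_mem_pendant (hC : ConnectedOn G C) (hTC : T ⊆ C) {v u : V} (hv : v ∈ T)
    (hu : u ∈ C) (huT : u ∉ T) : ∃ w ∈ T, u ∈ pendant G C T w := by
  obtain ⟨y, m, huy, hym, hm, -⟩ := (hC u hu v (hTC hv)).first_hit huT hv
  exact ⟨m, hm, (mem_pendant hm).2 ⟨y, hym.symm, huy.symm⟩⟩

theorem PathClosed.pendant_unique (hT : PathClosed G C T) (hw : w ∈ T) {u w' : V} (hw' : w' ∈ T)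
    (hu : u ∈ pendant G C T w) (hu' : u ∈ pendant G C T w') : w = w' := by
  obtain ⟨y, hy, hyu⟩ := (mem_pendant hw).1 hu
  obtain ⟨y', hy', hyu'⟩ := (mem_pendant hw').1 hu'
  exact hT.2 w hw w' hw' y y' (hyu.trans hyu'.symm) hy hy'

/-- Within C, the neighbours of P(w) lie in P(w) ∪ {w}; a clique touching P(w) therefore stays
there. -/
theorem PathClosed.clique_subset (hT : PathClosed G C T) (hw : w ∈ T) {Q : Finset V}
    (hQ : G.IsClique (Q : Set V)) {u z : V} (hu : u ∈ Q) (hup : u ∈ pendant G C T w) (hz : z ∈ Q)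
    (hzC : z ∈ C) : z ∈ pendant G C T w ∪ {w} := by
  rw [Finset.mem_union, Finset.mem_singleton]
  by_cases h : u = z
  · exact .inl (h ▸ hup)
  · have hadj := hQ hu hz h
    by_cases hzT : z ∈ T
    · exact .inr (hT.pendant_attach hw hup hzT hadj)
    · exact .inl (pendant_adj hw hup (Finset.mem_sdiff.2 ⟨hzC, hzT⟩) hadj)

theorem PathClosed.pairwise_disjoint (hT : PathClosed G C T) :
    (T : Set V).PairwiseDisjoint fun w => pendant G C T w ∪ {w} := by
  intro w hw w' hw' hne
  rw [Function.onFun, Finset.disjoint_left]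
  intro u hu hu'
  rw [Finset.mem_union, Finset.mem_singleton] at hu hu'
  rcases hu with hu | rfl <;> rcases hu' with hu' | rfl
  · exact hne (hT.pendant_unique hw hw' hu hu')
  · exact (Finset.mem_sdiff.1 (pendant_subset hw hu)).2 hw'
  · exact (Finset.mem_sdiff.1 (pendant_subset hw' hu')).2 hw
  · exact hne rfl

end Pendant

/-! ### Selecting the best candidate; exchange arguments for the excess. -/

section Candidates

variable {V : Type*} [DecidableEq V] {KK TT : List (Finset V)} {A F : Finset V}

/-- This makes A a safe initial value for `best`: the output is a solution even if the promises on
depth and excess fail. -/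
theorem valid_self : Valid KK A F A := fun Q _ _ h => by rwa [Finset.inter_self]

theorem pick_valid {x y : Finset V} (hy : Valid KK A F y) : Valid KK A F (pick KK A F x y) := by
  unfold pick; split_ifs with h
  exacts [h.1, hy]

theorem pick_card_le_left {x y : Finset V} (hx : Valid KK A F x) :
    (pick KK A F x y).card ≤ x.card := by
  unfold pick; split_ifs with h
  exacts [le_rfl, not_lt.1 fun h' => h ⟨hx, h'⟩]

theorem pick_card_le_right {x y : Finset V} : (pick KK A F x y).card ≤ y.card := by
  unfold pick; split_ifs with h
  exacts [h.2.le, le_rfl]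

theorem best_valid {ι : Type*} (cand : ι → Finset V) (l : List ι) :
    Valid KK A F (best KK A F cand l) := by
  unfold best
  induction l with
  | nil => exact valid_self
  | cons s l ih => exact pick_valid ih

theorem best_card_le {ι : Type*} {cand : ι → Finset V} {l : List ι} {s : ι} (hs : s ∈ l)
    (h : Valid KK A F (cand s)) : (best KK A F cand l).card ≤ (cand s).card := by
  unfold best
  induction l with
  | nil => simp at hs
  | cons s' l ih =>
    rw [List.foldr_cons]
    rcases List.mem_cons.1 hs with rfl | hs
    · exact pick_card_le_left h
    · exact pick_card_le_right.trans (ih hs)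

theorem unionOver_eq {l : List V} (hl : ∀ v, v ∈ l) (T : Finset V) (g : V → Finset V) :
    unionOver l T g = T.biUnion g := by
  have key : ∀ u (l : List V), u ∈ unionOver l T g ↔ ∃ v ∈ l, v ∈ T ∧ u ∈ g v := by
    intro u l
    unfold unionOver
    induction l with
    | nil => simp
    | cons v l ih =>
      rw [List.foldr_cons]
      by_cases h : v ∈ T <;> simp [h, ih]
  ext u
  simp [key, hl]

/-- `O` meets every member of `TT` contained in `A`. -/
def Hits (TT : List (Finset V)) (A O : Finset V) : Prop := ∀ K ∈ TT, K ⊆ A → (K ∩ O).Nonempty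

/-- `S` exceeds the size of the hitting sets of `TT` in `A` by at most `k`. -/
def ExcessLE (TT : List (Finset V)) (k : ℕ) (A S : Finset V) : Prop :=
  ∀ O, Hits TT A O → S.card ≤ O.card + k

/-- On the sets satisfying `p`, the function `f` gives valid solutions, which are at most as large
as any solution of excess at most `k`. -/
def Solves (KK TT : List (Finset V)) (k : ℕ) (p : Finset V → Prop)
    (f : Finset V → Finset V → Finset V) : Prop :=
  ∀ A F, p A → Disjoint A F → Valid KK A F (f A F) ∧
    ∀ S, Valid KK A F S → ExcessLE TT k A S → (f A F).card ≤ S.card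

/-- It suffices to compare with solutions contained in `A`. -/
theorem card_le_of_subset {k m : ℕ} {S : Finset V} (hS : Valid KK A F S) (hex : ExcessLE TT k A S)
    (h : ∀ S ⊆ A, Valid KK A F S → ExcessLE TT k A S → m ≤ S.card) : m ≤ S.card := by
  have hle : (A ∩ S).card ≤ S.card := Finset.card_le_card Finset.inter_subset_right
  refine (h (A ∩ S) Finset.inter_subset_left ?_ fun O hO => hle.trans (hex O hO)).trans hle
  intro Q hQ h1 h2
  rw [← Finset.inter_assoc A, Finset.inter_self]
  exact hS Q hQ h1 h2

variable {ι : Type*} {I : Finset ι} {P : ι → Finset V} {S : Finset V} {k : ℕ}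

/-- Every forbidden clique lies in one of the disjoint parts, so local hitting sets unite to a
global one, with which S can be compared. -/
theorem sum_excess_le (hdisj : (I : Set ι).PairwiseDisjoint P)
    (hcover : ∀ K ∈ TT, K ⊆ A → ∃ i ∈ I, K ⊆ P i) (hex : ExcessLE TT k A S) (O : ι → Finset V)
    (hO : ∀ i ∈ I, Hits TT (P i) (O i)) :
    ∑ i ∈ I, (S ∩ P i).card ≤ ∑ i ∈ I, (O i).card + k := by
  have h1 : S.card ≤ (I.biUnion O).card + k := by
    refine hex _ fun K hK hKA => ?_
    obtain ⟨i, hi, hKi⟩ := hcover K hK hKA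
    refine (hO i hi K hK hKi).mono (Finset.inter_subset_inter le_rfl ?_)
    exact Finset.subset_biUnion_of_mem O hi
  have h2 : ∑ i ∈ I, (S ∩ P i).card ≤ S.card := by
    rw [← Finset.card_biUnion]
    · exact Finset.card_le_card (Finset.biUnion_subset.2 fun i _ => Finset.inter_subset_left)
    · exact fun i hi j hj hne => (hdisj hi hj hne).mono Finset.inter_subset_right
        Finset.inter_subset_right
  have h3 := Finset.card_biUnion_le (s := I) (t := O)
  omega

/-- Replace S on one part only; the contributions of the other parts cancel. -/
theorem part_excess_le (hdisj : (I : Set ι).PairwiseDisjoint P)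
    (hcover : ∀ K ∈ TT, K ⊆ A → ∃ i ∈ I, K ⊆ P i) (hex : ExcessLE TT k A S)
    (hS : ∀ i ∈ I, Hits TT (P i) (S ∩ P i)) {i : ι} (hi : i ∈ I) :
    ExcessLE TT k (P i) (S ∩ P i) := by
  classical
  intro O hO
  have h := sum_excess_le hdisj hcover hex (fun j => if j = i then O else S ∩ P j) (by
    intro j hj
    by_cases h : j = i
    · subst h; simpa using hO
    · simpa [h] using hS j hj)
  have h' : ∑ j ∈ I.erase i, (if j = i then O else S ∩ P j).card =
      ∑ j ∈ I.erase i, (S ∩ P j).card :=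
    Finset.sum_congr rfl fun j hj => by rw [if_neg (Finset.ne_of_mem_erase hj)]
  rw [← Finset.add_sum_erase I _ hi,
    ← Finset.add_sum_erase I (fun j => (ite _ _ _ : Finset V).card) hi, if_pos rfl, h'] at h
  omega

theorem hits_part (hTK : ∀ K ∈ TT, K ∈ KK) (hne : ∀ K ∈ TT, K.Nonempty) (hS : Valid KK A F S)
    {B : Finset V} (hB : B ⊆ A) : Hits TT B (S ∩ B) := by
  intro K hK hKB
  have hKA := hKB.trans hB
  obtain ⟨z, hz⟩ := hS K (hTK K hK) (hKA.trans Finset.subset_union_left)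
    (by rw [Finset.inter_eq_left.2 hKA]; exact hne K hK)
  simp only [Finset.mem_inter] at hz
  exact ⟨z, by simp [hz, hKB hz.1]⟩

end Candidates

/-! ### Correctness of the step at a root. -/

section Root

variable {n : ℕ} {G : SimpleGraph (Fin n)} {KK TT : List (Finset (Fin n))}
  {C F T : Finset (Fin n)} {k : ℕ} {p : Finset (Fin n) → Prop}
  {rec : Finset (Fin n) → Finset (Fin n) → Finset (Fin n)}

/-- An exchange argument: a suitable guess Y with at most k elements makes the greedy choice agree
with S on S ∩ T and be no worse than S on every part. Enough vertices of T are then chosen to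
satisfy the constraints inside T ∪ F, and all other constraints are local to one part. -/
theorem solveRoot_card_le (hKK : ∀ Q ∈ KK, G.IsClique (Q : Set (Fin n)))
    (hTK : ∀ K ∈ TT, K ∈ KK) (hne : ∀ K ∈ TT, K.Nonempty) (hrec : Solves KK TT (k + 1) p rec)
    (hC : ConnectedOn G C) (hCF : Disjoint C F) (hT : PathClosed G C T)
    (hfree : ∀ K ∈ TT, ¬ K ⊆ T) {v : Fin n} (hv : v ∈ T) (hp : ∀ w ∈ T, p (pendant G C T w))
    {S : Finset (Fin n)} (hS : Valid KK C F S) (hex : ExcessLE TT k C S) :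
    (solveRoot G KK rec k C F T).card ≤ S.card := by
  refine card_le_of_subset hS hex ?_
  clear hS hex S
  intro S hSC hS hex
  set P : Fin n → Finset (Fin n) := pendant G C T with hP
  set inn : Fin n → Finset (Fin n) := fun w => {w} ∪ rec (P w) F with hinn
  set out : Fin n → Finset (Fin n) := fun w => rec (P w) (F ∪ {w}) with hout
  have hPC : ∀ w ∈ T, P w ⊆ C \ T := fun w hw => pendant_subset hw
  have hPC' : ∀ w ∈ T, P w ⊆ C := fun w hw => (hPC w hw).trans Finset.sdiff_subset
  have hPw : ∀ w ∈ T, w ∉ P w := fun w hw h => (Finset.mem_sdiff.1 (hPC w hw h)).2 hw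
  have hAC : ∀ w ∈ T, P w ∪ {w} ⊆ C := fun w hw =>
    Finset.union_subset (hPC' w hw) (Finset.singleton_subset_iff.2 (hT.1 hw))
  have hPF : ∀ w ∈ T, Disjoint (P w) F := fun w hw => hCF.mono_left (hPC' w hw)
  have hPF' : ∀ w ∈ T, Disjoint (P w) (F ∪ {w}) := fun w hw =>
    Finset.disjoint_union_right.2 ⟨hPF w hw, Finset.disjoint_singleton_right.2 (hPw w hw)⟩
  have hcover : ∀ K ∈ TT, K ⊆ C → ∃ w ∈ T, K ⊆ P w ∪ {w} := by
    intro K hK hKC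
    obtain ⟨u, hu, huT⟩ := Finset.not_subset.1 (hfree K hK)
    obtain ⟨w, hw, huw⟩ := exists_mem_pendant hC hT.1 hv (hKC hu) huT
    exact ⟨w, hw, fun z hz => hT.clique_subset hw (hKK K (hTK K hK)) hu huw hz (hKC hz)⟩
  have hparts : ∀ w ∈ T, Hits TT (P w ∪ {w}) (S ∩ (P w ∪ {w})) := fun w hw =>
    hits_part hTK hne hS (hAC w hw)
  have hpart : ∀ w ∈ T, ExcessLE TT k (P w ∪ {w}) (S ∩ (P w ∪ {w})) := fun w hw =>
    part_excess_le hT.pairwise_disjoint hcover hex hparts hw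
  have hsub : ∀ w, S ∩ P w ⊆ S ∩ (P w ∪ {w}) := fun w =>
    Finset.inter_subset_inter le_rfl Finset.subset_union_left
  -- A hitting set O of P(w) becomes one of P(w) ∪ {w} on adding w; this single vertex is the
  -- increase from k to k + 1.
  have hexP : ∀ w ∈ T, ExcessLE TT (k + 1) (P w) (S ∩ P w) := by
    intro w hw O hO
    have h1 := hpart w hw (O ∪ {w}) (by
      intro K hK hKA
      by_cases hwK : w ∈ K
      · exact ⟨w, by simp [hwK]⟩
      · refine (hO K hK fun z hz => ?_).mono
          (Finset.inter_subset_inter le_rfl Finset.subset_union_left)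
        rcases Finset.mem_union.1 (hKA hz) with h | h
        · exact h
        · exact absurd (Finset.mem_singleton.1 h ▸ hz) hwK)
    have h2 := Finset.card_union_le O {w}
    have h3 := Finset.card_le_card (hsub w)
    rw [Finset.card_singleton] at h2
    omega
  have hit : ∀ w ∈ T, ∀ Q ∈ KK, Q ⊆ P w ∪ (F ∪ {w}) → (Q ∩ P w).Nonempty →
      ∃ z ∈ Q, z ∈ S ∧ (z ∈ P w ∨ z = w) := by
    intro w hw Q hQ hsubQ hQP
    have hwC := hT.1 hw
    have h1 : Q ⊆ C ∪ F := fun z hz => by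
      have := hsubQ hz
      simp only [Finset.mem_union, Finset.mem_singleton] at this ⊢
      rcases this with h | h | rfl
      · exact .inl (hPC' w hw h)
      · exact .inr h
      · exact .inl hwC
    obtain ⟨z, hz⟩ := hS Q hQ h1 (hQP.mono (Finset.inter_subset_inter le_rfl (hPC' w hw)))
    simp only [Finset.mem_inter] at hz
    refine ⟨z, hz.1, hz.2.2, ?_⟩
    have := hsubQ hz.1
    simp only [Finset.mem_union, Finset.mem_singleton] at this
    rcases this with h | h | h
    · exact .inl h
    · exact absurd h (Finset.disjoint_left.1 hCF hz.2.1)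
    · exact .inr h
  have hvalP : ∀ w ∈ T, Valid KK (P w) F (S ∩ P w) := by
    intro w hw Q hQ hsubQ hQP
    obtain ⟨z, hzQ, hzS, h⟩ := hit w hw Q hQ
      (hsubQ.trans (Finset.union_subset_union le_rfl Finset.subset_union_left)) hQP
    have hzP : z ∈ P w := h.resolve_right fun e => by
      rcases Finset.mem_union.1 (hsubQ hzQ) with h | h
      · exact hPw w hw (e ▸ h)
      · exact Finset.disjoint_left.1 hCF (hSC hzS) h
    exact ⟨z, by simp [hzQ, hzS, hzP]⟩
  have hvalP' : ∀ w ∈ T, w ∉ S → Valid KK (P w) (F ∪ {w}) (S ∩ P w) := by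
    intro w hw hwS Q hQ hsubQ hQP
    obtain ⟨z, hzQ, hzS, h⟩ := hit w hw Q hQ hsubQ hQP
    have hzP : z ∈ P w := h.resolve_right fun e => hwS (e ▸ hzS)
    exact ⟨z, by simp [hzQ, hzS, hzP]⟩
  have hinn_valid : ∀ w ∈ T, Valid KK (P w ∪ {w}) F (inn w) := by
    intro w hw Q hQ hsubQ hQA
    by_cases hwQ : w ∈ Q
    · exact ⟨w, by simp [hwQ, hinn]⟩
    · have hmem : ∀ z ∈ Q, z ∈ P w ∪ {w} → z ∈ P w := fun z hz h =>
        (Finset.mem_union.1 h).resolve_right fun e => hwQ (Finset.mem_singleton.1 e ▸ hz)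
      obtain ⟨z, hz⟩ := (hrec (P w) F (hp w hw) (hPF w hw)).1 Q hQ
        (fun z hz => by
          rcases Finset.mem_union.1 (hsubQ hz) with h | h
          · exact Finset.mem_union_left _ (hmem z hz h)
          · exact Finset.mem_union_right _ h)
        (by
          obtain ⟨z, hz⟩ := hQA
          rw [Finset.mem_inter] at hz
          exact ⟨z, Finset.mem_inter.2 ⟨hz.1, hmem z hz.1 hz.2⟩⟩)
      simp only [Finset.mem_inter] at hz
      exact ⟨z, by simp [hz, hinn]⟩
  -- If w is not in S, a relevant constraint that misses P(w) could only be hit by S at w, so there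
  -- is none.
  have hout_valid : ∀ w ∈ T, w ∉ S → Valid KK (P w ∪ {w}) F (out w) := by
    intro w hw hwS Q hQ hsubQ hQA
    have h1 : Q ⊆ P w ∪ (F ∪ {w}) := by
      rwa [Finset.union_comm F, ← Finset.union_assoc]
    by_cases hQP : (Q ∩ P w).Nonempty
    · refine ((hrec (P w) (F ∪ {w}) (hp w hw) (hPF' w hw)).1 Q hQ h1 hQP).mono ?_
      exact Finset.inter_subset_inter le_rfl
        (Finset.inter_subset_inter Finset.subset_union_left le_rfl)
    · exfalso
      have h2 : Q ⊆ C ∪ F := hsubQ.trans (Finset.union_subset_union (hAC w hw) le_rfl)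
      obtain ⟨z, hz⟩ := hS Q hQ h2 (hQA.mono (Finset.inter_subset_inter le_rfl (hAC w hw)))
      simp only [Finset.mem_inter] at hz
      rcases Finset.mem_union.1 (hsubQ hz.1) with h | h
      · rcases Finset.mem_union.1 h with h | h
        · exact hQP ⟨z, Finset.mem_inter.2 ⟨hz.1, h⟩⟩
        · exact hwS (Finset.mem_singleton.1 h ▸ hz.2.2)
      · exact Finset.disjoint_left.1 hCF hz.2.1 h
  have hinn_card : ∀ w ∈ T, w ∈ S → (inn w).card ≤ (S ∩ (P w ∪ {w})).card := by
    intro w hw hwS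
    have h1 := (hrec (P w) F (hp w hw) (hPF w hw)).2 _ (hvalP w hw) (hexP w hw)
    have h2 := Finset.card_union_le {w} (rec (P w) F)
    have h3 : (S ∩ P w).card < (S ∩ (P w ∪ {w})).card := by
      refine Finset.card_lt_card ((Finset.ssubset_iff_of_subset (hsub w)).2 ⟨w, ?_, ?_⟩)
      · simp [hwS]
      · exact fun h => hPw w hw (Finset.mem_inter.1 h).2
    rw [Finset.card_singleton] at h2
    exact h2.trans (by omega)
  have hout_card : ∀ w ∈ T, w ∉ S → (out w).card ≤ (S ∩ (P w ∪ {w})).card := fun w hw hwS =>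
    ((hrec (P w) (F ∪ {w}) (hp w hw) (hPF' w hw)).2 _ (hvalP' w hw hwS) (hexP w hw)).trans
      (Finset.card_le_card (hsub w))
  classical
  -- These are the only places where the greedy choice would drop a vertex w of S ∩ T. The guess
  -- forces them in.
  set Y := T.filter fun w => w ∈ S ∧ Valid KK (P w ∪ {w}) F (out w) ∧ (out w).card < (inn w).card
    with hY
  have hYT : Y ⊆ T := Finset.filter_subset _ _
  -- Exchanging S for `out w` on the parts of Y keeps all t-cliques hit and saves at least one
  -- vertex per element of Y, so the excess bounds |Y|.
  have hYcard : Y.card ≤ k := by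
    have h1 := sum_excess_le hT.pairwise_disjoint hcover hex
      (fun w => if w ∈ Y then out w else S ∩ (P w ∪ {w})) (by
        intro w hw
        by_cases h : w ∈ Y
        · rw [if_pos h]
          intro K hK hKA
          refine ((Finset.mem_filter.1 h).2.2.1 K (hTK K hK)
            (hKA.trans Finset.subset_union_left) ?_).mono
              (Finset.inter_subset_inter le_rfl Finset.inter_subset_right)
          rw [Finset.inter_eq_left.2 hKA]; exact hne K hK
        · rw [if_neg h]; exact hparts w hw)
    have h2 : ∑ w ∈ T, ((if w ∈ Y then out w else S ∩ (P w ∪ {w})).card + if w ∈ Y then 1 else 0) ≤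
        ∑ w ∈ T, (S ∩ (P w ∪ {w})).card := by
      refine Finset.sum_le_sum fun w hw => ?_
      by_cases h : w ∈ Y
      · rw [if_pos h, if_pos h]
        have := (Finset.mem_filter.1 h).2
        exact (Nat.succ_le_of_lt this.2.2).trans (hinn_card w hw this.1)
      · rw [if_neg h, if_neg h]; simp
    rw [Finset.sum_add_distrib, Finset.sum_ite_mem, Finset.sum_const, smul_eq_mul, mul_one,
      Finset.inter_eq_right.2 hYT] at h2
    have h1' : ∑ w ∈ T, (S ∩ (P w ∪ {w})).card ≤
      ∑ w ∈ T, (if w ∈ Y then out w else S ∩ (P w ∪ {w})).card + k := h1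
    omega
  set sol : Fin n → Finset (Fin n) := pendantSol G KK rec C F T Y with hsol
  have hsol_eq : ∀ w, sol w = if w ∈ Y then inn w else pick KK (P w ∪ {w}) F (out w) (inn w) :=
    fun w => rfl
  -- For w in S \ Y the option without w is invalid or not cheaper, so `pick` falls back on the
  -- option containing w.
  have hsol_inn : ∀ w ∈ T, w ∈ S → sol w = inn w := by
    intro w hw hwS
    rw [hsol_eq]
    by_cases h : w ∈ Y
    · rw [if_pos h]
    · rw [if_neg h, pick, if_neg]
      exact fun h' => h (Finset.mem_filter.2 ⟨hw, hwS, h'⟩)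
  have hsol_card : ∀ w ∈ T, (sol w).card ≤ (S ∩ (P w ∪ {w})).card := by
    intro w hw
    by_cases hwS : w ∈ S
    · rw [hsol_inn w hw hwS]; exact hinn_card w hw hwS
    · rw [hsol_eq, if_neg fun h => hwS (Finset.mem_filter.1 h).2.1]
      exact (pick_card_le_left (hout_valid w hw hwS)).trans (hout_card w hw hwS)
  have hsol_valid : ∀ w ∈ T, Valid KK (P w ∪ {w}) F (sol w) := by
    intro w hw
    rw [hsol_eq]
    split_ifs
    · exact hinn_valid w hw
    · exact pick_valid (hinn_valid w hw)
  have hcand : unionOver (List.finRange n) T sol = T.biUnion sol :=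
    unionOver_eq List.mem_finRange _ _
  refine (best_card_le (s := Y) (mem_smallSets hYcard) ?_).trans ?_
  · change Valid KK C F (unionOver (List.finRange n) T sol)
    rw [hcand]
    intro Q hQ hsubQ hQC
    by_cases h : ∃ w ∈ T, ∃ u ∈ Q, u ∈ P w
    · obtain ⟨w, hw, u, hu, huw⟩ := h
      obtain ⟨z, hz⟩ := hsol_valid w hw Q hQ
        (fun z hz => by
          rcases Finset.mem_union.1 (hsubQ hz) with h | h
          · exact Finset.mem_union_left _ (hT.clique_subset hw (hKK Q hQ) hu huw hz h)
          · exact Finset.mem_union_right _ h)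
        ⟨u, Finset.mem_inter.2 ⟨hu, Finset.mem_union_left _ huw⟩⟩
      simp only [Finset.mem_inter] at hz
      refine ⟨z, ?_⟩
      simp only [Finset.mem_inter, Finset.mem_biUnion]
      exact ⟨hz.1, hAC w hw hz.2.1, w, hw, hz.2.2⟩
    -- The constraint now has no vertex in a pendant part. S hits it at some z in T, and z belongs
    -- to its own chosen option.
    · obtain ⟨z, hz⟩ := hS Q hQ hsubQ hQC
      simp only [Finset.mem_inter] at hz
      have hzT : z ∈ T := by
        by_contra hzT
        obtain ⟨w, hw, hzw⟩ := exists_mem_pendant hC hT.1 hv hz.2.1 hzT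
        exact h ⟨w, hw, z, hz.1, hzw⟩
      refine ⟨z, ?_⟩
      simp only [Finset.mem_inter, Finset.mem_biUnion]
      refine ⟨hz.1, hz.2.1, z, hzT, ?_⟩
      rw [hsol_inn z hzT hz.2.2]
      simp [hinn]
  · change (unionOver (List.finRange n) T sol).card ≤ S.card
    rw [hcand]
    refine Finset.card_biUnion_le.trans ((Finset.sum_le_sum hsol_card).trans ?_)
    rw [← Finset.card_biUnion]
    · exact Finset.card_le_card (Finset.biUnion_subset.2 fun i _ => Finset.inter_subset_left)
    · exact fun i hi j hj hne => (hT.pairwise_disjoint hi hj hne).mono Finset.inter_subset_right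
        Finset.inter_subset_right

end Root

/-! ### Correctness of the recursion -/

section Solve

variable {V : Type*} {G : SimpleGraph V}

theorem linkedSet_subset {r : V → V → Prop} {Y : Finset V} {v : V} : linkedSet r Y v ⊆ Y :=
  fun _ hu => (mem_linkedSet.1 hu).mem_right

theorem connectedOn_linkedSet {Y : Finset V} {v : V} : ConnectedOn G (linkedSet G.Adj Y v) := by
  have key : ∀ b ∈ linkedSet G.Adj Y v, Linked G.Adj (linkedSet G.Adj Y v) v b := by
    intro b hb
    have hb' := mem_linkedSet.1 hb
    exact hb'.closed (.refl (mem_linkedSet.2 (.refl hb'.mem_left))) fun x y hx hxY hy hxy =>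
      hx.trans (.step hx.mem_right
        (mem_linkedSet.2 ((mem_linkedSet.1 hx.mem_right).trans (.step hxY hy hxy))) hxy)
  exact fun a ha b hb => (key a ha).symm.trans (key b hb)

theorem linkedSet_clique {Y Q : Finset V} {v u z : V} (hQ : G.IsClique (Q : Set V)) (hu : u ∈ Q)
    (huv : u ∈ linkedSet G.Adj Y v) (hz : z ∈ Q) (hzY : z ∈ Y) : z ∈ linkedSet G.Adj Y v := by
  by_cases h : u = z
  · exact h ▸ huv
  · have huv' := mem_linkedSet.1 huv
    exact mem_linkedSet.2 (huv'.trans (.step huv'.mem_right hzY (hQ hu hz h)))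

theorem linkedSet_eq_of_mem {Y : Finset V} {v w u : V} (hv : u ∈ linkedSet G.Adj Y v)
    (hw : u ∈ linkedSet G.Adj Y w) : linkedSet G.Adj Y v = linkedSet G.Adj Y w := by
  rw [mem_linkedSet] at hv hw
  ext x
  rw [mem_linkedSet, mem_linkedSet]
  exact ⟨fun h => hw.trans (hv.symm.trans h), fun h => hv.trans (hw.symm.trans h)⟩

theorem mem_activePart [DecidableEq V] {TT : List (Finset V)} {A : Finset V} {v : V} :
    v ∈ activePart TT A ↔ ∃ K ∈ TT, K ⊆ A ∧ v ∈ K := by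
  classical
  rw [activePart, Finset.mem_filter]
  exact and_iff_right_of_imp fun ⟨_, _, h, hv⟩ => h hv

end Solve

/-! ### Correctness of the whole recursion. -/

section Correctness

variable {n : ℕ} {G : SimpleGraph (Fin n)} {KK TT : List (Finset (Fin n))} {k : ℕ}
  {rec : Finset (Fin n) → Finset (Fin n) → Finset (Fin n)}

/-- The unknown root T is replaced by the hull of one of its vertices, which is computable. As the
hull contains T, its pendant parts lie in C \ T and inherit the depth bound. -/
theorem solves_solveConn (hKK : ∀ Q ∈ KK, G.IsClique (Q : Set (Fin n))) (hTK : ∀ K ∈ TT, K ∈ KK)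
    (hne : ∀ K ∈ TT, K.Nonempty) {l : ℕ} (hrec : Solves KK TT (k + 1) (DepthLE G TT l) rec) :
    Solves KK TT k (fun C => ConnectedOn G C ∧ ∃ T, T.Nonempty ∧ PathClosed G C T ∧
      (∀ K ∈ TT, ¬ K ⊆ T) ∧ DepthLE G TT l (C \ T)) (solveConn G KK TT rec k) := by
  rintro C F ⟨hC, T, ⟨v, hv⟩, hT, hfree, hd⟩ hCF
  refine ⟨best_valid _ _, fun S hS hex => ?_⟩
  obtain ⟨hsub, hH, hHfree⟩ := freeHull_spec (fun K hK => hKK K (hTK K hK)) hC hT hfree hv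
  have hp : ∀ w ∈ freeHull G TT C v, DepthLE G TT l (pendant G C (freeHull G TT C v) w) :=
    fun w hw => hd.mono ((pendant_subset hw).trans (Finset.sdiff_subset_sdiff le_rfl hsub))
  exact (best_card_le (cand := fun v => solveRoot G KK rec k C F (freeHull G TT C v))
    (List.mem_finRange v) (best_valid _ _)).trans
    (solveRoot_card_le hKK hTK hne hrec hC hCF hH hHfree (hsub hv) hp hS hex)

/-- Components of the active part are connected and each of their vertices is in a t-clique inside
the component, so the inner solver only needs to handle sets of this kind. -/
theorem solves_solveSplit (hKK : ∀ Q ∈ KK, G.IsClique (Q : Set (Fin n))) (hTK : ∀ K ∈ TT, K ∈ KK)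
    (hne : ∀ K ∈ TT, K.Nonempty) {p : Finset (Fin n) → Prop} (hrec : Solves KK TT k p rec) :
    Solves KK TT k (fun A => ∀ C ⊆ A, C.Nonempty → ConnectedOn G C →
      (∀ v ∈ C, ∃ K ∈ TT, K ⊆ C ∧ v ∈ K) → p C) (solveSplit G KK TT rec k) := by
  intro A F hp hAF
  refine ⟨best_valid _ _, fun S hS hex => card_le_of_subset hS hex ?_⟩
  clear hS hex S
  intro S hSA hS hex
  set B := activePart TT A with hB
  set X := (A ∩ S) \ B with hX
  set F' := F ∪ ((A \ B) \ X) with hF'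
  set I := B.image (linkedSet G.Adj B) with hI
  have hBA : B ⊆ A := Finset.filter_subset _ _
  have hIB : ∀ c ∈ I, c ⊆ B := by
    intro c hc
    obtain ⟨v, -, rfl⟩ := Finset.mem_image.1 hc
    exact linkedSet_subset
  have hIA : ∀ c ∈ I, c ⊆ A := fun c hc => (hIB c hc).trans hBA
  have hdisj : (I : Set (Finset (Fin n))).PairwiseDisjoint fun c => c := by
    intro c hc d hd hcd
    obtain ⟨v, -, rfl⟩ := Finset.mem_image.1 (Finset.mem_coe.1 hc)
    obtain ⟨w, -, rfl⟩ := Finset.mem_image.1 (Finset.mem_coe.1 hd)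
    exact Finset.disjoint_left.2 fun u hu hu' => hcd (linkedSet_eq_of_mem hu hu')
  have hclique : ∀ c ∈ I, ∀ Q ∈ KK, ∀ u ∈ Q, u ∈ c → ∀ z ∈ Q, z ∈ B → z ∈ c := by
    intro c hc Q hQ u hu huc z hz hzB
    obtain ⟨v, -, rfl⟩ := Finset.mem_image.1 hc
    exact linkedSet_clique (hKK Q hQ) hu huc hz hzB
  have hself : ∀ u ∈ B, ∃ c ∈ I, u ∈ c := fun u hu =>
    ⟨_, Finset.mem_image_of_mem _ hu, mem_linkedSet.2 (.refl hu)⟩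
  have hTB : ∀ K ∈ TT, K ⊆ A → K ⊆ B := fun K hK hKA z hz => mem_activePart.2 ⟨K, hK, hKA, hz⟩
  have hcover : ∀ K ∈ TT, K ⊆ A → ∃ c ∈ I, K ⊆ c := by
    intro K hK hKA
    obtain ⟨u, hu⟩ := hne K hK
    obtain ⟨c, hc, huc⟩ := hself u (hTB K hK hKA hu)
    exact ⟨c, hc, fun z hz => hclique c hc K (hTK K hK) u hu huc z hz (hTB K hK hKA hz)⟩
  have hpI : ∀ c ∈ I, p c := by
    intro c hc
    obtain ⟨v, hv, rfl⟩ := Finset.mem_image.1 hc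
    refine hp _ (hIA _ hc) ⟨v, mem_linkedSet.2 (.refl hv)⟩ connectedOn_linkedSet fun u hu => ?_
    obtain ⟨K, hK, hKA, huK⟩ := mem_activePart.1 (hIB _ hc hu)
    exact ⟨K, hK, fun z hz => hclique _ hc K (hTK K hK) u huK hu z hz (hTB K hK hKA hz), huK⟩
  have hXS : X ⊆ S := Finset.sdiff_subset.trans Finset.inter_subset_right
  -- Every t-clique in A lies in B, so S \ X still hits them all.
  have hXcard : X.card ≤ k := by
    have h1 := hex (S \ X) fun K hK hKA => by
      obtain ⟨z, hz⟩ := hS K (hTK K hK) (hKA.trans Finset.subset_union_left)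
        (by rw [Finset.inter_eq_left.2 hKA]; exact hne K hK)
      simp only [Finset.mem_inter] at hz
      have hzX : z ∉ X := fun h => (Finset.mem_sdiff.1 h).2 (hTB K hK hKA hz.1)
      exact ⟨z, by simp [hz, hzX]⟩
    have h2 := Finset.card_sdiff_add_card_eq_card hXS
    omega
  have hF'sub : ∀ c ∈ I, c ∪ F' ⊆ A ∪ F := by
    intro c hc z hz
    simp only [hF', Finset.mem_union, Finset.mem_sdiff] at hz ⊢
    rcases hz with h | h | h
    exacts [.inl (hIA c hc h), .inr h, .inl h.1.1]
  have hIF : ∀ c ∈ I, Disjoint c F' := by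
    intro c hc
    refine Finset.disjoint_left.2 fun z hz h => ?_
    rcases Finset.mem_union.1 h with h | h
    · exact Finset.disjoint_left.1 hAF (hIA c hc hz) h
    · exact (Finset.mem_sdiff.1 (Finset.mem_sdiff.1 h).1).2 (hIB c hc hz)
  have hval : ∀ c ∈ I, Valid KK c F' (S ∩ c) := by
    intro c hc Q hQ hsubQ hQc
    obtain ⟨z, hz⟩ := hS Q hQ (hsubQ.trans (hF'sub c hc))
      (hQc.mono (Finset.inter_subset_inter le_rfl (hIA c hc)))
    simp only [Finset.mem_inter] at hz
    have hzc : z ∈ c := by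
      refine (Finset.mem_union.1 (hsubQ hz.1)).resolve_right fun h => ?_
      rcases Finset.mem_union.1 h with h | h
      · exact Finset.disjoint_left.1 hAF hz.2.1 h
      · have h' := Finset.mem_sdiff.1 h
        exact h'.2 (Finset.mem_sdiff.2
          ⟨Finset.mem_inter.2 hz.2, (Finset.mem_sdiff.1 h'.1).2⟩)
    exact ⟨z, by simp [hz, hzc]⟩
  have hcard : ∀ c ∈ I, (rec c F').card ≤ (S ∩ c).card := fun c hc =>
    (hrec c F' (hpI c hc) (hIF c hc)).2 _ (hval c hc)
      (part_excess_le hdisj hcover hex (fun d hd => hits_part hTK hne hS (hIA d hd)) hc)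
  have hcand : splitCand G TT rec A F S = X ∪ I.biUnion fun c => rec c F' := by
    rw [splitCand, unionOver_eq List.mem_finRange, hI, Finset.image_biUnion]
  refine (best_card_le (s := X) (mem_smallSets hXcard) ?_).trans ?_
  all_goals
    -- A guess matters only through its part in A \ B, so the small set X yields the same candidate
    -- as S itself.
    have hAX : (A ∩ X) \ B = X := by
      rw [Finset.inter_eq_right.2 (hXS.trans hSA), hX, Finset.sdiff_idem]
    have hcandX : splitCand G TT rec A F X = X ∪ I.biUnion fun c => rec c F' := by
      rw [← hcand, splitCand, splitCand, hAX]
    rw [hcandX]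
  · intro Q hQ hsubQ hQA
    by_cases h : ∃ u ∈ Q, u ∈ B
    · obtain ⟨u, hu, huB⟩ := h
      by_cases hQX : ∃ z ∈ Q, z ∈ X
      · obtain ⟨z, hz, hzX⟩ := hQX
        exact ⟨z, by simp [hz, hzX, hSA (hXS hzX)]⟩
      -- A constraint avoiding X has its vertices in B inside one component c and all others in F',
      -- so it is a constraint of the instance (c, F').
      · obtain ⟨c, hc, huc⟩ := hself u huB
        obtain ⟨z, hz⟩ := (hrec c F' (hpI c hc) (hIF c hc)).1 Q hQ
          (fun z hz => by
            by_cases hzB : z ∈ B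
            · exact Finset.mem_union_left _ (hclique c hc Q hQ u hu huc z hz hzB)
            · refine Finset.mem_union_right _ ?_
              rcases Finset.mem_union.1 (hsubQ hz) with h | h
              · exact Finset.mem_union_right _ (Finset.mem_sdiff.2
                  ⟨Finset.mem_sdiff.2 ⟨h, hzB⟩, fun hzX => hQX ⟨z, hz, hzX⟩⟩)
              · exact Finset.mem_union_left _ h)
          ⟨u, Finset.mem_inter.2 ⟨hu, huc⟩⟩
        simp only [Finset.mem_inter] at hz
        refine ⟨z, ?_⟩
        simp only [Finset.mem_inter, Finset.mem_union, Finset.mem_biUnion]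
        exact ⟨hz.1, hIA c hc hz.2.1, .inr ⟨c, hc, hz.2.2⟩⟩
    · obtain ⟨z, hz⟩ := hS Q hQ hsubQ hQA
      simp only [Finset.mem_inter] at hz
      have hzX : z ∈ X := Finset.mem_sdiff.2 ⟨Finset.mem_inter.2 hz.2, fun hzB => h ⟨z, hz.1, hzB⟩⟩
      exact ⟨z, by simp [hz, hzX]⟩
  · have h1 : (I.biUnion fun c => rec c F').card ≤ (S \ X).card := by
      refine Finset.card_biUnion_le.trans ((Finset.sum_le_sum hcard).trans ?_)
      rw [← Finset.card_biUnion]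
      · refine Finset.card_le_card (Finset.biUnion_subset.2 fun c hc z hz => ?_)
        rw [Finset.mem_inter] at hz
        exact Finset.mem_sdiff.2 ⟨hz.1, fun h => (Finset.mem_sdiff.1 h).2 (hIB c hc hz.2)⟩
      · exact fun i hi j hj hij => (hdisj hi hj hij).mono Finset.inter_subset_right
          Finset.inter_subset_right
    have h2 := Finset.card_sdiff_add_card_eq_card hXS
    have h3 := Finset.card_union_le X (I.biUnion fun c => rec c F')
    omega

theorem solve_valid (l k : ℕ) (A F : Finset (Fin n)) : Valid KK A F (solve G KK TT l k A F) := by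
  cases l <;> exact best_valid _ _

/-- The algorithm is correct on the sets of bounded depth. -/
theorem solves_solve (hKK : ∀ Q ∈ KK, G.IsClique (Q : Set (Fin n))) (hTK : ∀ K ∈ TT, K ∈ KK)
    (hne : ∀ K ∈ TT, K.Nonempty) (l k : ℕ) :
    Solves KK TT k (DepthLE G TT l) (solve G KK TT l k) := by
  induction l generalizing k with
  | zero =>
    intro A F hA hAF
    -- At depth 0 there is no active set, so the inner solver is never consulted and may be
    -- arbitrary.
    refine solves_solveSplit hKK hTK hne (p := fun _ => False) (fun _ _ h => h.elim) A F ?_ hAF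
    rintro C hCA ⟨v, hv⟩ - hact
    obtain ⟨K, hK, hKC, -⟩ := hact v hv
    exact hA K hK (hKC.trans hCA)
  | succ l ih =>
    intro A F hA hAF
    exact solves_solveSplit hKK hTK hne (solves_solveConn hKK hTK hne (ih (k + 1))) A F
      (fun C hCA hC hconn hact => ⟨hconn, hA C hCA hC hconn hact⟩) hAF

end Correctness

/-! ### Solutions and the optimum -/

section Optimum

variable {n t : ℕ} {G : SimpleGraph (Fin n)} {H : Finset (Finset (Fin n))}
  {hs : List (Finset (Fin n))}

/-- With A everything and F empty every constraint is relevant, and being K_t-free after deletion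
means hitting all t-cliques. -/
theorem mem_sol_iff {KK : List (Finset (Fin n))} (ht : 0 < t) (hH : IsCliqueFamily t G H)
    (hKK : ∀ S, S ∈ KK ↔ S ∈ H ∨ G.IsNClique t S) {S : Finset (Fin n)} :
    S ∈ sol t G H ↔ Valid KK Finset.univ ∅ S := by
  have hne : ∀ Q ∈ KK, Q.Nonempty := by
    intro Q hQ
    rcases (hKK Q).1 hQ with h | h
    · exact (hH Q h).1
    · rw [← Finset.card_pos, h.2]; exact ht
  have hval : Valid KK Finset.univ ∅ S ↔ ∀ Q ∈ KK, (S ∩ Q).Nonempty := by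
    unfold Valid
    simp only [Finset.univ_inter, Finset.inter_univ, Finset.union_empty, Finset.subset_univ,
      true_implies, Finset.inter_comm S]
    exact ⟨fun h Q hQ => h Q hQ (hne Q hQ), fun h Q hQ _ => h Q hQ⟩
  rw [hval]
  change (G.induce ((S : Set (Fin n))ᶜ)).CliqueFree t ∧ _ ↔ _
  rw [cliqueFree_induce_iff]
  have hcl : ∀ K : Finset (Fin n), ¬ (K : Set (Fin n)) ⊆ (S : Set (Fin n))ᶜ ↔ (S ∩ K).Nonempty := by
    intro K
    rw [Set.subset_compl_iff_disjoint_left, Finset.disjoint_coe,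
      Finset.not_disjoint_iff_nonempty_inter]
  simp only [hcl]
  constructor
  · rintro ⟨h1, h2⟩ Q hQ
    exact ((hKK Q).1 hQ).elim (h2 Q) (h1 Q)
  · exact fun h => ⟨fun K hK => h K ((hKK K).2 (.inr hK)), fun Z hZ => h Z ((hKK Z).2 (.inl hZ))⟩

theorem opt_le {S : Finset (Fin n)} (hS : S ∈ sol t G H) : opt t G H ≤ S.card :=
  Nat.sInf_le ⟨S, hS, rfl⟩

/-- The given solution excludes the default value of `sInf` on the empty set. -/
theorem exists_card_eq_opt {S : Finset (Fin n)} (hS : S ∈ sol t G H) :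
    ∃ S ∈ sol t G H, S.card = opt t G H :=
  Nat.sInf_mem (s := {k | ∃ S ∈ sol t G H, S.card = k}) ⟨_, S, hS, rfl⟩

theorem isCliqueFamily_empty : IsCliqueFamily t G ∅ := fun Z hZ => absurd hZ (Finset.notMem_empty Z)

theorem mem_cliqueList_iff_or (S : Finset (Fin n)) :
    S ∈ cliqueList G t ↔ S ∈ (∅ : Finset (Finset (Fin n))) ∨ G.IsNClique t S := by
  simp [mem_cliqueList]

/-- The algorithm solves the extended `K_t`-hitting problem. -/
theorem solve_spec (ht : 2 ≤ t) (hH : IsCliqueFamily t G H) {KK : List (Finset (Fin n))}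
    (hKK : ∀ S, S ∈ KK ↔ S ∈ H ∨ G.IsNClique t S) (l k : ℕ) :
    solve G KK (cliqueList G t) l k Finset.univ ∅ ∈ sol t G H ∧
      (bedPlus t G ≤ l → opt t G H ≤ opt t G ∅ + k →
        (solve G KK (cliqueList G t) l k Finset.univ ∅).card = opt t G H) := by
  have ht0 : 0 < t := by omega
  have hmem := (mem_sol_iff ht0 hH hKK).2
    (solve_valid (G := G) (TT := cliqueList G t) l k Finset.univ ∅)
  refine ⟨hmem, fun hbed hopt => le_antisymm ?_ (opt_le hmem)⟩
  obtain ⟨S, hS, hcard⟩ := exists_card_eq_opt hmem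
  rw [← hcard]
  refine (solves_solve ?_ ?_ ?_ l k Finset.univ ∅
    (depthLE_of_bedPlusOn ht (fun K => mem_cliqueList) _ _ hbed)
    (Finset.disjoint_empty_right _)).2 S ((mem_sol_iff ht0 hH hKK).1 hS) ?_
  · intro Q hQ
    exact ((hKK Q).1 hQ).elim (fun h => (hH Q h).2.2) fun h => h.1
  · exact fun K hK => (hKK K).2 (.inr (mem_cliqueList.1 hK))
  · intro K hK
    rw [← Finset.card_pos, (mem_cliqueList.1 hK).2]; exact ht0
  -- The sets compared with in the excess are exactly the solutions without the family, so the
  -- promise on `opt` is the required excess bound.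
  · intro O hO
    have : O ∈ sol t G ∅ := by
      refine (mem_sol_iff ht0 isCliqueFamily_empty mem_cliqueList_iff_or).2 fun Q hQ _ _ => ?_
      rw [Finset.univ_inter]
      exact hO Q hQ (Finset.subset_univ Q)
    have := opt_le this
    omega

end Optimum

theorem mainTheorem7 (t : ℕ) (ht : 3 ≤ t) :
    (∃ (P : Program) (C : ℕ),
      ∀ (n : ℕ) (G : SimpleGraph (Fin n)) (H : Finset (Finset (Fin n))) (lam kap : ℕ)
        (hs : List (Finset (Fin n))),
        IsCliqueFamily t G H → Enumerates hs H →
        ∃ (S : Finset (Fin n)) (steps : ℕ),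
          P.Runs (encInput G hs [lam, kap]) (encSet S) steps ∧
          steps ≤ (max n 2) ^ (C * ((lam + kap) ^ 2 + 1)) ∧
          S ∈ sol t G H ∧
          (bedPlus t G ≤ lam → opt t G H ≤ opt t G ∅ + kap → S.card = opt t G H)) ∧
    (∃ (P : Program) (C : ℕ),
      ∀ (n : ℕ) (G : SimpleGraph (Fin n)) (F : Finset (Finset (Fin n))) (lam : ℕ)
        (fs : List (Finset (Fin n))),
        IsCliqueFamily t G F → Enumerates fs F → bedPlus t G ≤ lam →
        ∃ steps : ℕ,
          P.Runs (encInput G fs [lam]) (.pair (.num (opt t G ∅)) (encBool (IsClean t G F))) steps ∧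
          steps ≤ (max n 2) ^ (C * (lam ^ 2 + 1))) := by
  have ht2 : 2 ≤ t := by omega
  have hlen : ∀ {n : ℕ} {G : SimpleGraph (Fin n)} {H : Finset (Finset (Fin n))}
      {hs : List (Finset (Fin n))}, IsCliqueFamily t G H → Enumerates hs H →
      hs.length ≤ (n + 1) ^ t := fun hH hE =>
    length_family_le hE.1 fun Z hZ => (hH Z ((hE.2 Z).1 hZ)).2.1.le
  have hKK : ∀ {n : ℕ} (G : SimpleGraph (Fin n)) {H : Finset (Finset (Fin n))}
      {hs : List (Finset (Fin n))}, Enumerates hs H →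
      ∀ S, S ∈ constraintList G t hs ↔ S ∈ H ∨ G.IsNClique t S := fun G H hs hE S => by
    rw [mem_constraintList, hE.2]
  have hB : ∀ n m : ℕ, n + 2 ≤ (n + 2) ^ (m + 1) := fun n m => Nat.le_self_pow (by omega) _
  have hpow : ∀ n m : ℕ, (n + 2) ^ m ≤ (n + 2) ^ (m + 1) := fun n m =>
    Nat.pow_le_pow_right (by omega) (by omega)
  -- The constant is that of `cost_le_pow` for the exponents a = 6t + 2000 of the main function and
  -- d = 18(t + 1) + 12000 of one level.
  refine ⟨⟨hittingProgram t, 4 * ((6 * t + 2000) + (18 * (t + 1) + 12000)), ?_⟩,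
    ⟨hittingProgram t, 4 * ((6 * t + 2000) + (18 * (t + 1) + 12000)), ?_⟩⟩
  · intro n G H lam kap hs hH hE
    obtain ⟨c, hrun, hc⟩ := calls_main_solution (hB n (lam + kap)) G (hlen hH hE) lam kap
      (hpow n (lam + kap))
    exact ⟨_, c, hrun, hc.trans (cost_le_pow lam (lam + kap) _ _ (Nat.le_add_right _ _) _),
      solve_spec ht2 hH (hKK G hE) lam kap⟩
  · intro n G F lam fs hF hE hbed
    obtain ⟨c, hrun, hc⟩ := calls_main_decision (hB n lam) G (hlen hF hE) lam (hpow n lam)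
    refine ⟨c, ?_, hc.trans (cost_le_pow lam lam _ _ le_rfl _)⟩
    obtain ⟨-, h1⟩ := solve_spec ht2 isCliqueFamily_empty (mem_cliqueList_iff_or (G := G)) lam 0
    obtain ⟨hsol, h2⟩ := solve_spec ht2 hF (hKK G hE) lam 0
    have h1 := h1 hbed le_rfl
    have hle : opt t G ∅ ≤ opt t G F := by
      obtain ⟨S, hS, hcard⟩ := exists_card_eq_opt hsol
      rw [← hcard]
      exact opt_le ⟨hS.1, fun Z hZ => absurd hZ (Finset.notMem_empty Z)⟩
    rw [h1] at hrun
    -- The output for F is always a solution, so opt(G) ≤ opt(G, F) ≤ its size. Size at most opt(G)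
    -- thus proves cleanness; conversely, if (G, F) is clean, the excess bound 0 holds and the
    -- output is optimal.
    rw [encBool_congr (show IsClean t G F ↔ _ from
      ⟨fun h => (h2 hbed h.le).le.trans h.le, fun h => ((opt_le hsol).trans h).antisymm hle⟩)]
    exact hrun
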